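/- Let $R,\mu>0$ be fixed. For $\delta>0$ let $D_1,D_2\subset\mathbb{R}^2$ be the open disks of radius $R$ centred at $(-R-\delta/2,0)$ and $(R+\delta/2,0)$, and let $D^e=\mathbb{R}^2\setminus\overline{D_1\cup D_2}$. Consider the exterior Stokes problem $$\mu\Delta \mathbf h=\nabla p,\quad \nabla\cdot\mathbf h=0 \ \text{ in } D^e,\qquad \mathbf h(x,y)=\begin{bmatrix} y\\-x\end{bmatrix}\ \text{ on }\partial D_1\cup\partial D_2,$$ with the decay conditions, as $|\mathbf x|\to\infty$, $$\mathbf h(\mathbf x)=\mathbf C+O(|\mathbf x|^{-1}),\qquad \nabla\mathbf h(\mathbf x)=O(|\mathbf x|^{-2}),\qquad p(\mathbf x)=O(|\mathbf x|^{-2})$$ for some constant vector $\mathbf C\in\mathbb{R}^2$. A solution is a pair $(\mathbf h,p)$ with $\mathbf h\in C^2(D^e)\cap C^1(\overline{D^e})$ and $p\in C^1(D^e)\cap C(\overline{D^e})$ that satisfies these equations. Write $\mathcal E[\mathbf h]=\frac12(\nabla\mathbf h+\nabla\mathbf h^T)$ and $\sigma[\mathbf h,p]=-pI+2\mu\,\mathcal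 E[\mathbf h]$, and let $\|\cdot\|_\infty$ be the supremum norm over $D^e$ (the largest absolute value of the entries, for matrices). For every $\delta>0$ a solution exists. Moreover, for every $\delta_0>0$ there is a constant $K$, which may depend on $R$, $\mu$ and $\delta_0$ but not on $\delta$, such that for every $\delta\in(0,\delta_0]$ every solution $(\mathbf h_{\rm rot},p_{\rm rot})=(\mathbf h,p)$ satisfies $$\|\mathcal E[\mathbf h_{\rm rot}]\|_\infty\le K,\qquad \|p_{\rm rot}\|_\infty\le K,\qquad \|\sigma[\mathbf h_{\rm rot},p_{\rm rot}]\|_\infty\le K .$$ -/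

import Mathlib

open scoped Laplacian Gradient
open Asymptotics Bornology

noncomputable section

namespace StokesTwoDisks

/-- The Euclidean plane. -/
abbrev Plane : Type := EuclideanSpace ℝ (Fin 2)

/-- The left disk: radius `R`, centre `(-R - δ/2, 0)`. -/
def disk1 (R δ : ℝ) : Set Plane := Metric.ball !₂[-R - δ / 2, 0] R

/-- The right disk: radius `R`, centre `(R + δ/2, 0)`. -/
def disk2 (R δ : ℝ) : Set Plane := Metric.ball !₂[R + δ / 2, 0] R

/-- The exterior domain, the complement of the closure of the two disks. -/
def exterior (R δ : ℝ) : Set Plane := (closure (disk1 R δ ∪ disk2 R δ))ᶜ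

/-- The rigid rotation field `(y, -x)`. -/
def rigidRotation (x : Plane) : Plane := !₂[x 1, -x 0]

/-- The velocity gradient at `x`; its `(i, j)` entry is `∂ⱼ uᵢ (x)`. -/
def velGrad (u : Plane → Plane) (x : Plane) : Matrix (Fin 2) (Fin 2) ℝ :=
  Matrix.of fun i j => (fderiv ℝ u x (EuclideanSpace.single j 1)) i

/-- The divergence of a planar vector field. -/
def divergence (u : Plane → Plane) (x : Plane) : ℝ := (velGrad u x).trace

/-- The strain tensor `(∇u + ∇uᵀ) / 2`. -/
def strain (u : Plane → Plane) (x : Plane) : Matrix (Fin 2) (Fin 2) ℝ :=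
  (1 / 2 : ℝ) • (velGrad u x + (velGrad u x).transpose)

/-- The stress tensor `-p I + 2 μ E[u]`. -/
def stress (μ : ℝ) (u : Plane → Plane) (p : Plane → ℝ) (x : Plane) :
    Matrix (Fin 2) (Fin 2) ℝ :=
  -(p x) • (1 : Matrix (Fin 2) (Fin 2) ℝ) + (2 * μ) • strain u x

/-- The decay class `M`: as `|x| → ∞`, `u = C + O(|x|⁻¹)` for some constant vector `C`,
`∇u = O(|x|⁻²)` and `p = O(|x|⁻²)`. -/
def DecayClass (u : Plane → Plane) (p : Plane → ℝ) : Prop :=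
  (∃ C : Plane, (fun x => u x - C) =O[cobounded Plane] fun x => ‖x‖⁻¹) ∧
    (fderiv ℝ u) =O[cobounded Plane] (fun x => (‖x‖ ^ 2)⁻¹) ∧
    p =O[cobounded Plane] fun x => (‖x‖ ^ 2)⁻¹

/-- `(u, p)` is a classical solution, with velocity gradient and pressure continuous up to the
boundary, of the exterior Stokes problem with viscosity `μ` whose velocity on the boundary of both
disks is the rotation `(y, -x)`, in the decay class `M`. The functions are total, but only their
values on the closure of the exterior domain matter. -/
structure IsRotSolution (μ R δ : ℝ) (u : Plane → Plane) (p : Plane → ℝ) : Prop where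
  velocity_interior : ContDiffOn ℝ 2 u (exterior R δ)
  pressure_interior : ContDiffOn ℝ 1 p (exterior R δ)
  velocity_closure : ContDiffOn ℝ 1 u (closure (exterior R δ))
  pressure_closure : ContinuousOn p (closure (exterior R δ))
  momentum : ∀ x ∈ exterior R δ, μ • (Δ u) x = ∇ p x
  incompressible : ∀ x ∈ exterior R δ, divergence u x = 0
  boundary : ∀ x ∈ frontier (disk1 R δ) ∪ frontier (disk2 R δ), u x = rigidRotation x
  decay : DecayClass u p

end StokesTwoDisks

end

/-! Existence and the bounds come from an explicit series solution; a uniqueness theorem then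
carries the bounds over to every solution.

Choose `α > 0` with `R cosh α = R + δ/2` and put `a = R sinh α`. The Möbius map `t = (z + a)/(z -
a)` takes the closed exterior domain into `e^{-α} ≤ |t| ≤ e^α`, the two circles to the two boundary
circles of this annulus, and infinity to `t = 1`. A velocity with real derivative `w ↦ -i (Im k) w +
conj ((x k' + l) w)`, where `k` and `l` are analytic, is divergence free and has Laplacian `2 conj
k'`, so `2μ Re k` is a pressure for it. The solution takes `k = i J φ(t)` and `l = i J τ(t)` with `J
= (t - 1)²/(2t)` and even real Laurent series `φ`, `τ` (`hasFDerivAt_hFun`); the factor `J` supplies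
the decay. On one circle the boundary condition is a recurrence for the coefficients
(`bdryCoeff_rec`). The denominators `charDen` and their tail sums solve it up to an amplitude, and
the equations at the indices 0 and 1 fix the amplitude because `ampDen` is positive. The other
circle follows since the velocity is odd.

Uniformity in `δ` has two sources. First, `ampDen` is a difference of two quantities close to 1 when
`α` is small, and `ampDen_ge` bounds it below by a multiple of `α`, so that `amp` stays bounded.
Second, multiplication by `J` replaces the coefficients by second differences, which away from index
0 are `O(α e^{-c α|n|})` with `c > 1`. Weighted by `e^{α|n|}`, their sum is bounded independently of
`α` (`exists_wnorm_bounds`). In `x k'`, the estimate `|x t'/t| ≤ sinh α` pays for the derivative.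

For uniqueness, the difference `w` of two solutions vanishes on the circles. The energy flux is cut
off where `|w| ≤ 1/m` and far away; extended by zero it is a compactly supported `C¹` field on the
plane, and the integral of its divergence is zero. Dominated convergence gives `∫ |∇w|² = 0` without
boundary integrals and without comparing the constants at infinity. So velocity gradients agree; the
pressure difference is then constant along rays to infinity, where it decays, so it vanishes. -/

noncomputable section

namespace StokesTwoDisks

section

open Real

/-! ### The coefficients of the explicit solution -/

/-- The characteristic denominators `sinh (2nα) + n sinh (2α)` of the two-cylinder problem. -/
def charDen (α : ℝ) (n : ℕ) : ℝ := sinh (n * (2 * α)) + n * sinh (2 * α)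

/-- The tail sums `∑_{j ≥ n} 1 / (E_j E_{j+1})`. -/
def tailSum (α : ℝ) (n : ℕ) : ℝ := ∑' j : ℕ, 1 / (charDen α (n + j) * charDen α (n + j + 1))

/-- The determinant that fixes the amplitude of the explicit solution. -/
def ampDen (α : ℝ) : ℝ :=
  (2 * α * cosh (2 * α) + sinh (2 * α)) / (2 * α + sinh (2 * α)) -
    4 * sinh (2 * α) ^ 2 * tailSum α 1

/-- The amplitude of the explicit solution. -/
def amp (α : ℝ) : ℝ := -2 * sinh (2 * α) / ampDen α

/-- The coefficients of the pressure series. -/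
def phiCoeff (α : ℝ) (n : ℕ) : ℝ :=
  if n = 0 then amp α / (2 * α + sinh (2 * α))
  else 2 * sinh (2 * α) * amp α * (n * tailSum α n)

/-- The coefficients of the second Goursat series. -/
def tauCoeff (α : ℝ) (n : ℕ) : ℝ :=
  if n = 0 then amp α / (2 * α + sinh (2 * α)) else amp α * (n / charDen α n)

/-! ### Lower bounds for the denominators and the determinant. -/

theorem nat_mul_sinh_le {x : ℝ} (hx : 0 ≤ x) (n : ℕ) : n * sinh x ≤ sinh (n * x) := by
  induction n with
  | zero => simp
  | succ n ih =>
    have h1 : sinh ((n + 1 : ℕ) * x) = sinh (n * x) * cosh x + cosh (n * x) * sinh x := by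
      rw [← sinh_add]; push_cast; ring_nf
    have h2 : 0 ≤ sinh (n * x) := sinh_nonneg_iff.2 (by positivity)
    have h3 : 0 ≤ sinh x := sinh_nonneg_iff.2 hx
    rw [h1]; push_cast
    nlinarith [one_le_cosh x, one_le_cosh (n * x)]

theorem charDen_ge {α : ℝ} (hα : 0 < α) (n : ℕ) : 2 * n * sinh (2 * α) ≤ charDen α n := by
  have := nat_mul_sinh_le (x := 2 * α) (by positivity) n
  unfold charDen; linarith

theorem sinh_two_mul_pos {α : ℝ} (hα : 0 < α) : 0 < sinh (2 * α) :=
  sinh_pos_iff.2 (by positivity)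

theorem charDen_pos {α : ℝ} (hα : 0 < α) {n : ℕ} (hn : 1 ≤ n) : 0 < charDen α n := by
  have h := charDen_ge hα n
  have h1 := sinh_two_mul_pos hα
  have h2 : (1 : ℝ) ≤ n := by exact_mod_cast hn
  have : 0 < 2 * (n : ℝ) * sinh (2 * α) := by positivity
  linarith

theorem sinh_le_charDen {α : ℝ} (hα : 0 < α) (n : ℕ) : sinh (n * (2 * α)) ≤ charDen α n := by
  have h1 := sinh_two_mul_pos hα
  unfold charDen
  have : 0 ≤ (n : ℝ) * sinh (2 * α) := by positivity
  linarith

theorem one_add_sq_div_two_le_cosh {y : ℝ} (hy : 0 ≤ y) : 1 + y ^ 2 / 2 ≤ cosh y := by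
  have h1 : cosh y = 1 + 2 * sinh (y / 2) ^ 2 := by
    rw [sinh_sq, ← sub_eq_zero]
    have := cosh_two_mul (y / 2)
    rw [sinh_sq, mul_div_cancel₀ y two_ne_zero] at this
    linarith
  have h2 : y / 2 ≤ sinh (y / 2) := self_le_sinh_iff.2 (by positivity)
  rw [h1]
  nlinarith

/-- An elementary exponential lower bound for `sinh`. -/
theorem mul_exp_le_sinh (y : ℝ) : y * exp y ≤ sinh y * (1 + 2 * y) := by
  have h1 : 1 + 2 * y ≤ exp (2 * y) := by linarith [add_one_le_exp (2 * y)]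
  have h2 : exp (2 * y) * exp (-y) = exp y := by rw [← exp_add]; ring_nf
  have h3 := exp_pos (-y)
  rw [sinh_eq]
  nlinarith [mul_le_mul_of_nonneg_right h1 h3.le]

theorem inv_charDen_le {α : ℝ} (hα : 0 < α) (n : ℕ) :
    1 / charDen α (n + 1) ≤ 1 / sinh (2 * α) * exp (-(2 * α)) ^ n := by
  have hs := sinh_two_mul_pos hα
  have h1 : sinh (2 * α) * exp (2 * α) ^ n ≤ sinh ((n + 1 : ℕ) * (2 * α)) := by
    have h2 : sinh ((n + 1 : ℕ) * (2 * α)) =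
        sinh (2 * α) * cosh (n * (2 * α)) + cosh (2 * α) * sinh (n * (2 * α)) := by
      rw [← sinh_add]; push_cast; ring_nf
    have h3 : exp (2 * α) ^ n = cosh (n * (2 * α)) + sinh (n * (2 * α)) := by
      rw [cosh_add_sinh, ← exp_nat_mul]
    have h4 : 0 ≤ sinh (n * (2 * α)) := sinh_nonneg_iff.2 (by positivity)
    have h5 : sinh (2 * α) ≤ cosh (2 * α) := (sinh_lt_cosh _).le
    rw [h2, h3]; nlinarith
  have h2 := h1.trans (sinh_le_charDen hα _)
  rw [exp_neg, inv_pow, ← one_div, one_div_mul_one_div]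
  exact one_div_le_one_div_of_le (by positivity) h2

/-- The linear lower bound on each denominator turns the series into a telescoping one. Used from
index 1 to infinity it gives only `ampDen α ≥ 0`; `ampDen_ge` improves it on the far part of the
sum. -/
theorem charDen_tail_term_le {α : ℝ} (hα : 0 < α) {n : ℕ} (hn : 1 ≤ n) :
    1 / (charDen α n * charDen α (n + 1)) ≤
      1 / (4 * sinh (2 * α) ^ 2) * (1 / n - 1 / ((n : ℝ) + 1)) := by
  have hs := sinh_two_mul_pos hα
  have h1 := charDen_ge hα n
  have h2 := charDen_ge hα (n + 1)
  have hn' : (0 : ℝ) < n := by exact_mod_cast hn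
  have h3 : 1 / (4 * sinh (2 * α) ^ 2) * (1 / n - 1 / ((n : ℝ) + 1)) =
      1 / ((2 * n * sinh (2 * α)) * (2 * ((n + 1 : ℕ) : ℝ) * sinh (2 * α))) := by
    push_cast; field_simp; ring
  rw [h3]
  apply one_div_le_one_div_of_le (by positivity)
  exact mul_le_mul h1 h2 (by positivity) (charDen_pos hα hn).le

theorem charDen_tail_term_nonneg {α : ℝ} (hα : 0 < α) {n : ℕ} (hn : 1 ≤ n) :
    0 ≤ 1 / (charDen α n * charDen α (n + 1)) := by
  have h1 := charDen_pos hα hn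
  have h2 := charDen_pos hα (n := n + 1) (by omega)
  positivity

/-- Geometric decay with constants that degenerate as `α → 0`: it serves convergence at fixed `α`,
never the uniform estimates. -/
theorem charDen_tail_term_le_exp {α : ℝ} (hα : 0 < α) {n : ℕ} (hn : 1 ≤ n) :
    1 / (charDen α n * charDen α (n + 1)) ≤
      (1 / sinh (2 * α)) ^ 2 * exp (2 * α) * exp (-(4 * α)) ^ n := by
  obtain ⟨m, rfl⟩ : ∃ m, n = m + 1 := ⟨n - 1, by omega⟩
  have hs := sinh_two_mul_pos hα
  have h1 := inv_charDen_le hα m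
  have h2 := inv_charDen_le hα (m + 1)
  have h3 := charDen_pos hα (n := m + 2) (by omega)
  rw [← one_div_mul_one_div]
  refine (mul_le_mul h1 h2 (by positivity) (by positivity)).trans (le_of_eq ?_)
  have h4 : exp (-(2 * α)) ^ m * exp (-(2 * α)) ^ (m + 1) =
      exp (2 * α) * exp (-(4 * α)) ^ (m + 1) := by
    simp only [← exp_nat_mul, ← exp_add]; push_cast; ring_nf
  calc _ = (1 / sinh (2 * α)) ^ 2 * (exp (-(2 * α)) ^ m * exp (-(2 * α)) ^ (m + 1)) := by ring
    _ = _ := by rw [h4]; ring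

theorem exp_neg_four_lt_one {α : ℝ} (hα : 0 < α) : exp (-(4 * α)) < 1 :=
  by rw [exp_lt_one_iff]; linarith

theorem summable_tail {α : ℝ} (hα : 0 < α) {n : ℕ} (hn : 1 ≤ n) :
    Summable fun j : ℕ => 1 / (charDen α (n + j) * charDen α (n + j + 1)) := by
  refine Summable.of_nonneg_of_le (fun j => charDen_tail_term_nonneg hα (by omega))
    (fun j => charDen_tail_term_le_exp hα (by omega)) ?_
  simp_rw [pow_add]
  exact ((summable_geometric_of_lt_one (exp_pos _).le (exp_neg_four_lt_one hα)).mul_left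
    _).mul_left _

theorem tailSum_eq {α : ℝ} (hα : 0 < α) {n : ℕ} (hn : 1 ≤ n) :
    tailSum α n = 1 / (charDen α n * charDen α (n + 1)) + tailSum α (n + 1) := by
  unfold tailSum
  rw [(summable_tail hα hn).tsum_eq_zero_add]
  simp only [add_zero]
  congr 1
  refine tsum_congr fun j => ?_
  rw [show n + (j + 1) = n + 1 + j by ring]

theorem tailSum_nonneg {α : ℝ} (hα : 0 < α) {n : ℕ} (hn : 1 ≤ n) : 0 ≤ tailSum α n :=
  tsum_nonneg fun j => charDen_tail_term_nonneg hα (by omega)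

theorem tailSum_le_exp {α : ℝ} (hα : 0 < α) : ∃ K : ℝ, 0 ≤ K ∧ ∀ n : ℕ, 1 ≤ n →
    tailSum α n ≤ K * exp (-(4 * α)) ^ n := by
  have hq := exp_neg_four_lt_one hα
  have hg := summable_geometric_of_lt_one (exp_pos (-(4 * α))).le hq
  refine ⟨(1 / sinh (2 * α)) ^ 2 * exp (2 * α) * ∑' j : ℕ, exp (-(4 * α)) ^ j, ?_, ?_⟩
  · have : 0 ≤ ∑' j : ℕ, exp (-(4 * α)) ^ j := tsum_nonneg fun j => by positivity
    positivity
  · intro n hn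
    have h1 : tailSum α n ≤ ∑' j : ℕ, ((1 / sinh (2 * α)) ^ 2 * exp (2 * α) *
        exp (-(4 * α)) ^ n) * exp (-(4 * α)) ^ j := by
      refine (summable_tail hα hn).tsum_le_tsum (fun j => ?_) (hg.mul_left _)
      refine (charDen_tail_term_le_exp hα (by omega)).trans (le_of_eq ?_)
      rw [pow_add]; ring
    rw [tsum_mul_left] at h1
    linarith

theorem tailSum_le {α : ℝ} (hα : 0 < α) {n : ℕ} (hn : 1 ≤ n) {κ : ℝ} (hκ : 0 ≤ κ)
    (h : ∀ j, n ≤ j → 1 / (charDen α j * charDen α (j + 1)) ≤ κ * (1 / j - 1 / ((j : ℝ) + 1))) :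
    tailSum α n ≤ κ / n := by
  refine Real.tsum_le_of_sum_range_le (fun j => charDen_tail_term_nonneg hα (by omega))
    fun m => ?_
  have hn' : (0 : ℝ) < n := by exact_mod_cast hn
  have key : ∑ j ∈ Finset.range m, 1 / (charDen α (n + j) * charDen α (n + j + 1)) ≤
      κ * (1 / n - 1 / ((n : ℝ) + m)) := by
    induction m with
    | zero => simp
    | succ m ih =>
      rw [Finset.sum_range_succ]
      have := h (n + m) (by omega)
      push_cast at this ⊢
      rw [← add_assoc]
      linarith
  have : 0 ≤ κ * (1 / ((n : ℝ) + m)) := by positivity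
  calc _ ≤ _ := key
    _ ≤ κ * (1 / n) := by linarith
    _ = κ / n := by ring

/-- A quantitative lower bound for the determinant, of the order of the half-gap parameter. -/
theorem ampDen_ge {α : ℝ} (hα : 0 < α) : α / (4 + 4 * α) ≤ ampDen α := by
  have hs := sinh_two_mul_pos hα
  have h1 : 1 ≤ (2 * α * cosh (2 * α) + sinh (2 * α)) / (2 * α + sinh (2 * α)) := by
    rw [one_le_div (by positivity)]
    nlinarith [one_le_cosh (2 * α)]
  -- `N` is of order `1/α`: beyond it the exponential growth of `sinh` has doubled the linear lower
  -- bound on the denominators.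
  obtain ⟨N, hN0, hN1, hN2⟩ : ∃ N : ℕ, 2 ≤ N ∧ 2 / α ≤ N - 1 ∧ (N : ℝ) < 2 / α + 2 := by
    refine ⟨⌈2 / α⌉₊ + 1, ?_, ?_, ?_⟩
    · have : 0 < ⌈2 / α⌉₊ := Nat.ceil_pos.2 (by positivity)
      omega
    · push_cast; linarith [Nat.le_ceil (2 / α)]
    · push_cast; linarith [Nat.ceil_lt_add_one (a := 2 / α) (by positivity)]
  have hN0' : (2 : ℝ) ≤ N := by exact_mod_cast hN0
  have hbig : ∀ j : ℕ, N ≤ j → 4 * j * sinh (2 * α) ≤ charDen α j := by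
    intro j hj
    have hj' : (N : ℝ) ≤ j := by exact_mod_cast hj
    -- Splitting `j` into two nearly equal halves makes both `cosh` factors in the addition formula
    -- at least 3, since `i * (2α) ≥ (j - 1) α ≥ 2`. Hence `sinh (j * 2α) ≥ 3 j sinh (2α)`.
    obtain ⟨i, m, hij, him, hmi⟩ : ∃ i m : ℕ, j = i + m ∧ i ≤ m ∧ m ≤ i + 1 :=
      ⟨j / 2, j - j / 2, by omega, by omega, by omega⟩
    have hij' : (j : ℝ) = i + m := by exact_mod_cast hij
    have him' : (i : ℝ) ≤ m := by exact_mod_cast him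
    have hmi' : (m : ℝ) ≤ i + 1 := by exact_mod_cast hmi
    have hi2 : 2 ≤ i * (2 * α) := by
      have : 2 ≤ (j - 1 : ℝ) * α := by rw [← div_le_iff₀ hα]; linarith
      nlinarith
    have hc3 : 3 ≤ cosh (i * (2 * α)) := by
      have := one_add_sq_div_two_le_cosh (y := i * (2 * α)) (by positivity)
      nlinarith
    have hcm : cosh (i * (2 * α)) ≤ cosh (m * (2 * α)) := by
      rw [cosh_le_cosh, abs_of_nonneg (by positivity), abs_of_nonneg (by positivity)]
      gcongr
    have h2 : sinh (j * (2 * α)) = sinh (i * (2 * α)) * cosh (m * (2 * α)) +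
        cosh (i * (2 * α)) * sinh (m * (2 * α)) := by
      rw [← sinh_add, hij']; ring_nf
    have hi := nat_mul_sinh_le (x := 2 * α) (by positivity) i
    have hm := nat_mul_sinh_le (x := 2 * α) (by positivity) m
    have h3 : (i * sinh (2 * α)) * 3 ≤ sinh (i * (2 * α)) * cosh (m * (2 * α)) :=
      mul_le_mul hi (hc3.trans hcm) (by norm_num) (le_trans (by positivity) hi)
    have h4 : 3 * (m * sinh (2 * α)) ≤ cosh (i * (2 * α)) * sinh (m * (2 * α)) :=
      mul_le_mul hc3 hm (by positivity) (by linarith)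
    unfold charDen
    rw [h2, hij']
    linarith
  have htail : tailSum α N ≤ 1 / (16 * sinh (2 * α) ^ 2) / N := by
    refine tailSum_le hα (by omega) (by positivity) fun j hj => ?_
    have hj0 : (2 : ℝ) ≤ j := hN0'.trans (by exact_mod_cast hj)
    have h2 : 1 / (16 * sinh (2 * α) ^ 2) * (1 / j - 1 / ((j : ℝ) + 1)) =
        1 / ((4 * j * sinh (2 * α)) * (4 * ((j + 1 : ℕ) : ℝ) * sinh (2 * α))) := by
      push_cast; field_simp; ring
    rw [h2]
    apply one_div_le_one_div_of_le (by positivity)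
    exact mul_le_mul (hbig j hj) (hbig (j + 1) (by omega)) (by positivity)
      (charDen_pos hα (by omega)).le
  have hhead : ∀ n : ℕ, 1 ≤ n →
      tailSum α 1 ≤ 1 / (4 * sinh (2 * α) ^ 2) * (1 - 1 / n) + tailSum α n := by
    intro n hn
    induction n, hn using Nat.le_induction with
    | base => simp
    | succ n hn ih =>
      have := charDen_tail_term_le hα hn
      rw [tailSum_eq hα hn] at ih
      push_cast
      linarith
  have h2 := (hhead N (by omega)).trans (add_le_add_right htail _)
  -- The terms below `N` telescope to at most `1 - 1/N`, and the doubled denominators reduce the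
  -- rest from `1/N` to `1/(4N)`. The gain `3/(4N)` is of order `α`.
  have h3 : 4 * sinh (2 * α) ^ 2 * tailSum α 1 ≤ 1 - 3 / 4 / N := by
    calc _ ≤ 4 * sinh (2 * α) ^ 2 * (1 / (4 * sinh (2 * α) ^ 2) * (1 - 1 / N) +
          1 / (16 * sinh (2 * α) ^ 2) / N) := by gcongr
      _ = _ := by field_simp; ring
  have h4 : α / (4 + 4 * α) ≤ 3 / 4 / N := by
    rw [div_le_div_iff₀ (by positivity) (by positivity)]
    have : N * α < 2 + 2 * α := by
      calc N * α < (2 / α + 2) * α := by gcongr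
        _ = _ := by field_simp
    nlinarith
  unfold ampDen
  linarith

theorem ampDen_pos {α : ℝ} (hα : 0 < α) : 0 < ampDen α :=
  lt_of_lt_of_le (by positivity) (ampDen_ge hα)

theorem amp_eq {α : ℝ} (hα : 0 < α) : amp α * ampDen α = -2 * sinh (2 * α) := by
  unfold amp
  have := (ampDen_pos hα).ne'
  field_simp

/-- Coefficients of an even Laurent series. -/
def phiZ (α : ℝ) (n : ℤ) : ℝ := phiCoeff α n.natAbs

/-- Coefficients of an even Laurent series. -/
def tauZ (α : ℝ) (n : ℤ) : ℝ := tauCoeff α n.natAbs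

/-- Fourier coefficients of the boundary values of the solution. -/
def bdryCoeff (α : ℝ) (n : ℤ) : ℝ :=
  if n = 0 then -(phiZ α 0 * α)
  else -(phiZ α n * cosh (n * α) - tauZ α n * exp (-(n * α))) / n

/-! ### The recurrence imposed by the boundary condition. -/

theorem phiCoeff_succ (α : ℝ) (n : ℕ) :
    phiCoeff α (n + 1) = 2 * sinh (2 * α) * amp α * ((n + 1) * tailSum α (n + 1)) := by
  simp [phiCoeff]

theorem tauCoeff_succ (α : ℝ) (n : ℕ) :
    tauCoeff α (n + 1) = amp α * ((n + 1) / charDen α (n + 1)) := by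
  simp [tauCoeff]

theorem charDen_one (α : ℝ) : charDen α 1 = 2 * sinh (2 * α) := by
  simp [charDen]; ring

theorem charDen_two (α : ℝ) :
    charDen α 2 = 2 * sinh (2 * α) * (cosh (2 * α) + 1) := by
  simp only [charDen]; push_cast
  rw [sinh_two_mul]; ring

/-- This is the equation `amp_eq` for the amplitude, in the form in which the recurrence needs it at
the two inhomogeneous indices. -/
theorem phiCoeff_one_sub_one {α : ℝ} (hα : 0 < α) :
    2 * sinh (2 * α) * (phiCoeff α 1 - 1) =
      phiCoeff α 0 * (2 * α * cosh (2 * α) + sinh (2 * α)) := by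
  have h := amp_eq hα
  have hs := sinh_two_mul_pos hα
  have h0 : 2 * α + sinh (2 * α) ≠ 0 := by positivity
  rw [phiCoeff_succ α 0]
  simp only [phiCoeff, if_true, ampDen] at h ⊢
  norm_num
  field_simp at h ⊢
  linear_combination -h

theorem bdryCoeff_succ (α : ℝ) (n : ℕ) : bdryCoeff α (n + 1) =
    -(2 * sinh (2 * α) * amp α * tailSum α (n + 1)) * cosh ((n + 1) * α) +
      amp α * exp (-((n + 1) * α)) / charDen α (n + 1) := by
  have h1 : ((n : ℤ) + 1) ≠ 0 := by omega
  have h2 : ((n : ℤ) + 1).natAbs = n + 1 := by omega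
  have h3 : (n : ℝ) + 1 ≠ 0 := by positivity
  simp only [bdryCoeff, h1, if_false, phiZ, tauZ, h2, phiCoeff_succ, tauCoeff_succ]
  push_cast
  field_simp
  ring

theorem bdryCoeff_neg_succ (α : ℝ) (n : ℕ) : bdryCoeff α (-(n + 1)) =
    (2 * sinh (2 * α) * amp α * tailSum α (n + 1)) * cosh ((n + 1) * α) -
      amp α * exp ((n + 1) * α) / charDen α (n + 1) := by
  have h1 : -((n : ℤ) + 1) ≠ 0 := by omega
  have h2 : (-((n : ℤ) + 1)).natAbs = n + 1 := by omega
  have h3 : (n : ℝ) + 1 ≠ 0 := by positivity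
  have h4 : cosh ((-1 + -(n : ℝ)) * α) = cosh ((n + 1) * α) := by
    rw [← cosh_neg]; ring_nf
  simp only [bdryCoeff, h1, if_false, phiZ, tauZ, h2, phiCoeff_succ, tauCoeff_succ]
  push_cast
  rw [show -1 + -(n : ℝ) = -(n + 1) by ring] at h4
  rw [show -((n : ℝ) + 1) = -(n + 1) by ring, h4, neg_mul, neg_neg]
  field_simp

/-- The coefficient form of the boundary condition after multiplication by `t - 1`; the two `if`
terms come from `z (t - 1) = a (t + 1)`. Away from the indices 0 and 1 it holds for any amplitude,
by the one-step relation of the tail sums. -/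
theorem bdryCoeff_rec {α : ℝ} (hα : 0 < α) (n : ℤ) :
    bdryCoeff α n - exp α * bdryCoeff α (n - 1) =
      sinh α * exp (-((n - 1) * α)) * (phiZ α n - phiZ α (n - 1)) -
        (if n = 1 then exp α else 0) - (if n = 0 then 1 else 0) := by
  have hs := sinh_two_mul_pos hα
  obtain ⟨m, rfl⟩ | rfl | rfl | ⟨m, rfl⟩ :
      (∃ m : ℕ, n = m + 2) ∨ n = 1 ∨ n = 0 ∨ ∃ m : ℕ, n = -(m + 1) := by
    rcases lt_trichotomy n 0 with h | h | h
    · exact .inr (.inr (.inr ⟨(-n - 1).toNat, by omega⟩))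
    · exact .inr (.inr (.inl h))
    · by_cases h1 : n = 1
      · exact .inr (.inl h1)
      · exact .inl ⟨(n - 2).toNat, by omega⟩
  · have e1 := charDen_pos hα (n := m + 1) (by omega)
    have e2 := charDen_pos hα (n := m + 2) (by omega)
    have h1 := bdryCoeff_succ α m
    have h2 := bdryCoeff_succ α (m + 1)
    have h3 : phiZ α (m + 2) = _ := phiCoeff_succ α (m + 1)
    have h4 : phiZ α (m + 1) = _ := phiCoeff_succ α m
    have h5 := tailSum_eq hα (n := m + 1) (by omega)
    rw [show (m : ℤ) + 2 - 1 = m + 1 by ring, h3, h4, h1,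
      show ((m : ℤ) + 2) = ((m + 1 : ℕ) : ℤ) + 1 by push_cast; ring, h2, h5,
      if_neg (by omega), if_neg (by omega)]
    -- Once the tail sum at `m + 1` is expanded through the next one, `key` handles the terms with
    -- products of denominators and `key2` those with a tail sum. `key` is polynomial in `exp α` and
    -- `exp (m α)`.
    have key : 2 * sinh (2 * α) * cosh ((m + 2) * α) + exp (-((m + 2) * α)) * charDen α (m + 1) -
        exp α * exp (-((m + 1) * α)) * charDen α (m + 2) =
        -2 * (m + 2) * sinh (2 * α) * sinh α * exp (-((m + 1) * α)) := by
      simp only [charDen, sinh_eq, cosh_eq]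
      push_cast
      have g1 : exp ((m + 1) * (2 * α)) = exp (m * α) ^ 2 * exp α ^ 2 := by
        simp only [← exp_nat_mul, ← exp_add]; push_cast; ring_nf
      have g2 : exp ((m + 2) * (2 * α)) = exp (m * α) ^ 2 * exp α ^ 4 := by
        simp only [← exp_nat_mul, ← exp_add]; push_cast; ring_nf
      have g3 : exp ((m + 2) * α) = exp (m * α) * exp α ^ 2 := by
        simp only [← exp_nat_mul, ← exp_add]; push_cast; ring_nf
      have g4 : exp ((m + 1) * α) = exp (m * α) * exp α := by
        simp only [← exp_add]; ring_nf
      have g5 : exp (2 * α) = exp α ^ 2 := by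
        simp only [← exp_nat_mul]; push_cast; ring_nf
      simp only [exp_neg, g1, g2, g3, g4, g5]
      field_simp
      ring
    have key2 : cosh ((m + 2) * α) - exp α * cosh ((m + 1) * α) =
        -(sinh α * exp (-((m + 1) * α))) := by
      rw [show ((m : ℝ) + 2) * α = (m + 1) * α + α by ring, cosh_add, ← cosh_sub_sinh,
        ← cosh_add_sinh α]
      ring
    push_cast
    rw [show (m : ℝ) + 1 + 1 - 1 = m + 1 by ring, show (m : ℝ) + 1 + 1 = m + 2 by ring]
    have hp : (charDen α (m + 1))⁻¹ * charDen α (m + 1) = 1 := inv_mul_cancel₀ e1.ne'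
    have hq : (charDen α (m + 2))⁻¹ * charDen α (m + 2) = 1 := inv_mul_cancel₀ e2.ne'
    simp only [mul_inv, div_eq_mul_inv, show m + 1 + 1 = m + 2 from rfl]
    linear_combination (amp α * (charDen α (m + 1))⁻¹ * (charDen α (m + 2))⁻¹) * key -
      (2 * sinh (2 * α) * amp α * (tailSum α (m + 2) +
        (charDen α (m + 1))⁻¹ * (charDen α (m + 2))⁻¹)) * key2 -
      amp α * exp (-((m + 2) * α)) * (charDen α (m + 2))⁻¹ * hp +
      amp α * exp α * exp (-((m + 1) * α)) * (charDen α (m + 1))⁻¹ * hq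
  -- Facts for the remaining indices. At 1 and 0 the amplitude is expressed through the zeroth
  -- coefficient, so that `phiCoeff_one_sub_one` closes both cases.
  all_goals
    have h3 : phiZ α 0 = phiCoeff α 0 := rfl
    have hb : bdryCoeff α 0 = -(phiCoeff α 0 * α) := rfl
    have hq : (2 * sinh (2 * α))⁻¹ * (2 * sinh (2 * α)) = 1 := inv_mul_cancel₀ (by positivity)
    have h4 := phiCoeff_one_sub_one hα
    have h5 : phiCoeff α 0 = amp α / (2 * α + sinh (2 * α)) := by simp [phiCoeff]
    have h6 := phiCoeff_succ α 0
    have h0 : 2 * α + sinh (2 * α) ≠ 0 := by positivity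
    have h7 : amp α = phiCoeff α 0 * (2 * α + sinh (2 * α)) := by rw [h5]; field_simp
    have h8 : cosh (2 * α) = sinh (2 * α) + exp (-α) ^ 2 := by
      rw [← exp_nat_mul, ← sub_eq_iff_eq_add', cosh_sub_sinh]; push_cast; ring_nf
    have h9 : exp α * exp (-α) = 1 := by rw [← exp_add]; simp
    have h10 : sinh (2 * α) = (exp α ^ 2 - exp (-α) ^ 2) / 2 := by
      rw [sinh_eq, ← exp_nat_mul, ← exp_nat_mul]; push_cast; ring_nf
  · have h1 := bdryCoeff_succ α 0
    have h2 : phiZ α 1 = phiCoeff α 1 := rfl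
    norm_num [charDen_one] at h1 h6
    rw [← h6, h7] at h1
    norm_num [h1, h2, h3, hb]
    rw [h8] at h4
    rw [cosh_eq, sinh_eq α, div_eq_mul_inv _ (2 * sinh (2 * α))]
    linear_combination -(exp α * (2 * sinh (2 * α))⁻¹) * h4 + (exp α * (phiCoeff α 1 - 1) -
      phiCoeff α 0 * (α * exp α + (exp α - exp (-α)) / 2)) * hq -
      2 * α * exp (-α) * (2 * sinh (2 * α))⁻¹ * phiCoeff α 0 * h9
  · have h1 := bdryCoeff_neg_succ α 0
    have h2 : phiZ α (-1) = phiCoeff α 1 := rfl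
    norm_num [charDen_one] at h1 h6
    rw [← h6, h7] at h1
    norm_num [h1, h2, h3, hb]
    rw [h8] at h4
    rw [cosh_eq, sinh_eq α, div_eq_mul_inv _ (2 * sinh (2 * α))]
    linear_combination -(2 * sinh (2 * α))⁻¹ * h4 + (phiCoeff α 1 - 1 + phiCoeff α 0 *
      (α + exp α ^ 2 / 2 - 1 / 2)) * hq + (-phiCoeff α 1 + phiCoeff α 0 / 2) * h9 -
      4 * α * (2 * sinh (2 * α))⁻¹ * phiCoeff α 0 * h10
  · have e1 := charDen_pos hα (n := m + 1) (by omega)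
    have e2 := charDen_pos hα (n := m + 2) (by omega)
    have h1 := bdryCoeff_neg_succ α m
    have h2 := bdryCoeff_neg_succ α (m + 1)
    have h3 : phiZ α (-(m + 2)) = phiCoeff α (m + 2) := by
      unfold phiZ; congr 1
    have h4 : phiZ α (-(m + 1)) = phiCoeff α (m + 1) := by
      unfold phiZ; congr 1
    have h5 := tailSum_eq hα (n := m + 1) (by omega)
    have h6 := phiCoeff_succ α m
    have h7 := phiCoeff_succ α (m + 1)
    push_cast at h2 h7
    rw [show (m : ℤ) + 1 + 1 = m + 2 by ring, show (m : ℝ) + 1 + 1 = m + 2 by ring] at h2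
    rw [show (m : ℝ) + 1 + 1 = m + 2 by ring] at h7
    rw [show -((m : ℤ) + 1) - 1 = -(m + 2) by ring, h1, h2, h3, h4, h6, h7, h5,
      if_neg (by omega), if_neg (by omega)]
    have key : 2 * sinh (2 * α) * cosh ((m + 1) * α) - exp ((m + 1) * α) * charDen α (m + 2) +
        exp α * exp ((m + 2) * α) * charDen α (m + 1) =
        2 * (m + 1) * sinh (2 * α) * sinh α * exp ((m + 2) * α) := by
      simp only [charDen, sinh_eq, cosh_eq]
      push_cast
      have g1 : exp ((m + 1) * (2 * α)) = exp (m * α) ^ 2 * exp α ^ 2 := by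
        simp only [← exp_nat_mul, ← exp_add]; push_cast; ring_nf
      have g2 : exp ((m + 2) * (2 * α)) = exp (m * α) ^ 2 * exp α ^ 4 := by
        simp only [← exp_nat_mul, ← exp_add]; push_cast; ring_nf
      have g3 : exp ((m + 2) * α) = exp (m * α) * exp α ^ 2 := by
        simp only [← exp_nat_mul, ← exp_add]; push_cast; ring_nf
      have g4 : exp ((m + 1) * α) = exp (m * α) * exp α := by
        simp only [← exp_add]; ring_nf
      have g5 : exp (2 * α) = exp α ^ 2 := by
        simp only [← exp_nat_mul]; push_cast; ring_nf
      simp only [exp_neg, g1, g2, g3, g4, g5]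
      field_simp
      ring
    have key2 : cosh ((m + 1) * α) - exp α * cosh ((m + 2) * α) =
        -(sinh α * exp ((m + 2) * α)) := by
      rw [show ((m : ℝ) + 1) * α = (m + 2) * α - α by ring, cosh_sub, ← cosh_add_sinh α,
        ← cosh_add_sinh ((m + 2) * α)]
      ring
    push_cast
    rw [show -((-((m : ℝ) + 1) - 1) * α) = (m + 2) * α by ring]
    have hp : (charDen α (m + 1))⁻¹ * charDen α (m + 1) = 1 := inv_mul_cancel₀ e1.ne'
    have hq : (charDen α (m + 2))⁻¹ * charDen α (m + 2) = 1 := inv_mul_cancel₀ e2.ne'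
    simp only [mul_inv, div_eq_mul_inv, show m + 1 + 1 = m + 2 from rfl]
    linear_combination (amp α * (charDen α (m + 1))⁻¹ * (charDen α (m + 2))⁻¹) * key +
      (2 * sinh (2 * α) * amp α * tailSum α (m + 2)) * key2 +
      amp α * exp ((m + 1) * α) * (charDen α (m + 1))⁻¹ * hq -
      amp α * exp α * exp ((m + 2) * α) * (charDen α (m + 2))⁻¹ * hp

end

section

open Real

/-! ### Uniform bounds for second differences of the coefficients -/

theorem sinh_le_mul_cosh {y : ℝ} (hy : 0 ≤ y) : sinh y ≤ y * cosh y := by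
  rcases hy.eq_or_lt with rfl | hy
  · simp
  obtain ⟨c, hc, h⟩ := exists_deriv_eq_slope sinh hy continuous_sinh.continuousOn
    differentiable_sinh.differentiableOn
  have h1 : cosh c ≤ cosh y := by
    rw [cosh_le_cosh, abs_of_pos hc.1, abs_of_pos hy]; exact hc.2.le
  rw [Real.deriv_sinh, sinh_zero, sub_zero, sub_zero, eq_div_iff hy.ne'] at h
  nlinarith

theorem cosh_sub_one_le {y : ℝ} (hy : 0 ≤ y) : cosh y - 1 ≤ y ^ 2 * cosh y := by
  have h1 : cosh y = 1 + 2 * sinh (y / 2) ^ 2 := by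
    have := cosh_two_mul (y / 2)
    have h := cosh_sq (y / 2)
    rw [mul_div_cancel₀ y two_ne_zero] at this
    linarith
  have h2 : sinh (y / 2) ≤ y / 2 * cosh (y / 2) := sinh_le_mul_cosh (by positivity)
  have h3 : cosh y = 2 * cosh (y / 2) ^ 2 - 1 := by linarith [cosh_sq (y / 2)]
  have h4 : 0 ≤ sinh (y / 2) := sinh_nonneg_iff.2 (by positivity)
  have h5 : sinh (y / 2) ^ 2 ≤ (y / 2 * cosh (y / 2)) ^ 2 := by gcongr
  have h6 := mul_le_mul_of_nonneg_left (one_le_cosh y) (sq_nonneg y)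
  nlinarith

/-- This is `tanh (n x) ≤ n tanh x`. It gives the sign of the numerators in the second differences.
-/
theorem cosh_mul_sinh_le {x : ℝ} (hx : 0 ≤ x) (n : ℕ) :
    cosh x * sinh (n * x) ≤ n * sinh x * cosh (n * x) := by
  induction n with
  | zero => simp
  | succ n ih =>
    have h1 : sinh ((n + 1 : ℕ) * x) = sinh (n * x) * cosh x + cosh (n * x) * sinh x := by
      rw [← sinh_add]; push_cast; ring_nf
    have h2 : cosh ((n + 1 : ℕ) * x) = cosh (n * x) * cosh x + sinh (n * x) * sinh x := by
      rw [← cosh_add]; push_cast; ring_nf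
    have h3 : 0 ≤ sinh (n * x) := sinh_nonneg_iff.2 (by positivity)
    have h4 := mul_le_mul_of_nonneg_left ih (cosh_pos x).le
    rw [h1, h2]; push_cast
    have h5 : 0 ≤ ((n : ℝ) + 1) * (sinh x ^ 2 * sinh (n * x)) := by positivity
    nlinarith

/-- The first-order terms cancel, leaving a cubic quantity in `n x`. This cube matches the one in
`charDen_prod_ge`, so no negative power of `α` survives in the quotient. -/
theorem mul_sinh_mul_cosh_sub_le {x : ℝ} (hx : 0 ≤ x) {n : ℕ} (hn : 1 ≤ n) :
    n * sinh x * cosh (n * x) - sinh (n * x) ≤ (n * x) ^ 3 * cosh (n * x) * (1 + cosh x) := by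
  have hn' : (1 : ℝ) ≤ n := by exact_mod_cast hn
  have h1 := sinh_le_mul_cosh hx
  have h2 := mul_le_mul_of_nonneg_left (cosh_sub_one_le hx) hx
  have h3 : n * x ≤ sinh (n * x) := self_le_sinh_iff.2 (by positivity)
  have h4 := mul_le_mul_of_nonneg_left (cosh_sub_one_le (y := n * x) (by positivity))
    (show 0 ≤ n * x by positivity)
  have h5 : sinh x - x ≤ x ^ 3 * cosh x := by nlinarith
  have h6 : n * (sinh x - x) * cosh (n * x) ≤ n * (x ^ 3 * cosh x) * cosh (n * x) := by
    gcongr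
  have h7 : (n : ℝ) * (x ^ 3 * cosh x) * cosh (n * x) ≤
      n ^ 3 * (x ^ 3 * cosh x) * cosh (n * x) := by
    gcongr
    exact le_self_pow₀ hn' (by norm_num)
  nlinarith

/-- With `Y = (m + 2) * 2α`, each denominator is bounded below by `mul_exp_le_sinh`, and its factor
`1 + 2y` is absorbed in `48 exp (Y/12)`. Three such losses reduce the exponent `3Y` to `11/4 Y`; the
constant is `2 * 48³`, the 2 coming from replacing `(m+1)(m+2)(m+3)` by `(m+2)³`. -/
theorem charDen_prod_ge {α : ℝ} (hα : 0 < α) (m : ℕ) :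
    (((m : ℝ) + 2) * (2 * α)) ^ 3 * exp (11 / 4 * ((m + 2) * (2 * α))) ≤
      221184 * (charDen α (m + 1) * charDen α (m + 2) * charDen α (m + 3)) := by
  have key : ∀ j : ℕ, 1 ≤ j → j ≤ m + 3 → j * (2 * α) * exp (j * (2 * α)) ≤
      48 * exp ((m + 2) * (2 * α) / 12) * charDen α j := by
    intro j hj1 hj
    have h1 := mul_exp_le_sinh (j * (2 * α))
    have h2 := sinh_le_charDen hα j
    have h3 := add_one_le_exp ((m + 2) * (2 * α) / 12)
    have hj' : (j : ℝ) ≤ m + 3 := by exact_mod_cast hj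
    have h4 : 1 + 2 * (j * (2 * α)) ≤ 48 * exp ((m + 2) * (2 * α) / 12) := by
      have : (j : ℝ) * α ≤ (m + 3) * α := by gcongr
      have : (0 : ℝ) ≤ m * α := by positivity
      nlinarith
    calc _ ≤ _ := h1
      _ ≤ charDen α j * (48 * exp ((m + 2) * (2 * α) / 12)) :=
        mul_le_mul h2 h4 (by positivity) (charDen_pos hα hj1).le
      _ = _ := by ring
  have h1 := key (m + 1) (by omega) (by omega)
  have h2 := key (m + 2) (by omega) (by omega)
  have h3 := key (m + 3) (by omega) (by omega)
  have e1 := charDen_pos hα (n := m + 1) (by omega)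
  have e2 := charDen_pos hα (n := m + 2) (by omega)
  have e3 := charDen_pos hα (n := m + 3) (by omega)
  have h := mul_le_mul (mul_le_mul h1 h2 (by positivity) (by positivity)) h3 (by positivity)
    (by positivity)
  push_cast at h
  have g1 : exp ((m + 1) * (2 * α)) * exp ((m + 2) * (2 * α)) * exp ((m + 3) * (2 * α)) =
      exp (11 / 4 * ((m + 2) * (2 * α))) * exp ((m + 2) * (2 * α) / 12) ^ 3 := by
    simp only [← exp_nat_mul, ← exp_add]; push_cast; ring_nf
  set Q := exp ((m + 2) * (2 * α) / 12) with hQ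
  have hQ0 : 0 < Q ^ 3 := by positivity
  set P := charDen α (m + 1) * charDen α (m + 2) * charDen α (m + 3)
  set W := exp (11 / 4 * ((m + 2) * (2 * α)))
  have h' : ((m + 1) * (m + 2) * (m + 3) * (2 * α) ^ 3 * W) * Q ^ 3 ≤ (110592 * P) * Q ^ 3 := by
    calc _ = ((m : ℝ) + 1) * (m + 2) * (m + 3) * (2 * α) ^ 3 * (W * Q ^ 3) := by ring
      _ = _ := by rw [← g1]
      _ ≤ _ := le_trans (le_of_eq (by ring_nf)) (h.trans (le_of_eq (by simp only [P]; ring_nf)))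
  have h'' := le_of_mul_le_mul_right h' hQ0
  have h5 : ((m : ℝ) + 2) ^ 3 ≤ 2 * ((m + 1) * (m + 2) * (m + 3)) := by
    have : (0 : ℝ) ≤ m := by positivity
    nlinarith [pow_nonneg this 3, pow_nonneg this 2]
  have h6 : 0 ≤ (2 * α) ^ 3 * W := by positivity
  have h7 := mul_le_mul_of_nonneg_right h5 h6
  rw [mul_pow]
  linarith

/-- Half of the centred second difference of a sequence. -/
def halfDiff (c : ℤ → ℝ) (n : ℤ) : ℝ := (c (n + 1) + c (n - 1)) / 2 - c n

/-- The index multiplying the tail sum is linear, so in a second difference the tail sum at the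
middle index cancels and only finitely many explicit terms remain. -/
theorem halfDiff_phiZ {α : ℝ} (hα : 0 < α) (m : ℕ) :
    halfDiff (phiZ α) (m + 2) = 2 * sinh (2 * α) * amp α *
      ((m + 2) * sinh (2 * α) * cosh ((m + 2) * (2 * α)) -
        cosh (2 * α) * sinh ((m + 2) * (2 * α))) /
      (charDen α (m + 1) * charDen α (m + 2) * charDen α (m + 3)) := by
  have e1 := charDen_pos hα (n := m + 1) (by omega)
  have e2 := charDen_pos hα (n := m + 2) (by omega)
  have e3 := charDen_pos hα (n := m + 3) (by omega)
  have h1 : phiZ α (m + 1) = _ := phiCoeff_succ α m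
  have h2 : phiZ α (m + 2) = _ := phiCoeff_succ α (m + 1)
  have h3 : phiZ α (m + 3) = _ := phiCoeff_succ α (m + 2)
  have t1 : tailSum α (m + 1) = 1 / (charDen α (m + 1) * charDen α (m + 2)) + tailSum α (m + 2) :=
    tailSum_eq hα (n := m + 1) (by omega)
  have t2 : tailSum α (m + 2) = 1 / (charDen α (m + 2) * charDen α (m + 3)) + tailSum α (m + 3) :=
    tailSum_eq hα (n := m + 2) (by omega)
  have key : (m + 1) * charDen α (m + 3) - (m + 3) * charDen α (m + 1) =
      2 * ((m + 2) * sinh (2 * α) * cosh ((m + 2) * (2 * α)) -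
        cosh (2 * α) * sinh ((m + 2) * (2 * α))) := by
    simp only [charDen]; push_cast
    rw [show ((m : ℝ) + 3) * (2 * α) = (m + 2) * (2 * α) + 2 * α by ring,
      show ((m : ℝ) + 1) * (2 * α) = (m + 2) * (2 * α) - 2 * α by ring, sinh_add, sinh_sub]
    ring
  rw [halfDiff, show (m : ℤ) + 2 + 1 = m + 3 by ring, show (m : ℤ) + 2 - 1 = m + 1 by ring,
    h1, h2, h3, eq_div_iff (by positivity)]
  simp only [show m + 1 + 1 = m + 2 from rfl, show m + 2 + 1 = m + 3 from rfl]
  rw [t1, t2]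
  push_cast
  generalize cosh ((m + 2) * (2 * α)) = C at *
  generalize sinh ((m + 2) * (2 * α)) = S at *
  field_simp
  linear_combination amp α * key

theorem halfDiff_tauZ {α : ℝ} (hα : 0 < α) (m : ℕ) :
    halfDiff (tauZ α) (m + 2) = amp α *
      (sinh (2 * α) * (cosh ((m + 2) * (2 * α)) + 1) * ((m + 2) * sinh (2 * α) *
        cosh ((m + 2) * (2 * α)) - sinh ((m + 2) * (2 * α))) -
        (m + 2) * (cosh (2 * α) - 1) * sinh ((m + 2) * (2 * α)) *
          (cosh (2 * α) * sinh ((m + 2) * (2 * α)) + (m + 2) * sinh (2 * α))) /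
      (charDen α (m + 1) * charDen α (m + 2) * charDen α (m + 3)) := by
  have e1 := charDen_pos hα (n := m + 1) (by omega)
  have e2 := charDen_pos hα (n := m + 2) (by omega)
  have e3 := charDen_pos hα (n := m + 3) (by omega)
  have h1 : tauZ α (m + 1) = _ := tauCoeff_succ α m
  have h2 : tauZ α (m + 2) = _ := tauCoeff_succ α (m + 1)
  have h3 : tauZ α (m + 3) = _ := tauCoeff_succ α (m + 2)
  -- The two outer denominators are written as `X - Y` and `X + Y` around the middle index, which
  -- brings out the cancellations.
  have c1 : charDen α (m + 1) = cosh (2 * α) * sinh ((m + 2) * (2 * α)) + (m + 2) * sinh (2 * α) -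
      sinh (2 * α) * (cosh ((m + 2) * (2 * α)) + 1) := by
    simp only [charDen]; push_cast
    rw [show ((m : ℝ) + 1) * (2 * α) = (m + 2) * (2 * α) - 2 * α by ring, sinh_sub]
    ring
  have c2 : charDen α (m + 2) = sinh ((m + 2) * (2 * α)) + (m + 2) * sinh (2 * α) := by
    simp only [charDen]; push_cast; ring
  have c3 : charDen α (m + 3) = cosh (2 * α) * sinh ((m + 2) * (2 * α)) + (m + 2) * sinh (2 * α) +
      sinh (2 * α) * (cosh ((m + 2) * (2 * α)) + 1) := by
    simp only [charDen]; push_cast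
    rw [show ((m : ℝ) + 3) * (2 * α) = (m + 2) * (2 * α) + 2 * α by ring, sinh_add]
    ring
  rw [halfDiff, show (m : ℤ) + 2 + 1 = m + 3 by ring, show (m : ℤ) + 2 - 1 = m + 1 by ring,
    h1, h2, h3, eq_div_iff (by positivity)]
  simp only [show m + 1 + 1 = m + 2 from rfl, show m + 2 + 1 = m + 3 from rfl]
  push_cast
  field_simp
  rw [c1, c2, c3]
  ring

/-- Numerator and determinant are both of order `α`, so the quotient stays bounded as the gap
closes. -/
theorem abs_amp_le {α M : ℝ} (hα : 0 < α) (hM : α ≤ M) :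
    |amp α| ≤ 16 * (1 + M) * cosh (2 * M) := by
  have hs := sinh_two_mul_pos hα
  have hD := ampDen_ge hα
  have hD0 := ampDen_pos hα
  have h1 : sinh (2 * α) ≤ 2 * α * cosh (2 * M) := by
    have h2 : cosh (2 * α) ≤ cosh (2 * M) := by
      rw [cosh_le_cosh, abs_of_pos (by positivity), abs_of_pos (by linarith)]; linarith
    have h3 := sinh_le_mul_cosh (y := 2 * α) (by positivity)
    nlinarith
  have hc := cosh_pos (2 * M)
  have hM0 : 0 < M := hα.trans_le hM
  rw [amp, abs_div, abs_of_pos hD0, abs_mul, abs_of_pos hs, div_le_iff₀ hD0]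
  norm_num
  calc 2 * sinh (2 * α) ≤ 2 * (2 * α * cosh (2 * M)) := by gcongr
    _ = 16 * (1 + α) * cosh (2 * M) * (α / (4 + 4 * α)) := by field_simp; ring
    _ ≤ 16 * (1 + M) * cosh (2 * M) * ampDen α := by gcongr

theorem cosh_le_exp' {y : ℝ} (hy : 0 ≤ y) : cosh y ≤ exp y := by
  rw [← cosh_add_sinh]; linarith [sinh_nonneg_iff.2 hy]

theorem abs_halfDiff_phiZ_le {α M : ℝ} (hα : 0 < α) (hM : α ≤ M) (m : ℕ) :
    |halfDiff (phiZ α) (m + 2)| ≤ 221184 * 16 * 8 * (1 + M) * cosh (2 * M) ^ 3 * α *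
      exp (-(2 * α * (m + 2))) := by
  have hs := sinh_two_mul_pos hα
  have hA := abs_amp_le hα hM
  have hM0 : 0 < M := hα.trans_le hM
  set B := cosh (2 * M) with hB
  have hB1 : 1 ≤ B := one_le_cosh _
  have hcB : cosh (2 * α) ≤ B := by
    rw [cosh_le_cosh, abs_of_pos (by positivity), abs_of_pos (by linarith)]; linarith
  have hsB : sinh (2 * α) ≤ 2 * α * B := by
    have h3 := sinh_le_mul_cosh (y := 2 * α) (by positivity)
    nlinarith
  have e1 := charDen_pos hα (n := m + 1) (by omega)
  have e2 := charDen_pos hα (n := m + 2) (by omega)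
  have e3 := charDen_pos hα (n := m + 3) (by omega)
  have hP := charDen_prod_ge hα m
  have hn1 := cosh_mul_sinh_le (x := 2 * α) (by positivity) (m + 2)
  have hn2 := mul_sinh_mul_cosh_sub_le (x := 2 * α) (by positivity) (n := m + 2) (by omega)
  push_cast at hn1 hn2
  rw [halfDiff_phiZ hα]
  set y := ((m : ℝ) + 2) * (2 * α) with hy
  have hy0 : 0 < y := by positivity
  set P := charDen α (m + 1) * charDen α (m + 2) * charDen α (m + 3)
  have hS : sinh y ≤ cosh (2 * α) * sinh y :=
    le_mul_of_one_le_left (sinh_nonneg_iff.2 hy0.le) (one_le_cosh _)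
  have hnum : |((m : ℝ) + 2) * sinh (2 * α) * cosh y - cosh (2 * α) * sinh y| ≤
      y ^ 3 * exp y * (2 * B) := by
    rw [abs_of_nonneg (by linarith)]
    calc _ ≤ y ^ 3 * cosh y * (1 + cosh (2 * α)) := by linarith
      _ ≤ _ := by
        gcongr
        · exact cosh_le_exp' hy0.le
        · linarith
  rw [abs_div, abs_of_pos (show 0 < P by positivity), div_le_iff₀ (by positivity), abs_mul, abs_mul,
    abs_of_pos (show 0 < 2 * sinh (2 * α) by positivity)]
  calc 2 * sinh (2 * α) * |amp α| * _ ≤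
      2 * (2 * α * B) * (16 * (1 + M) * B) * (y ^ 3 * exp y * (2 * B)) := by gcongr
    _ = 16 * 8 * (1 + M) * B ^ 3 * α * (y ^ 3 * exp y) := by ring
    -- The numerator grows like `exp y` against `exp (11/4 y)` in the denominators; the surplus
    -- decay `exp (-7/4 y)` is more than is claimed.
    _ = 16 * 8 * (1 + M) * B ^ 3 * α * exp (-(7 / 4 * y)) * (y ^ 3 * exp (11 / 4 * y)) := by
      have : exp y = exp (-(7 / 4 * y)) * exp (11 / 4 * y) := by rw [← exp_add]; ring_nf
      rw [this]; ring
    _ ≤ 16 * 8 * (1 + M) * B ^ 3 * α * exp (-(2 * α * (m + 2))) * (221184 * P) := by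
      have : 2 * α * (m + 2) ≤ 7 / 4 * y := by rw [hy]; nlinarith
      gcongr
    _ = _ := by ring

theorem abs_halfDiff_tauZ_le {α M : ℝ} (hα : 0 < α) (hM : α ≤ M) (m : ℕ) :
    |halfDiff (tauZ α) (m + 2)| ≤ 221184 * 16 * 16 * (1 + M) * cosh (2 * M) ^ 4 * (1 + M) * α *
      exp (-(3 / 2 * α * (m + 2))) := by
  have hs := sinh_two_mul_pos hα
  have hA := abs_amp_le hα hM
  have hM0 : 0 < M := hα.trans_le hM
  set B := cosh (2 * M) with hB
  have hB1 : 1 ≤ B := one_le_cosh _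
  have hc1 := one_le_cosh (2 * α)
  have hcB : cosh (2 * α) ≤ B := by
    rw [cosh_le_cosh, abs_of_pos (by positivity), abs_of_pos (by linarith)]; linarith
  have hsB : sinh (2 * α) ≤ 2 * α * B := by
    have h3 := sinh_le_mul_cosh (y := 2 * α) (by positivity)
    nlinarith
  have hcB2 : cosh (2 * α) - 1 ≤ 4 * α ^ 2 * B := by
    have h3 := cosh_sub_one_le (y := 2 * α) (by positivity)
    nlinarith [sq_nonneg α]
  have e1 := charDen_pos hα (n := m + 1) (by omega)
  have e2 := charDen_pos hα (n := m + 2) (by omega)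
  have e3 := charDen_pos hα (n := m + 3) (by omega)
  have hP := charDen_prod_ge hα m
  have hn1 := cosh_mul_sinh_le (x := 2 * α) (by positivity) (m + 2)
  have hn2 := mul_sinh_mul_cosh_sub_le (x := 2 * α) (by positivity) (n := m + 2) (by omega)
  push_cast at hn1 hn2
  rw [halfDiff_tauZ hα]
  set y := ((m : ℝ) + 2) * (2 * α) with hy
  have hy0 : 0 < y := by positivity
  set P := charDen α (m + 1) * charDen α (m + 2) * charDen α (m + 3)
  have hS0 : 0 ≤ sinh y := sinh_nonneg_iff.2 hy0.le
  have hS : sinh y ≤ cosh (2 * α) * sinh y := le_mul_of_one_le_left hS0 hc1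
  have hCe : cosh y ≤ exp y := cosh_le_exp' hy0.le
  have he1 : 1 ≤ exp y := one_le_exp hy0.le
  have hSe : sinh y ≤ y * exp y := (sinh_le_mul_cosh hy0.le).trans (by gcongr)
  have hX : 0 ≤ ((m : ℝ) + 2) * sinh (2 * α) * cosh y - sinh y := by linarith
  have hX' : ((m : ℝ) + 2) * sinh (2 * α) * cosh y - sinh y ≤ y ^ 3 * exp y * (2 * B) := by
    refine hn2.trans ?_
    gcongr
    linarith
  have hm : ((m : ℝ) + 2) * sinh (2 * α) ≤ y * B := by
    calc _ ≤ ((m : ℝ) + 2) * (2 * α * B) := by gcongr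
      _ = _ := by rw [hy]; ring
  -- Each of the two parts of the numerator is `O(α y³ exp (2y))`. Against `exp (11/4 y)` this
  -- leaves decay `exp (-3/4 y)`, which is the rate `3/2 α` per index.
  have t1 : sinh (2 * α) * (cosh y + 1) * (((m : ℝ) + 2) * sinh (2 * α) * cosh y - sinh y) ≤
      2 * α * B * (2 * exp y) * (y ^ 3 * exp y * (2 * B)) := by
    gcongr
    linarith
  have t2 : ((m : ℝ) + 2) * (cosh (2 * α) - 1) * sinh y *
      (cosh (2 * α) * sinh y + (m + 2) * sinh (2 * α)) ≤
      ((m : ℝ) + 2) * (4 * α ^ 2 * B) * (y * exp y) * (B * (y * exp y) + y * B * exp y) := by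
    have : ((m : ℝ) + 2) * sinh (2 * α) ≤ y * B * exp y :=
      hm.trans (le_mul_of_one_le_right (by positivity) he1)
    have : 0 ≤ cosh (2 * α) - 1 := by linarith
    gcongr
  have t2' : ((m : ℝ) + 2) * (4 * α ^ 2 * B) * (y * exp y) * (B * (y * exp y) + y * B * exp y) =
      4 * α * B ^ 2 * y ^ 3 * exp y ^ 2 := by
    rw [hy]; ring
  have t3 : 0 ≤ sinh (2 * α) * (cosh y + 1) * (((m : ℝ) + 2) * sinh (2 * α) * cosh y - sinh y) := by
    have := cosh_pos y
    positivity
  have t4 : 0 ≤ ((m : ℝ) + 2) * (cosh (2 * α) - 1) * sinh y *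
      (cosh (2 * α) * sinh y + (m + 2) * sinh (2 * α)) := by
    have : 0 ≤ cosh (2 * α) - 1 := by linarith
    positivity
  have hnum : |sinh (2 * α) * (cosh y + 1) * (((m : ℝ) + 2) * sinh (2 * α) * cosh y - sinh y) -
      ((m : ℝ) + 2) * (cosh (2 * α) - 1) * sinh y *
      (cosh (2 * α) * sinh y + (m + 2) * sinh (2 * α))| ≤ 16 * α * B ^ 2 * y ^ 3 * exp y ^ 2 := by
    rw [t2'] at t2
    have : 0 ≤ α * B ^ 2 * y ^ 3 * exp y ^ 2 := by positivity
    rw [abs_le]; constructor <;> nlinarith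
  rw [abs_div, abs_of_pos (show 0 < P by positivity), div_le_iff₀ (by positivity), abs_mul]
  calc |amp α| * _ ≤ (16 * (1 + M) * B) * (16 * α * B ^ 2 * y ^ 3 * exp y ^ 2) := by gcongr
    _ = 16 * 16 * (1 + M) * B ^ 3 * α * 1 * (y ^ 3 * exp y ^ 2) := by ring
    _ ≤ 16 * 16 * (1 + M) * B ^ 4 * α * (1 + M) * (y ^ 3 * exp y ^ 2) := by
      gcongr
      · norm_num
      · linarith
    _ = 16 * 16 * (1 + M) * B ^ 4 * α * (1 + M) * exp (-(3 / 4 * y)) *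
        (y ^ 3 * exp (11 / 4 * y)) := by
      have : exp y ^ 2 = exp (-(3 / 4 * y)) * exp (11 / 4 * y) := by
        rw [← exp_nat_mul, ← exp_add]; push_cast; ring_nf
      rw [this]; ring
    _ = 16 * 16 * (1 + M) * B ^ 4 * α * (1 + M) * exp (-(3 / 2 * α * (m + 2))) *
        (y ^ 3 * exp (11 / 4 * y)) := by
      rw [show 3 / 4 * y = 3 / 2 * α * (m + 2) by rw [hy]; ring]
    _ ≤ 16 * 16 * (1 + M) * B ^ 4 * α * (1 + M) * exp (-(3 / 2 * α * (m + 2))) * (221184 * P) := by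
      gcongr
    _ = _ := by ring

end

section

open Real

/-! ### Parity, the exceptional indices 0 and 1, and bounds at all indices. -/

theorem phiZ_neg (α : ℝ) (n : ℤ) : phiZ α (-n) = phiZ α n := by simp [phiZ]

theorem tauZ_neg (α : ℝ) (n : ℤ) : tauZ α (-n) = tauZ α n := by simp [tauZ]

theorem halfDiff_neg {c : ℤ → ℝ} (hc : ∀ n, c (-n) = c n) (n : ℤ) :
    halfDiff c (-n) = halfDiff c n := by
  unfold halfDiff
  rw [← hc (-n + 1), ← hc (-n - 1), ← hc (-n), neg_neg, show -(-n + 1) = n - 1 by ring,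
    show -(-n - 1) = n + 1 by ring]
  ring

theorem amp_eq_phiCoeff_zero {α : ℝ} (hα : 0 < α) :
    amp α = phiCoeff α 0 * (2 * α + sinh (2 * α)) := by
  have hs := sinh_two_mul_pos hα
  simp only [phiCoeff, if_true]
  field_simp

/-- The zeroth coefficient is not given by the tail formula, so the second differences at 0 and 1
are computed by hand. The summand 1 is the inhomogeneous term; it is why the bound at index 0
carries no factor `α`. -/
theorem halfDiff_phiZ_zero {α : ℝ} (hα : 0 < α) :
    halfDiff (phiZ α) 0 =
      1 + phiCoeff α 0 * (2 * α * cosh (2 * α) - sinh (2 * α)) / (2 * sinh (2 * α)) := by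
  have hs := sinh_two_mul_pos hα
  have h := phiCoeff_one_sub_one hα
  have h1 : halfDiff (phiZ α) 0 = phiCoeff α 1 - phiCoeff α 0 := by
    simp [halfDiff, phiZ]
  rw [h1]
  field_simp
  linear_combination h

theorem halfDiff_phiZ_one {α : ℝ} (hα : 0 < α) :
    halfDiff (phiZ α) 1 = phiCoeff α 0 * (sinh (2 * α) * cosh (2 * α) - 2 * α) /
      (2 * (cosh (2 * α) + 1) * sinh (2 * α)) := by
  have hs := sinh_two_mul_pos hα
  have hc := cosh_pos (2 * α)
  have h1 : halfDiff (phiZ α) 1 = (phiCoeff α 2 + phiCoeff α 0) / 2 - phiCoeff α 1 := by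
    simp [halfDiff, phiZ]
  have h2 := phiCoeff_succ α 0
  have h3 := phiCoeff_succ α 1
  have h4 := tailSum_eq hα (n := 1) le_rfl
  have h5 := amp_eq_phiCoeff_zero hα
  rw [charDen_one, charDen_two] at h4
  norm_num at h2 h3 h4
  have h6 : phiCoeff α 2 = 2 * phiCoeff α 1 - amp α / (sinh (2 * α) * (cosh (2 * α) + 1)) := by
    rw [h3, h2, h4]; field_simp; ring
  rw [h1, h6, h5, eq_div_iff (by positivity)]
  field_simp
  ring

theorem halfDiff_tauZ_zero {α : ℝ} (hα : 0 < α) :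
    halfDiff (tauZ α) 0 = amp α * (2 * α - sinh (2 * α)) /
      (2 * sinh (2 * α) * (2 * α + sinh (2 * α))) := by
  have hs := sinh_two_mul_pos hα
  have h1 : halfDiff (tauZ α) 0 = tauCoeff α 1 - tauCoeff α 0 := by
    simp [halfDiff, tauZ]
  have h2 := tauCoeff_succ α 0
  rw [charDen_one] at h2
  rw [h1, h2]
  simp only [tauCoeff, if_true]
  norm_num
  field_simp
  ring

theorem halfDiff_tauZ_one {α : ℝ} (hα : 0 < α) :
    halfDiff (tauZ α) 1 = amp α * (sinh (2 * α) - 2 * α * cosh (2 * α)) /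
      (2 * sinh (2 * α) * (1 + cosh (2 * α)) * (2 * α + sinh (2 * α))) := by
  have hs := sinh_two_mul_pos hα
  have hc := cosh_pos (2 * α)
  have h1 : halfDiff (tauZ α) 1 = (tauCoeff α 2 + tauCoeff α 0) / 2 - tauCoeff α 1 := by
    simp [halfDiff, tauZ]
  have h2 := tauCoeff_succ α 0
  have h3 := tauCoeff_succ α 1
  rw [charDen_one] at h2
  rw [charDen_two] at h3
  rw [h1, h2, h3]
  simp only [tauCoeff, if_true]
  norm_num
  field_simp
  ring

/-- Elementary estimates for the hyperbolic functions of `2α`. -/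
theorem small_hyp_bounds {α M : ℝ} (hα : 0 < α) (hM : α ≤ M) :
    2 * α ≤ sinh (2 * α) ∧ sinh (2 * α) ≤ 2 * α * cosh (2 * α) ∧
      cosh (2 * α) - 1 ≤ 4 * α ^ 2 * cosh (2 * M) ∧ cosh (2 * α) ≤ cosh (2 * M) := by
  have hcB : cosh (2 * α) ≤ cosh (2 * M) := by
    rw [cosh_le_cosh, abs_of_pos (by positivity), abs_of_pos (by linarith)]; linarith
  refine ⟨self_le_sinh_iff.2 (by positivity), sinh_le_mul_cosh (by positivity), ?_, hcB⟩
  have h3 := cosh_sub_one_le (y := 2 * α) (by positivity)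
  nlinarith [sq_nonneg α]

theorem abs_phiCoeff_zero_mul_le {α : ℝ} (hα : 0 < α) :
    |phiCoeff α 0| * (4 * α) ≤ |amp α| := by
  have h1 : 2 * α ≤ sinh (2 * α) := self_le_sinh_iff.2 (by positivity)
  rw [amp_eq_phiCoeff_zero hα, abs_mul, abs_of_pos (show 0 < 2 * α + sinh (2 * α) by linarith)]
  gcongr
  linarith

theorem abs_halfDiff_phiZ_zero_le {α M : ℝ} (hα : 0 < α) (hM : α ≤ M) :
    |halfDiff (phiZ α) 0| ≤ 1 + |amp α| * α * cosh (2 * M) := by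
  obtain ⟨h1, h2, h3, h4⟩ := small_hyp_bounds hα hM
  have hs := sinh_two_mul_pos hα
  have h5 := abs_phiCoeff_zero_mul_le hα
  rw [halfDiff_phiZ_zero hα]
  refine (abs_add_le _ _).trans ?_
  rw [abs_one, abs_div, abs_mul, abs_of_pos (show 0 < 2 * sinh (2 * α) by positivity),
    abs_of_nonneg (show 0 ≤ 2 * α * cosh (2 * α) - sinh (2 * α) by linarith)]
  gcongr
  rw [div_le_iff₀ (by positivity)]
  have hB := cosh_pos (2 * M)
  calc |phiCoeff α 0| * (2 * α * cosh (2 * α) - sinh (2 * α))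
      ≤ |phiCoeff α 0| * (2 * α * (4 * α ^ 2 * cosh (2 * M))) := by
        gcongr
        nlinarith
    _ = (|phiCoeff α 0| * (4 * α)) * (α * cosh (2 * M) * (2 * α)) := by ring
    _ ≤ |amp α| * (α * cosh (2 * M) * (2 * sinh (2 * α))) := by
        gcongr
        linarith
    _ = _ := by ring

theorem abs_halfDiff_phiZ_one_le {α M : ℝ} (hα : 0 < α) (hM : α ≤ M) :
    |halfDiff (phiZ α) 1| ≤ |amp α| * α * cosh (2 * M) := by
  obtain ⟨h1, h2, h3, h4⟩ := small_hyp_bounds hα hM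
  have hs := sinh_two_mul_pos hα
  have hc := one_le_cosh (2 * α)
  have h5 := abs_phiCoeff_zero_mul_le hα
  rw [halfDiff_phiZ_one hα, abs_div, abs_mul,
    abs_of_pos (show 0 < 2 * (cosh (2 * α) + 1) * sinh (2 * α) by positivity),
    abs_of_nonneg (show 0 ≤ sinh (2 * α) * cosh (2 * α) - 2 * α by nlinarith),
    div_le_iff₀ (by positivity)]
  have hB := cosh_pos (2 * M)
  have h6 : sinh (2 * α) * cosh (2 * α) - 2 * α ≤
      2 * α * (4 * α ^ 2 * cosh (2 * M)) * (cosh (2 * α) + 1) := by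
    calc _ ≤ 2 * α * (cosh (2 * α) - 1) * (cosh (2 * α) + 1) := by nlinarith
      _ ≤ _ := by gcongr
  calc |phiCoeff α 0| * (sinh (2 * α) * cosh (2 * α) - 2 * α)
      ≤ |phiCoeff α 0| * (2 * α * (4 * α ^ 2 * cosh (2 * M)) * (cosh (2 * α) + 1)) := by gcongr
    _ = (|phiCoeff α 0| * (4 * α)) * (α * cosh (2 * M) * (cosh (2 * α) + 1) * (2 * α)) := by ring
    _ ≤ |amp α| * (α * cosh (2 * M) * (cosh (2 * α) + 1) * (2 * sinh (2 * α))) := by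
        gcongr
        linarith
    _ = _ := by ring

theorem abs_halfDiff_tauZ_zero_le {α M : ℝ} (hα : 0 < α) (hM : α ≤ M) :
    |halfDiff (tauZ α) 0| ≤ |amp α| * α * cosh (2 * M) := by
  obtain ⟨h1, h2, h3, h4⟩ := small_hyp_bounds hα hM
  have hs := sinh_two_mul_pos hα
  rw [halfDiff_tauZ_zero hα, abs_div, abs_mul, abs_sub_comm,
    abs_of_pos (show 0 < 2 * sinh (2 * α) * (2 * α + sinh (2 * α)) by positivity),
    abs_of_nonneg (show 0 ≤ sinh (2 * α) - 2 * α by linarith), div_le_iff₀ (by positivity)]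
  have hB := cosh_pos (2 * M)
  calc |amp α| * (sinh (2 * α) - 2 * α)
      ≤ |amp α| * (α * cosh (2 * M) * (2 * (2 * α) * (2 * α + 2 * α))) := by
        have : 0 ≤ α * α ^ 2 * cosh (2 * M) := by positivity
        gcongr
        nlinarith
    _ ≤ |amp α| * (α * cosh (2 * M) * (2 * sinh (2 * α) * (2 * α + sinh (2 * α)))) := by
        gcongr
    _ = _ := by ring

theorem abs_halfDiff_tauZ_one_le {α M : ℝ} (hα : 0 < α) (hM : α ≤ M) :
    |halfDiff (tauZ α) 1| ≤ |amp α| * α * cosh (2 * M) := by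
  obtain ⟨h1, h2, h3, h4⟩ := small_hyp_bounds hα hM
  have hs := sinh_two_mul_pos hα
  have hc := one_le_cosh (2 * α)
  rw [halfDiff_tauZ_one hα, abs_div, abs_mul, abs_sub_comm,
    abs_of_pos (show 0 < 2 * sinh (2 * α) * (1 + cosh (2 * α)) * (2 * α + sinh (2 * α)) by
      positivity),
    abs_of_nonneg (show 0 ≤ 2 * α * cosh (2 * α) - sinh (2 * α) by linarith),
    div_le_iff₀ (by positivity)]
  have hB := cosh_pos (2 * M)
  calc |amp α| * (2 * α * cosh (2 * α) - sinh (2 * α))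
      ≤ |amp α| * (α * cosh (2 * M) * (2 * (2 * α) * (1 + 1) * (2 * α + 2 * α))) := by
        have : 0 ≤ α * α ^ 2 * cosh (2 * M) := by positivity
        gcongr
        nlinarith
    _ ≤ |amp α| * (α * cosh (2 * M) *
        (2 * sinh (2 * α) * (1 + cosh (2 * α)) * (2 * α + sinh (2 * α)))) := by
        gcongr
    _ = _ := by ring

/-- Puts the bounds at the exceptional indices into the exponential form used elsewhere; since `b α
≤ 2 M`, this costs only a constant. -/
theorem amp_mul_le_exp {α M : ℝ} (hα : 0 < α) (hM : α ≤ M) {b : ℝ} (hb : b ≤ 2) :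
    |amp α| * α * cosh (2 * M) ≤
      16 * (1 + M) * cosh (2 * M) * cosh (2 * M) * exp (2 * M) * α * exp (-(b * α)) := by
  have hB := cosh_pos (2 * M)
  have hM0 : 0 < M := hα.trans_le hM
  have h1 : 1 ≤ exp (2 * M) * exp (-(b * α)) := by
    rw [← exp_add]; apply one_le_exp
    nlinarith
  calc |amp α| * α * cosh (2 * M) ≤ 16 * (1 + M) * cosh (2 * M) * α * cosh (2 * M) * 1 := by
        rw [mul_one]; gcongr; exact abs_amp_le hα hM
    _ ≤ 16 * (1 + M) * cosh (2 * M) * α * cosh (2 * M) * (exp (2 * M) * exp (-(b * α))) := by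
        gcongr
    _ = _ := by ring

theorem int_natAbs_cases {n : ℤ} (hn : n ≠ 0) :
    ∃ m : ℕ, n.natAbs = m + 1 ∧ (n = (m : ℤ) + 1 ∨ n = -((m : ℤ) + 1)) :=
  ⟨n.natAbs - 1, by omega, by omega⟩

/-- Uniform bounds for the second differences of the pressure coefficients. -/
theorem exists_halfDiff_phiZ_bound (M : ℝ) : ∃ A : ℝ, ∀ α, 0 < α → α ≤ M →
    |halfDiff (phiZ α) 0| ≤ A ∧ ∀ n : ℤ, n ≠ 0 →
      |halfDiff (phiZ α) n| ≤ A * α * exp (-(2 * α * n.natAbs)) := by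
  rcases le_or_gt M 0 with hM0 | hM0
  · exact ⟨0, fun α h1 h2 => absurd (h1.trans_le h2) (not_lt.2 hM0)⟩
  set A₁ := 221184 * 16 * 8 * (1 + M) * cosh (2 * M) ^ 3
  set A₂ := 16 * (1 + M) * cosh (2 * M) * cosh (2 * M) * exp (2 * M)
  have hB := cosh_pos (2 * M)
  have hA₁ : 0 ≤ A₁ := by positivity
  have hA₂ : 0 ≤ A₂ := by positivity
  refine ⟨A₁ + A₂ * (1 + M) + 1, fun α hα hM => ⟨?_, fun n hn => ?_⟩⟩
  · have h1 := amp_mul_le_exp hα hM (b := 0) (by norm_num)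
    have h2 := abs_halfDiff_phiZ_zero_le hα hM
    norm_num at h1
    have : A₂ * α ≤ A₂ * (1 + M) := by gcongr; linarith
    linarith
  · obtain ⟨m, hm, h⟩ := int_natAbs_cases hn
    have h1 : |halfDiff (phiZ α) n| = |halfDiff (phiZ α) (m + 1)| := by
      rcases h with rfl | rfl
      · rfl
      · rw [halfDiff_neg (phiZ_neg α)]
    rw [h1, hm]
    have hA₂' : 0 ≤ A₂ * M := by positivity
    cases m with
    | zero =>
      have h2 := abs_halfDiff_phiZ_one_le hα hM
      have h3 := amp_mul_le_exp hα hM (b := 2) le_rfl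
      norm_num
      calc _ ≤ A₂ * α * exp (-(2 * α)) := h2.trans h3
        _ ≤ _ := by gcongr; nlinarith
    | succ m =>
      have h2 := abs_halfDiff_phiZ_le hα hM m
      rw [show ((m + 1 : ℕ) : ℤ) + 1 = m + 2 by push_cast; ring]
      refine h2.trans ?_
      rw [show ((m + 1 + 1 : ℕ) : ℝ) = m + 2 by push_cast; ring]
      gcongr
      nlinarith

/-- Uniform bounds for the second differences of the coefficients of the second series. -/
theorem exists_halfDiff_tauZ_bound (M : ℝ) : ∃ A : ℝ, ∀ α, 0 < α → α ≤ M →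
    |halfDiff (tauZ α) 0| ≤ A ∧ ∀ n : ℤ, n ≠ 0 →
      |halfDiff (tauZ α) n| ≤ A * α * exp (-(3 / 2 * α * n.natAbs)) := by
  rcases le_or_gt M 0 with hM0 | hM0
  · exact ⟨0, fun α h1 h2 => absurd (h1.trans_le h2) (not_lt.2 hM0)⟩
  set A₁ := 221184 * 16 * 16 * (1 + M) * cosh (2 * M) ^ 4 * (1 + M)
  set A₂ := 16 * (1 + M) * cosh (2 * M) * cosh (2 * M) * exp (2 * M)
  have hB := cosh_pos (2 * M)
  have hA₁ : 0 ≤ A₁ := by positivity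
  have hA₂ : 0 ≤ A₂ := by positivity
  refine ⟨A₁ + A₂ * (1 + M), fun α hα hM => ⟨?_, fun n hn => ?_⟩⟩
  · have h1 := amp_mul_le_exp hα hM (b := 0) (by norm_num)
    have h2 := abs_halfDiff_tauZ_zero_le hα hM
    norm_num at h1
    have : A₂ * α ≤ A₂ * (1 + M) := by gcongr; linarith
    linarith
  · obtain ⟨m, hm, h⟩ := int_natAbs_cases hn
    have h1 : |halfDiff (tauZ α) n| = |halfDiff (tauZ α) (m + 1)| := by
      rcases h with rfl | rfl
      · rfl
      · rw [halfDiff_neg (tauZ_neg α)]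
    rw [h1, hm]
    have hA₂' : 0 ≤ A₂ * M := by positivity
    cases m with
    | zero =>
      have h2 := abs_halfDiff_tauZ_one_le hα hM
      have h3 := amp_mul_le_exp hα hM (b := 3 / 2) (by norm_num)
      norm_num
      calc _ ≤ A₂ * α * exp (-(3 / 2 * α)) := h2.trans h3
        _ ≤ _ := by gcongr; nlinarith
    | succ m =>
      have h2 := abs_halfDiff_tauZ_le hα hM m
      rw [show ((m + 1 : ℕ) : ℤ) + 1 = m + 2 by push_cast; ring]
      refine h2.trans ?_
      rw [show ((m + 1 + 1 : ℕ) : ℝ) = m + 2 by push_cast; ring]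
      gcongr
      nlinarith

/-! ### Weighted sums of the coefficients, uniform in the gap. -/

theorem summable_pow_natAbs {r : ℝ} (hr0 : 0 ≤ r) (hr : r < 1) :
    Summable fun n : ℤ => r ^ n.natAbs :=
  .of_nat_of_neg (by simpa using summable_geometric_of_lt_one hr0 hr)
    (by simpa using summable_geometric_of_lt_one hr0 hr)

theorem tsum_pow_natAbs_le {r : ℝ} (hr0 : 0 ≤ r) (hr : r < 1) :
    ∑' n : ℤ, r ^ n.natAbs ≤ 2 / (1 - r) := by
  have hg := hasSum_geometric_of_lt_one hr0 hr
  have h1 : HasSum (fun n : ℕ => r ^ (-((n : ℤ) + 1)).natAbs) (r * (1 - r)⁻¹) := by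
    have e : (fun n : ℕ => r ^ (-((n : ℤ) + 1)).natAbs) = fun n => r * r ^ n := funext fun n => by
      rw [show (-((n : ℤ) + 1)).natAbs = n + 1 by omega, pow_succ']
    rw [e]
    exact hg.mul_left r
  have h2 : HasSum (fun n : ℕ => r ^ (n : ℤ).natAbs) (1 - r)⁻¹ := by simpa using hg
  rw [(HasSum.of_nat_of_neg_add_one (f := fun n : ℤ => r ^ n.natAbs) h2 h1).tsum_eq]
  have h3 : 0 < 1 - r := by linarith
  rw [div_eq_mul_inv]
  have : 0 ≤ (1 - r)⁻¹ := inv_nonneg.2 h3.le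
  have := mul_le_mul_of_nonneg_right hr.le this
  linarith

/-- Weighted summability of the coefficients of a Laurent series. -/
def WSummable (ρ : ℝ) (c : ℤ → ℝ) : Prop := Summable fun n : ℤ => |c n| * ρ ^ n.natAbs

/-- The weighted `ℓ¹` norm of the coefficients of a Laurent series. -/
def wnorm (ρ : ℝ) (c : ℤ → ℝ) : ℝ := ∑' n : ℤ, |c n| * ρ ^ n.natAbs

/-- The weight `exp (α|n|)` leaves `α exp (-α|n|/2)`. About `1/α` indices contribute, so the factor
`α` exactly balances the length of the sum. -/
theorem wnorm_le_of_bound {α A : ℝ} (hα : 0 < α) {c : ℤ → ℝ} (h0 : |c 0| ≤ A)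
    (h : ∀ n, n ≠ 0 → |c n| ≤ A * α * exp (-(3 / 2 * α * n.natAbs))) :
    WSummable (exp α) c ∧ wnorm (exp α) c ≤ A + 2 * A * (2 + α) := by
  have hA : 0 ≤ A := (abs_nonneg _).trans h0
  have hr0 := (exp_pos (-(α / 2))).le
  have hr : exp (-(α / 2)) < 1 := by rw [exp_lt_one_iff]; linarith
  have hs := (summable_pow_natAbs hr0 hr).mul_left (A * α)
  have hd : Summable fun n : ℤ => if n = 0 then A else 0 :=
    summable_of_ne_finset_zero (s := {0}) fun n hn => if_neg (by simpa using hn)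
  have hle : ∀ n : ℤ, |c n| * exp α ^ n.natAbs ≤
      (if n = 0 then A else 0) + A * α * exp (-(α / 2)) ^ n.natAbs := by
    intro n
    split_ifs with hn
    · subst hn
      simp only [Int.natAbs_zero, pow_zero, mul_one]
      have : 0 ≤ A * α := by positivity
      linarith
    · rw [zero_add]
      calc _ ≤ A * α * exp (-(3 / 2 * α * n.natAbs)) * exp α ^ n.natAbs := by
            gcongr; exact h n hn
        _ = _ := by
          simp only [← exp_nat_mul]
          rw [mul_assoc, ← exp_add]; ring_nf
  have hsum : WSummable (exp α) c :=
    .of_nonneg_of_le (fun n => by positivity) hle (hd.add hs)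
  refine ⟨hsum, (hsum.tsum_le_tsum hle (hd.add hs)).trans ?_⟩
  rw [hd.tsum_add hs, tsum_ite_eq, tsum_mul_left, add_le_add_iff_left]
  have h1 := tsum_pow_natAbs_le hr0 hr
  have h2 : α / (2 + α) ≤ 1 - exp (-(α / 2)) := by
    have h3 := add_one_le_exp (α / 2)
    have h4 : exp (-(α / 2)) ≤ (α / 2 + 1)⁻¹ := by
      rw [exp_neg]; exact inv_anti₀ (by positivity) h3
    have h5 : (α / 2 + 1)⁻¹ = 1 - α / (2 + α) := by field_simp; ring
    linarith
  calc A * α * ∑' n : ℤ, exp (-(α / 2)) ^ n.natAbs ≤ A * α * (2 / (α / (2 + α))) := by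
        gcongr
        exact h1.trans (by gcongr)
    _ = _ := by field_simp

/-- The uniform summation bounds behind the main theorem. -/
theorem exists_wnorm_bounds {M : ℝ} (hM : 0 < M) : ∃ K : ℝ, ∀ α, 0 < α → α ≤ M →
    (WSummable (exp α) (halfDiff (phiZ α)) ∧ wnorm (exp α) (halfDiff (phiZ α)) ≤ K) ∧
    (WSummable (exp α) (halfDiff (tauZ α)) ∧ wnorm (exp α) (halfDiff (tauZ α)) ≤ K) ∧
    (WSummable (exp α) (fun n => sinh α * (n * halfDiff (phiZ α) n)) ∧
      wnorm (exp α) (fun n => sinh α * (n * halfDiff (phiZ α) n)) ≤ K) := by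
  obtain ⟨A, hA⟩ := exists_halfDiff_phiZ_bound M
  obtain ⟨A', hA'⟩ := exists_halfDiff_tauZ_bound M
  have hA0 : 0 ≤ A := (abs_nonneg _).trans (hA M hM le_rfl).1
  have hA0' : 0 ≤ A' := (abs_nonneg _).trans (hA' M hM le_rfl).1
  have hBp := cosh_pos M
  set A'' := A * (2 * cosh M) with hA''
  have hA0'' : 0 ≤ A'' := by positivity
  set T := A + A' + A'' with hT
  refine ⟨T + 2 * T * (2 + M), fun α hα hαM => ?_⟩
  have hmono : ∀ {c : ℤ → ℝ} {B : ℝ}, 0 ≤ B → B ≤ T →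
      (WSummable (exp α) c ∧ wnorm (exp α) c ≤ B + 2 * B * (2 + α)) →
      WSummable (exp α) c ∧ wnorm (exp α) c ≤ T + 2 * T * (2 + M) := by
    intro c B hB hBT h
    refine ⟨h.1, h.2.trans ?_⟩
    gcongr
  have hexp : ∀ n : ℤ, exp (-(2 * α * n.natAbs)) ≤ exp (-(3 / 2 * α * n.natAbs)) := by
    intro n
    have : 0 ≤ α * n.natAbs := by positivity
    rw [exp_le_exp]; linarith
  obtain ⟨h0, h1⟩ := hA α hα hαM
  obtain ⟨h0', h1'⟩ := hA' α hα hαM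
  refine ⟨hmono hA0 (by linarith) (wnorm_le_of_bound hα h0 fun n hn => (h1 n hn).trans ?_),
    hmono hA0' (by linarith) (wnorm_le_of_bound hα h0' h1'),
    hmono hA0'' (by linarith) (wnorm_le_of_bound hα (by simpa using hA0'') fun n hn => ?_)⟩
  · gcongr _ * ?_
    exact hexp n
  · have hs : sinh α ≤ α * cosh M := by
      have hc : cosh α ≤ cosh M := by
        rw [cosh_le_cosh, abs_of_pos hα, abs_of_pos hM]; exact hαM
      exact (sinh_le_mul_cosh hα.le).trans (by gcongr)
    have hs0 := sinh_nonneg_iff.2 hα.le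
    -- The extra index from the derivative, paired with `sinh α = O(α)`, is absorbed by giving up
    -- decay `α/2`; the rate drops from `2α` to the `3/2 α` that `wnorm_le_of_bound` requires.
    have hn2 : α * n.natAbs ≤ 2 * exp (1 / 2 * α * n.natAbs) := by
      have := add_one_le_exp (1 / 2 * α * n.natAbs)
      linarith
    have hn3 : |(n : ℝ)| = n.natAbs := by rw [Nat.cast_natAbs, Int.cast_abs]
    rw [abs_mul, abs_mul, abs_of_nonneg hs0, hn3]
    calc sinh α * (n.natAbs * |halfDiff (phiZ α) n|)
        ≤ (α * cosh M) * (n.natAbs * (A * α * exp (-(2 * α * n.natAbs)))) := by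
          gcongr
          exact h1 n hn
      _ = A * cosh M * α * (α * n.natAbs) * exp (-(2 * α * n.natAbs)) := by ring
      _ ≤ A * cosh M * α * (2 * exp (1 / 2 * α * n.natAbs)) * exp (-(2 * α * n.natAbs)) := by
          gcongr
      _ = A * cosh M * α * 2 * (exp (1 / 2 * α * n.natAbs) * exp (-(2 * α * n.natAbs))) := by ring
      _ = _ := by rw [← exp_add, hA'']; ring_nf

theorem summable_of_natAbs_bound {f : ℤ → ℝ} {g : ℕ → ℝ} (hg : Summable g)
    (h0 : ∀ n, 0 ≤ f n) (h : ∀ n, f n ≤ g n.natAbs) : Summable f :=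
  .of_nat_of_neg (.of_nonneg_of_le (fun _ => h0 _) (fun n => by simpa using h n) hg)
    (.of_nonneg_of_le (fun _ => h0 _) (fun n => by simpa using h (-n)) hg)

theorem summable_nat_mul_exp {b : ℝ} (hb : 0 < b) : Summable fun n : ℕ => (n : ℝ) * exp (-b) ^ n := by
  have h : ‖exp (-b)‖ < 1 := by
    rw [norm_of_nonneg (exp_pos _).le, exp_lt_one_iff]; linarith
  simpa using summable_pow_mul_geometric_of_norm_lt_one 1 h

/-- The radius `exp (3/2 α)` exceeds the boundary radius `exp α`, so the explicit solution is smooth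
in a neighbourhood of the closed domain. No uniformity in `α` is involved here. -/
theorem wSummable_phiZ {α : ℝ} (hα : 0 < α) : WSummable (exp (3 / 2 * α)) (phiZ α) := by
  obtain ⟨K, hK0, hK⟩ := tailSum_le_exp hα
  have hs := sinh_two_mul_pos hα
  have hg := ((summable_nat_mul_exp (b := 5 / 2 * α) (by positivity)).mul_left
    (2 * sinh (2 * α) * |amp α| * K)).add
    (summable_of_ne_finset_zero (s := {0}) (f := fun n : ℕ => if n = 0 then |phiCoeff α 0| else 0)
      fun n hn => if_neg (by simpa using hn))
  refine summable_of_natAbs_bound hg (fun n => by positivity) fun n => ?_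
  unfold phiZ
  rcases n.natAbs with _ | m
  · simp
  · rw [phiCoeff_succ, if_neg (by omega), add_zero]
    have h1 := hK (m + 1) (by omega)
    have h2 := tailSum_nonneg hα (n := m + 1) (by omega)
    rw [abs_mul, abs_mul, abs_mul, abs_of_pos hs, abs_of_nonneg (show
      0 ≤ ((m : ℝ) + 1) * tailSum α (m + 1) by positivity), abs_two]
    calc _ ≤ 2 * sinh (2 * α) * |amp α| * ((m + 1) * (K * exp (-(4 * α)) ^ (m + 1))) *
          exp (3 / 2 * α) ^ (m + 1) := by gcongr
      _ = 2 * sinh (2 * α) * |amp α| * K * ((m + 1) * (exp (-(4 * α)) ^ (m + 1) *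
          exp (3 / 2 * α) ^ (m + 1))) := by ring
      _ = _ := by
        rw [← mul_pow, ← exp_add]; push_cast; ring_nf

theorem wSummable_tauZ {α : ℝ} (hα : 0 < α) : WSummable (exp (3 / 2 * α)) (tauZ α) := by
  have hs := sinh_two_mul_pos hα
  have hg := ((summable_nat_mul_exp (b := 1 / 2 * α) (by positivity)).mul_left
    (|amp α| * (1 / sinh (2 * α) * exp (2 * α)))).add
    (summable_of_ne_finset_zero (s := {0}) (f := fun n : ℕ => if n = 0 then |tauCoeff α 0| else 0)
      fun n hn => if_neg (by simpa using hn))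
  refine summable_of_natAbs_bound hg (fun n => by positivity) fun n => ?_
  unfold tauZ
  rcases n.natAbs with _ | m
  · simp
  · rw [tauCoeff_succ, if_neg (by omega), add_zero]
    have h1 := inv_charDen_le hα m
    have h2 := charDen_pos hα (n := m + 1) (by omega)
    rw [abs_mul, abs_of_nonneg (show 0 ≤ ((m : ℝ) + 1) / charDen α (m + 1) by positivity),
      div_eq_mul_one_div]
    calc _ ≤ |amp α| * ((m + 1) * (1 / sinh (2 * α) * exp (-(2 * α)) ^ m)) *
          exp (3 / 2 * α) ^ (m + 1) := by gcongr
      _ = |amp α| * (1 / sinh (2 * α)) * (m + 1) * (exp (-(2 * α)) ^ m *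
          exp (3 / 2 * α) ^ (m + 1)) := by ring
      _ = |amp α| * (1 / sinh (2 * α)) * (m + 1) * (exp (2 * α) *
          exp (-(1 / 2 * α)) ^ (m + 1)) := by
        congr 1
        simp only [← exp_nat_mul, ← exp_add]; push_cast; ring_nf
      _ = _ := by push_cast; ring

end

/-! ### Laurent series on annuli -/

/-- The Laurent series with real coefficients `c`. -/
def laurent (c : ℤ → ℝ) (t : ℂ) : ℂ := ∑' n : ℤ, (c n : ℂ) * t ^ n

/-- The open annulus `ρ⁻¹ < |t| < ρ`. -/
def annulus (ρ : ℝ) : Set ℂ := {t | ρ⁻¹ < ‖t‖ ∧ ‖t‖ < ρ}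

theorem isOpen_annulus (ρ : ℝ) : IsOpen (annulus ρ) :=
  (isOpen_lt continuous_const continuous_norm).inter (isOpen_lt continuous_norm continuous_const)

theorem norm_zpow_le {ρ : ℝ} (hρ : 0 < ρ) {t : ℂ} (h1 : ρ⁻¹ ≤ ‖t‖) (h2 : ‖t‖ ≤ ρ) (n : ℤ) :
    ‖t ^ n‖ ≤ ρ ^ n.natAbs := by
  have ht : 0 < ‖t‖ := (inv_pos.2 hρ).trans_le h1
  rcases Int.natAbs_eq n with h | h
  · rw [h]
    simp only [zpow_natCast, norm_pow, Int.natAbs_natCast]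
    gcongr
  · rw [h]
    simp only [zpow_neg, zpow_natCast, norm_inv, norm_pow, Int.natAbs_neg, Int.natAbs_natCast]
    rw [← inv_pow]
    gcongr
    exact inv_le_of_inv_le₀ hρ h1

theorem norm_term_le {ρ : ℝ} (hρ : 0 < ρ) {t : ℂ} (h1 : ρ⁻¹ ≤ ‖t‖) (h2 : ‖t‖ ≤ ρ) (c : ℤ → ℝ)
    (n : ℤ) : ‖(c n : ℂ) * t ^ n‖ ≤ |c n| * ρ ^ n.natAbs := by
  rw [norm_mul, Complex.norm_real, Real.norm_eq_abs]
  gcongr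
  exact norm_zpow_le hρ h1 h2 n

theorem hasSum_laurent {ρ : ℝ} (hρ : 0 < ρ) {c : ℤ → ℝ} (hc : WSummable ρ c) {t : ℂ}
    (h1 : ρ⁻¹ ≤ ‖t‖) (h2 : ‖t‖ ≤ ρ) : HasSum (fun n : ℤ => (c n : ℂ) * t ^ n) (laurent c t) :=
  (Summable.of_norm_bounded hc (norm_term_le hρ h1 h2 c)).hasSum

theorem norm_laurent_le {ρ : ℝ} (hρ : 0 < ρ) {c : ℤ → ℝ} (hc : WSummable ρ c) {t : ℂ}
    (h1 : ρ⁻¹ ≤ ‖t‖) (h2 : ‖t‖ ≤ ρ) : ‖laurent c t‖ ≤ wnorm ρ c :=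
  tsum_of_norm_bounded hc.hasSum (norm_term_le hρ h1 h2 c)

theorem ne_zero_of_mem_annulus {ρ : ℝ} (hρ : 0 < ρ) {t : ℂ} (ht : t ∈ annulus ρ) : t ≠ 0 :=
  norm_pos_iff.1 ((inv_pos.2 hρ).trans ht.1)

theorem differentiableOn_term {ρ : ℝ} (hρ : 0 < ρ) (c : ℤ → ℝ) (n : ℤ) :
    DifferentiableOn ℂ (fun t : ℂ => (c n : ℂ) * t ^ n) (annulus ρ) := fun _ ht =>
  (((differentiableAt_zpow.2 (.inl (ne_zero_of_mem_annulus hρ ht))).const_mul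
    _)).differentiableWithinAt

theorem differentiableOn_laurent {ρ : ℝ} (hρ : 0 < ρ) {c : ℤ → ℝ} (hc : WSummable ρ c) :
    DifferentiableOn ℂ (laurent c) (annulus ρ) :=
  Complex.differentiableOn_tsum_of_summable_norm hc (differentiableOn_term hρ c)
    (isOpen_annulus ρ) fun n _ ht => norm_term_le hρ ht.1.le ht.2.le c n

theorem hasSum_mul_deriv_laurent {ρ : ℝ} (hρ : 0 < ρ) {c : ℤ → ℝ} (hc : WSummable ρ c) {t : ℂ}
    (ht : t ∈ annulus ρ) :
    HasSum (fun n : ℤ => ((n * c n : ℝ) : ℂ) * t ^ n) (t * deriv (laurent c) t) := by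
  have ht0 := ne_zero_of_mem_annulus hρ ht
  have h := (Complex.hasSum_deriv_of_summable_norm hc (differentiableOn_term hρ c)
    (isOpen_annulus ρ) (fun n _ ht => norm_term_le hρ ht.1.le ht.2.le c n) ht).mul_left t
  have e : (fun n : ℤ => ((n * c n : ℝ) : ℂ) * t ^ n) =
      fun n : ℤ => t * deriv (fun t : ℂ => (c n : ℂ) * t ^ n) t := funext fun n => by
    rw [deriv_const_mul_field, deriv_zpow, zpow_sub_one₀ ht0]
    push_cast
    field_simp
  rw [e]
  exact h

theorem laurent_inv (c : ℤ → ℝ) (t : ℂ) : laurent c t⁻¹ = laurent (fun n => c (-n)) t := by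
  unfold laurent
  rw [← (Equiv.neg ℤ).tsum_eq]
  simp

theorem laurent_inv_of_even {c : ℤ → ℝ} (hc : ∀ n, c (-n) = c n) (t : ℂ) :
    laurent c t⁻¹ = laurent c t := by
  rw [laurent_inv]; simp_rw [hc]

theorem laurent_inv_of_odd {c : ℤ → ℝ} (hc : ∀ n, c (-n) = -c n) (t : ℂ) :
    laurent c t⁻¹ = -laurent c t := by
  rw [laurent_inv]; simp_rw [hc]
  simp [laurent, tsum_neg]

theorem laurent_one_of_odd {c : ℤ → ℝ} (hc : ∀ n, c (-n) = -c n) : laurent c 1 = 0 := by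
  have h := laurent_inv_of_odd hc 1
  rw [inv_one] at h
  linear_combination h / 2

theorem laurent_conj (c : ℤ → ℝ) (t : ℂ) :
    laurent c (starRingEnd ℂ t) = starRingEnd ℂ (laurent c t) := by
  unfold laurent
  rw [Complex.conj_tsum]
  simp

/-- Multiplication by `t` and `t⁻¹` shifts the index, and `(t + t⁻¹)/2 - 1 = (t - 1)²/(2t)`. -/
theorem laurent_halfDiff {ρ : ℝ} (hρ : 0 < ρ) {c : ℤ → ℝ} (hc : WSummable ρ c) {t : ℂ}
    (ht : t ∈ annulus ρ) :
    laurent (halfDiff c) t = (t - 1) ^ 2 / (2 * t) * laurent c t := by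
  have ht0 := ne_zero_of_mem_annulus hρ ht
  have h := hasSum_laurent hρ hc ht.1.le ht.2.le
  have h1 := (((Equiv.addRight (1 : ℤ)).hasSum_iff.2 h).mul_left (t⁻¹ / 2))
  have h2 := (((Equiv.addRight (-1 : ℤ)).hasSum_iff.2 h).mul_left (t / 2))
  have h3 := (h1.add h2).sub h
  have e : (fun n : ℤ => ((halfDiff c n : ℝ) : ℂ) * t ^ n) = _ := funext fun n => by
    show _ = t⁻¹ / 2 * (c (n + 1) * t ^ (n + 1)) + t / 2 * (c (n + -1) * t ^ (n + -1)) -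
      c n * t ^ n
    rw [zpow_add₀ ht0, zpow_add₀ ht0, zpow_one, zpow_neg_one, halfDiff, ← sub_eq_add_neg]
    push_cast
    field_simp
  have h4 : laurent (halfDiff c) t = _ := (congrArg tsum e).trans (HasSum.tsum_eq h3)
  rw [h4]
  field_simp
  ring

/-- Division of the coefficients by the index. -/
def divIndex (c : ℤ → ℝ) (n : ℤ) : ℝ := c n / n

theorem divIndex_neg {c : ℤ → ℝ} (hc : ∀ n, c (-n) = c n) (n : ℤ) :
    divIndex c (-n) = -divIndex c n := by
  unfold divIndex; rw [hc]; push_cast; rw [div_neg]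

theorem wSummable_divIndex {ρ : ℝ} (hρ : 0 < ρ) {c : ℤ → ℝ} (hc : WSummable ρ c) :
    WSummable ρ (divIndex c) := by
  refine Summable.of_nonneg_of_le (fun n => by positivity) (fun n => ?_) hc
  refine mul_le_mul_of_nonneg_right ?_ (by positivity)
  unfold divIndex
  rcases eq_or_ne n 0 with rfl | hn
  · simp
  · rw [abs_div]
    exact div_le_self (abs_nonneg _) (by exact_mod_cast Int.one_le_abs hn)

/-- Index division is termwise integration of `c(t)/t`. At index 0 division by zero returns 0, so
the logarithm that `c 0` would produce is missing; it reappears as the real logarithm in `hFun`. -/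
theorem mul_deriv_laurent_divIndex {ρ : ℝ} (hρ : 0 < ρ) {c : ℤ → ℝ} (hc : WSummable ρ c) {t : ℂ}
    (ht : t ∈ annulus ρ) :
    t * deriv (laurent (divIndex c)) t = laurent c t - c 0 := by
  have h := hasSum_mul_deriv_laurent hρ (wSummable_divIndex hρ hc) ht
  have h2 := (hasSum_laurent hρ hc ht.1.le ht.2.le).sub (hasSum_ite_eq (0 : ℤ) (c 0 : ℂ))
  refine h.unique (?_ : HasSum _ _)
  refine (congrArg (HasSum · _) (funext fun n => ?_)).mpr h2
  unfold divIndex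
  split_ifs with hn
  · subst hn; simp
  · have : (n : ℝ) ≠ 0 := by exact_mod_cast hn
    rw [mul_div_cancel₀ _ this, sub_zero]

section

open Complex ComplexConjugate Filter Topology

/-! ### The explicit solution in complex notation -/

/-- The Möbius map that sends the two circles to concentric circles. -/
def mob (a : ℝ) (z : ℂ) : ℂ := (z + a) / (z - a)

/-- A neighbourhood of the closed exterior domain. -/
def solDom (α a : ℝ) : Set ℂ := {z | mob a z ∈ annulus (Real.exp (3 / 2 * α))}

/-- The analytic function whose real part is the pressure, up to the factor `2μ`. -/
def kFun (α a : ℝ) (z : ℂ) : ℂ := I * laurent (halfDiff (phiZ α)) (mob a z)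

/-- The second analytic function in the representation of the solution. -/
def lFun (α a : ℝ) (z : ℂ) : ℂ := I * laurent (halfDiff (tauZ α)) (mob a z)

/-- The velocity field of the explicit solution. -/
def hFun (α a : ℝ) (z : ℂ) : ℂ :=
  z.re * conj (kFun α a z) - a * (laurent (divIndex (phiZ α)) (mob a z)).im +
    I * a * (conj (laurent (divIndex (tauZ α)) (mob a z)) +
      phiZ α 0 * Real.log ‖mob a z‖)

/-- The derivative of the Möbius coordinate, up to normalization. -/
def jFun (a : ℝ) (z : ℂ) : ℂ := 2 * a ^ 2 / ((z - a) * (z + a))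

theorem sub_ne_zero_of_mem_solDom {α a : ℝ} {z : ℂ} (hz : z ∈ solDom α a) : z - a ≠ 0 := by
  intro h
  have := ne_zero_of_mem_annulus (Real.exp_pos _) hz
  simp [mob, h] at this

theorem add_ne_zero_of_mem_solDom {α a : ℝ} {z : ℂ} (hz : z ∈ solDom α a) : z + a ≠ 0 := by
  intro h
  have := ne_zero_of_mem_annulus (Real.exp_pos _) hz
  simp [mob, h] at this

theorem hasDerivAt_mob {a : ℝ} {z : ℂ} (hz : z - a ≠ 0) :
    HasDerivAt (mob a) (-2 * a / (z - a) ^ 2) z := by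
  have h := ((hasDerivAt_id z).add_const (a : ℂ)).div ((hasDerivAt_id z).sub_const (a : ℂ)) hz
  refine h.congr_deriv ?_
  simp only [id]
  ring

theorem isOpen_solDom (α a : ℝ) : IsOpen (solDom α a) := by
  rw [isOpen_iff_mem_nhds]
  intro z hz
  exact (hasDerivAt_mob (sub_ne_zero_of_mem_solDom hz)).continuousAt.preimage_mem_nhds
    ((isOpen_annulus _).mem_nhds hz)

theorem wSummable_halfDiff {ρ : ℝ} (hρ : 1 ≤ ρ) {c : ℤ → ℝ} (hc : WSummable ρ c) :
    WSummable ρ (halfDiff c) := by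
  have h1 := ((Equiv.addRight (1 : ℤ)).summable_iff.2 hc).mul_left ρ
  have h2 := ((Equiv.addRight (-1 : ℤ)).summable_iff.2 hc).mul_left ρ
  refine Summable.of_nonneg_of_le (fun n => by positivity) (fun n => ?_) ((h1.add h2).add hc)
  simp only [Function.comp, Equiv.coe_addRight]
  have e1 : ρ ^ n.natAbs ≤ ρ * ρ ^ (n + 1).natAbs := by
    rw [← pow_succ']; exact pow_le_pow_right₀ hρ (by omega)
  have e2 : ρ ^ n.natAbs ≤ ρ * ρ ^ (n + -1).natAbs := by
    rw [← pow_succ']; exact pow_le_pow_right₀ hρ (by omega)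
  have e3 : |halfDiff c n| ≤ |c (n + 1)| + |c (n + -1)| + |c n| := by
    unfold halfDiff
    rw [← sub_eq_add_neg]
    have t1 := abs_sub ((c (n + 1) + c (n - 1)) / 2) (c n)
    have t2 := abs_add_le (c (n + 1)) (c (n - 1))
    rw [abs_div, abs_two] at t1
    linarith [abs_nonneg (c (n + 1)), abs_nonneg (c (n - 1))]
  calc |halfDiff c n| * ρ ^ n.natAbs ≤ (|c (n + 1)| + |c (n + -1)| + |c n|) * ρ ^ n.natAbs := by
        gcongr
    _ = |c (n + 1)| * ρ ^ n.natAbs + |c (n + -1)| * ρ ^ n.natAbs + |c n| * ρ ^ n.natAbs := by ring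
    _ ≤ |c (n + 1)| * (ρ * ρ ^ (n + 1).natAbs) + |c (n + -1)| * (ρ * ρ ^ (n + -1).natAbs) +
        |c n| * ρ ^ n.natAbs := by gcongr
    _ = _ := by ring

theorem one_le_exp_three_halves {α : ℝ} (hα : 0 < α) : 1 ≤ Real.exp (3 / 2 * α) :=
  Real.one_le_exp (by positivity)

theorem jFun_eq {a : ℝ} {z : ℂ} (h1 : z - a ≠ 0) (h2 : z + a ≠ 0) :
    (mob a z - 1) ^ 2 / (2 * mob a z) = jFun a z := by
  unfold mob jFun
  field_simp
  ring

theorem kFun_eq {α a : ℝ} (hα : 0 < α) {z : ℂ} (hz : z ∈ solDom α a) :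
    kFun α a z = I * jFun a z * laurent (phiZ α) (mob a z) := by
  rw [kFun, laurent_halfDiff (Real.exp_pos _) (wSummable_phiZ hα) hz,
    jFun_eq (sub_ne_zero_of_mem_solDom hz) (add_ne_zero_of_mem_solDom hz), mul_assoc]

theorem lFun_eq {α a : ℝ} (hα : 0 < α) {z : ℂ} (hz : z ∈ solDom α a) :
    lFun α a z = I * jFun a z * laurent (tauZ α) (mob a z) := by
  rw [lFun, laurent_halfDiff (Real.exp_pos _) (wSummable_tauZ hα) hz,
    jFun_eq (sub_ne_zero_of_mem_solDom hz) (add_ne_zero_of_mem_solDom hz), mul_assoc]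

theorem differentiableOn_mob (α a : ℝ) : DifferentiableOn ℂ (mob a) (solDom α a) := fun _ hz =>
  (hasDerivAt_mob (sub_ne_zero_of_mem_solDom hz)).differentiableAt.differentiableWithinAt

theorem differentiableOn_laurent_mob {α a : ℝ} {c : ℤ → ℝ}
    (hc : WSummable (Real.exp (3 / 2 * α)) c) :
    DifferentiableOn ℂ (fun z => laurent c (mob a z)) (solDom α a) :=
  (differentiableOn_laurent (Real.exp_pos _) hc).comp (differentiableOn_mob α a) fun _ hz => hz

theorem differentiableOn_kFun {α : ℝ} (hα : 0 < α) (a : ℝ) :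
    DifferentiableOn ℂ (kFun α a) (solDom α a) :=
  (differentiableOn_laurent_mob (wSummable_halfDiff (one_le_exp_three_halves hα)
    (wSummable_phiZ hα))).const_mul I

theorem differentiableOn_lFun {α : ℝ} (hα : 0 < α) (a : ℝ) :
    DifferentiableOn ℂ (lFun α a) (solDom α a) :=
  (differentiableOn_laurent_mob (wSummable_halfDiff (one_le_exp_three_halves hα)
    (wSummable_tauZ hα))).const_mul I

theorem hasDerivAt_laurent_divIndex_mob {α a : ℝ} {c : ℤ → ℝ}
    (hc : WSummable (Real.exp (3 / 2 * α)) c) {z : ℂ} (hz : z ∈ solDom α a) :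
    ∃ D : ℂ, HasDerivAt (fun z => laurent (divIndex c) (mob a z)) D z ∧
      a * D = -jFun a z * (laurent c (mob a z) - c 0) := by
  have h1 := sub_ne_zero_of_mem_solDom hz
  have h2 := add_ne_zero_of_mem_solDom hz
  have ht0 := ne_zero_of_mem_annulus (Real.exp_pos _) hz
  have hd := ((differentiableOn_laurent (Real.exp_pos _) (wSummable_divIndex (Real.exp_pos _)
    hc)).differentiableAt ((isOpen_annulus _).mem_nhds hz)).hasDerivAt
  refine ⟨_, hd.comp z (hasDerivAt_mob h1), ?_⟩
  have h3 := mul_deriv_laurent_divIndex (Real.exp_pos _) hc hz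
  rw [← h3]
  unfold jFun mob
  field_simp

/-- Dividing by the value at `z` moves the argument of the complex logarithm to 1, away from the
branch cut. -/
theorem hasFDerivAt_log_norm {f : ℂ → ℂ} {f' z : ℂ} (hf : HasDerivAt f f' z) (h0 : f z ≠ 0) :
    HasFDerivAt (fun z => Real.log ‖f z‖)
      (reCLM ∘L ((ContinuousLinearMap.toSpanSingleton ℂ (f' / f z)).restrictScalars ℝ)) z := by
  have h1 : HasDerivAt (fun w => Complex.log (f w / f z)) (f' / f z) z := by
    have := (hf.div_const (f z)).clog (by simp [h0])
    simpa [div_self h0] using this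
  have h2 := (reCLM.hasFDerivAt).comp z (h1.hasFDerivAt.restrictScalars ℝ)
  have h3 := h2.add_const (Real.log ‖f z‖)
  refine h3.congr_of_eventuallyEq ?_
  filter_upwards [hf.continuousAt.eventually_ne h0] with w hw
  simp only [Function.comp, reCLM_apply, log_re, norm_div]
  rw [Real.log_div (norm_ne_zero_iff.2 hw) (norm_ne_zero_iff.2 h0)]
  ring

/-- The real derivative of the velocity field. -/
def hDeriv (α a : ℝ) (z : ℂ) : ℂ →L[ℝ] ℂ :=
  (ContinuousLinearMap.toSpanSingleton ℂ (-I * (kFun α a z).im)).restrictScalars ℝ +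
    (conjCLE : ℂ →L[ℝ] ℂ) ∘L ((ContinuousLinearMap.toSpanSingleton ℂ
      (z.re * deriv (kFun α a) z + lFun α a z)).restrictScalars ℝ)

theorem hDeriv_apply (α a : ℝ) (z w : ℂ) : hDeriv α a z w =
    -I * (kFun α a z).im * w + conj ((z.re * deriv (kFun α a) z + lFun α a z) * w) := by
  simp [hDeriv, mul_comm]

/-- In this form the complex linear part is multiplication by an imaginary number and the rest is
conjugate linear, which makes incompressibility immediate and leaves only `k`, `x k'` and `l` to be
bounded. -/
theorem hasFDerivAt_hFun {α a : ℝ} (hα : 0 < α) {z : ℂ} (hz : z ∈ solDom α a) :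
    HasFDerivAt (hFun α a) (hDeriv α a z) z := by
  have h1 := sub_ne_zero_of_mem_solDom hz
  have h2 := add_ne_zero_of_mem_solDom hz
  have ht0 := ne_zero_of_mem_annulus (Real.exp_pos _) hz
  obtain ⟨D₁, hD₁, e₁⟩ := hasDerivAt_laurent_divIndex_mob (wSummable_phiZ hα) hz
  obtain ⟨D₂, hD₂, e₂⟩ := hasDerivAt_laurent_divIndex_mob (wSummable_tauZ hα) hz
  have hk := ((differentiableOn_kFun hα a).differentiableAt
    ((isOpen_solDom α a).mem_nhds hz)).hasDerivAt
  have hlog := hasFDerivAt_log_norm (hasDerivAt_mob h1) ht0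
  have elog : a * ((-2 * a / (z - a) ^ 2) / mob a z) = -jFun a z := by
    unfold jFun mob; field_simp
  set D₃ := (-2 * a / (z - a) ^ 2) / mob a z
  have g1 := ((ofRealCLM.hasFDerivAt.comp z (reCLM.hasFDerivAt (x := z)))).mul
    ((conjCLE : ℂ →L[ℝ] ℂ).hasFDerivAt.comp z (hk.hasFDerivAt.restrictScalars ℝ))
  have g2 := (ofRealCLM.hasFDerivAt.comp z (imCLM.hasFDerivAt.comp z
    (hD₁.hasFDerivAt.restrictScalars ℝ))).const_mul (a : ℂ)
  have g3 := (conjCLE : ℂ →L[ℝ] ℂ).hasFDerivAt.comp z (hD₂.hasFDerivAt.restrictScalars ℝ)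
  have g4 := (ofRealCLM.hasFDerivAt.comp z hlog).const_mul (phiZ α 0 : ℂ)
  have g := (g1.sub g2).add ((g3.add g4).const_mul (I * a))
  refine (g.congr_fderiv ?_ : HasFDerivAt (hFun α a) _ z)
  ext w
  have ek := kFun_eq hα hz
  have el := lFun_eq hα hz
  rw [hDeriv_apply]
  simp only [add_apply, sub_apply,
    smul_apply, ContinuousLinearMap.comp_apply, reCLM_apply, imCLM_apply,
    ofRealCLM_apply, ContinuousLinearMap.coe_restrictScalars',
    ContinuousLinearMap.toSpanSingleton_apply, Function.comp, smul_eq_mul]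
  have hre : ∀ x : ℂ, (x.re : ℂ) = (x + conj x) / 2 := fun x => re_eq_add_conj x
  have him : ∀ x : ℂ, (x.im : ℂ) = -(I / 2) * (x - conj x) := fun x => by
    rw [im_eq_sub_conj, div_eq_iff (by simp)]
    linear_combination (x - conj x) * I_sq
  -- The two series share their zeroth coefficient. This is what cancels the multivalued `arg t`
  -- terms, leaving only `log |t|`.
  have hτ : (tauZ α 0 : ℂ) = phiZ α 0 := rfl
  have f₁ : a * D₁ = I * kFun α a z + jFun a z * phiZ α 0 := by
    rw [e₁, ek]; linear_combination (-jFun a z * laurent (phiZ α) (mob a z)) * I_sq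
  have f₂ : a * D₂ = I * lFun α a z + jFun a z * phiZ α 0 := by
    rw [e₂, el, hτ]; linear_combination (-jFun a z * laurent (tauZ α) (mob a z)) * I_sq
  have c₁ := congrArg conj f₁
  have c₂ := congrArg conj f₂
  have c₃ := congrArg conj elog
  simp only [map_mul, map_add, map_neg, conj_ofReal, conj_I] at c₁ c₂ c₃
  simp only [ContinuousLinearEquiv.coe_coe, conjCLE_apply, hre w, hre (w * D₃), him (w * D₁),
    him (kFun α a z), map_mul, map_add, conj_ofReal]
  linear_combination (I / 2 * w) * f₁ - (I / 2 * conj w) * c₁ + (I * conj w) * c₂ +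
    (I / 2 * phiZ α 0 * w) * elog + (I / 2 * phiZ α 0 * conj w) * c₃ +
    (conj w * conj (kFun α a z) / 2 - conj w * conj (lFun α a z) +
      conj (kFun α a z) * w / 2) * I_sq

/-! ### Symmetry and boundary values of the velocity. -/

theorem mob_neg {a : ℝ} (z : ℂ) : mob a (-z) = (mob a z)⁻¹ := by
  unfold mob
  rw [inv_div, ← neg_div_neg_eq]
  congr 1 <;> ring

theorem phiZ_halfDiff_even (α : ℝ) (n : ℤ) :
    halfDiff (phiZ α) (-n) = halfDiff (phiZ α) n := halfDiff_neg (phiZ_neg α) n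

theorem kFun_neg (α a : ℝ) (z : ℂ) : kFun α a (-z) = kFun α a z := by
  unfold kFun
  rw [mob_neg, laurent_inv_of_even (phiZ_halfDiff_even α)]

theorem hFun_neg (α a : ℝ) (z : ℂ) : hFun α a (-z) = -hFun α a z := by
  unfold hFun
  rw [kFun_neg, mob_neg, laurent_inv_of_odd (divIndex_neg (phiZ_neg α)),
    laurent_inv_of_odd (divIndex_neg (tauZ_neg α)), norm_inv, Real.log_inv]
  simp only [neg_re, neg_im, map_neg, ofReal_neg]
  ring

theorem exp_zpow (x : ℝ) (n : ℤ) : Real.exp x ^ n = Real.exp (n * x) := by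
  apply ofReal_injective
  push_cast
  rw [exp_int_mul]

/-- The boundary condition in the annulus. -/
theorem boundary_series {α : ℝ} (hα : 0 < α) {e : ℂ} (he : ‖e‖ = 1) :
    (Real.sinh α : ℂ) * ((Real.exp α : ℂ) - e) * laurent (phiZ α) (e / Real.exp α) +
      ((Real.exp α : ℂ) * e - 1) * (-(1 / 2) * (laurent (divIndex (phiZ α)) (Real.exp α * e) +
        laurent (divIndex (phiZ α)) (e / Real.exp α)) +
        laurent (divIndex (tauZ α)) (e / Real.exp α) - phiZ α 0 * α) = Real.exp α * e + 1 := by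
  set u := Real.exp α with hu
  have hu0 : 0 < u := Real.exp_pos α
  have huC : (u : ℂ) ≠ 0 := by exact_mod_cast hu0.ne'
  have hu1 : 1 ≤ u := Real.one_le_exp hα.le
  have he0 : e ≠ 0 := by rw [← norm_pos_iff, he]; norm_num
  have huρ : u ≤ Real.exp (3 / 2 * α) := Real.exp_le_exp.2 (by linarith)
  have hρ0 := Real.exp_pos (3 / 2 * α)
  have n1 : ‖e / u‖ = u⁻¹ := by
    rw [norm_div, he, norm_real, Real.norm_of_nonneg hu0.le, one_div]
  have n2 : ‖u * e‖ = u := by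
    rw [norm_mul, he, norm_real, Real.norm_of_nonneg hu0.le, mul_one]
  have b1 : (Real.exp (3 / 2 * α))⁻¹ ≤ u⁻¹ := inv_anti₀ hu0 huρ
  have b2 : u⁻¹ ≤ u := (inv_le_one_of_one_le₀ hu1).trans hu1
  have sφ := hasSum_laurent hρ0 (wSummable_phiZ hα) (t := e / u) (by rw [n1]; exact b1)
    (by rw [n1]; exact b2.trans huρ)
  have sΦ := hasSum_laurent hρ0 (wSummable_divIndex hρ0 (wSummable_phiZ hα)) (t := e / u)
    (by rw [n1]; exact b1) (by rw [n1]; exact b2.trans huρ)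
  have sΦ' := hasSum_laurent hρ0 (wSummable_divIndex hρ0 (wSummable_phiZ hα)) (t := u * e)
    (by rw [n2]; exact b1.trans b2) (by rw [n2]; exact huρ)
  have sτ := hasSum_laurent hρ0 (wSummable_divIndex hρ0 (wSummable_tauZ hα)) (t := e / u)
    (by rw [n1]; exact b1) (by rw [n1]; exact b2.trans huρ)
  have sX := (((sΦ'.add sΦ).mul_left (-(1 / 2))).add sτ).sub
    (hasSum_ite_eq (0 : ℤ) ((phiZ α 0 : ℂ) * α))
  set X := -(1 / 2) * (laurent (divIndex (phiZ α)) (u * e) +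
        laurent (divIndex (phiZ α)) (e / u)) +
        laurent (divIndex (tauZ α)) (e / u) - phiZ α 0 * α
  set φ := laurent (phiZ α) (e / u)
  -- `bdryCoeff` is the Fourier coefficient of the bracket in the boundary condition; index 0 gets
  -- only the logarithmic contribution.
  have hXn : ∀ n : ℤ, -(1 / 2) * ((divIndex (phiZ α) n : ℂ) * (u * e) ^ n +
      (divIndex (phiZ α) n : ℂ) * (e / u) ^ n) + (divIndex (tauZ α) n : ℂ) * (e / u) ^ n -
      (if n = 0 then (phiZ α 0 : ℂ) * α else 0) = (bdryCoeff α n : ℂ) * e ^ n := by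
    intro n
    have h1 : (u : ℂ) ^ n = (Real.exp (n * α) : ℝ) := by
      rw [hu, ← ofReal_zpow, exp_zpow]
    rw [mul_zpow, div_zpow, h1, divIndex, divIndex, bdryCoeff]
    rcases eq_or_ne n 0 with rfl | hn
    · simp
    · have hn' : (n : ℂ) ≠ 0 := by exact_mod_cast hn
      have hE : (Real.exp (n * α) : ℂ) ≠ 0 := by exact_mod_cast (Real.exp_pos _).ne'
      simp only [hn, if_false, sub_zero, Real.cosh_eq, Real.exp_neg]
      push_cast at hE ⊢
      field_simp
      ring
  have sX' : HasSum (fun n : ℤ => (bdryCoeff α n : ℂ) * e ^ n) X :=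
    (congrArg (HasSum · X) (funext hXn)).mp sX
  -- Multiplying by `e` shifts the index by one, so comparing coefficients of `e ^ n` yields
  -- `bdryCoeff_rec`.
  have sX'' := ((Equiv.addRight (-1 : ℤ)).hasSum_iff.2 sX').mul_left (u * e)
  have sφ'' := ((Equiv.addRight (-1 : ℤ)).hasSum_iff.2 sφ).mul_left (Real.sinh α * e)
  have s := (((sφ.mul_left (Real.sinh α * u : ℂ)).sub sφ'').add sX'').sub sX'
  have r := (hasSum_ite_eq (1 : ℤ) ((u : ℂ) * e)).add (hasSum_ite_eq (0 : ℤ) (1 : ℂ))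
  have hfun : ∀ n : ℤ, (if n = 1 then (u : ℂ) * e else 0) + (if n = 0 then (1 : ℂ) else 0) =
      Real.sinh α * u * ((phiZ α n : ℂ) * (e / u) ^ n) -
        Real.sinh α * e * ((phiZ α (n + -1) : ℂ) * (e / u) ^ (n + -1)) +
        u * e * ((bdryCoeff α (n + -1) : ℂ) * e ^ (n + -1)) - bdryCoeff α n * e ^ n := by
    intro n
    have h := bdryCoeff_rec hα n
    have h1 : (u : ℂ) ^ n = (Real.exp (n * α) : ℝ) := by
      rw [hu, ← ofReal_zpow, exp_zpow]
    have h2 : Real.exp (-((n - 1) * α)) = u * (u ^ n)⁻¹ := by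
      rw [hu, exp_zpow, ← Real.exp_neg, ← Real.exp_add]; ring_nf
    rw [h2, ← hu] at h
    have hun : (u : ℂ) ^ n ≠ 0 := zpow_ne_zero n huC
    have hen : e ^ n ≠ 0 := zpow_ne_zero n he0
    have h' := congrArg (fun x : ℝ => (x : ℂ)) h
    simp only [ofReal_sub, ofReal_mul, ofReal_inv, ofReal_zpow] at h'
    rw [div_zpow, div_zpow, zpow_add₀ he0, zpow_add₀ huC, zpow_neg_one, zpow_neg_one,
      ← sub_eq_add_neg]
    have e1 : (if n = 1 then (u : ℂ) * e else 0) = ((if n = 1 then u else 0 : ℝ) : ℂ) * e ^ n := by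
      split_ifs with hn
      · rw [hn, zpow_one]
      · simp
    have e2 : (if n = 0 then (1 : ℂ) else 0) = ((if n = 0 then 1 else 0 : ℝ) : ℂ) * e ^ n := by
      split_ifs with hn
      · rw [hn, zpow_zero, mul_one, ofReal_one]
      · simp
    rw [e1, e2]
    field_simp
    field_simp at h'
    linear_combination h'
  have r' := (congrArg (HasSum · ((u : ℂ) * e + 1)) (funext hfun)).mp r
  have := s.unique r'
  linear_combination this

/-- On `|t| = exp α` one has `e / exp α = (conj t)⁻¹`. By parity, the series at that point are, up
to sign, the conjugates of the series at `t`, so the velocity times `t - 1` becomes the identity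
`boundary_series`. -/
theorem hFun_boundary_right {α a : ℝ} (hα : 0 < α) {z : ℂ}
    (h : ‖mob a z‖ = Real.exp α) : hFun α a z = -I * z := by
  have hmem : z ∈ solDom α a := by
    refine ⟨?_, ?_⟩
    · rw [h, ← Real.exp_neg, Real.exp_lt_exp]; linarith
    · rw [h, Real.exp_lt_exp]; linarith
  have h1 := sub_ne_zero_of_mem_solDom hmem
  have h2 := add_ne_zero_of_mem_solDom hmem
  have hk := kFun_eq hα hmem
  set u := Real.exp α with hu
  have hu0 : 0 < u := Real.exp_pos α
  have huC : (u : ℂ) ≠ 0 := by exact_mod_cast hu0.ne'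
  set t := mob a z with ht
  set e := t / u with he
  have hte : t = u * e := by rw [he]; field_simp
  have hen : ‖e‖ = 1 := by
    rw [he, norm_div, h, norm_real, Real.norm_of_nonneg hu0.le, div_self hu0.ne']
  have hes : e * conj e = 1 := by rw [mul_conj, normSq_eq_norm_sq, hen]; simp
  have he0 : e ≠ 0 := by rw [← norm_pos_iff, hen]; norm_num
  have key := boundary_series hα hen
  rw [← hu, ← hte] at key
  have hinv : e / u = (conj t)⁻¹ := by
    refine eq_inv_of_mul_eq_one_left ?_
    rw [hte, map_mul, conj_ofReal]
    field_simp
    exact hes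
  rw [hinv, laurent_inv_of_even (phiZ_neg α), laurent_inv_of_odd (divIndex_neg (phiZ_neg α)),
    laurent_inv_of_odd (divIndex_neg (tauZ_neg α)), laurent_conj, laurent_conj, laurent_conj] at key
  have hT : t * conj t = u ^ 2 := by
    rw [hte, map_mul, conj_ofReal]; linear_combination (u : ℂ) ^ 2 * hes
  have ht0 : t ≠ 0 := by rw [hte]; exact mul_ne_zero huC he0
  have hT0 : conj t ≠ 0 := by simpa using ht0
  have hzt : z * (t - 1) = a * (t + 1) := by
    rw [ht, mob]; field_simp; ring
  have hzt' := congrArg conj hzt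
  simp only [map_mul, map_sub, map_add, map_one, conj_ofReal] at hzt'
  have ht1 : t - 1 ≠ 0 := by
    intro h0
    have h3 : t = 1 := by linear_combination h0
    rw [h3, norm_one] at h
    exact absurd h (Real.one_lt_exp_iff.2 hα).ne
  have hS : (Real.sinh α : ℂ) * (u - e) = (t * conj t - 1) * (conj t - 1) / (2 * conj t) := by
    have h3 : (Real.sinh α : ℂ) = ((u : ℂ) - (u : ℂ)⁻¹) / 2 := by
      rw [Real.sinh_eq, Real.exp_neg, ← hu]; push_cast; ring
    rw [h3, he, eq_div_iff (by simpa using ht0), hT]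
    field_simp
    linear_combination (-(u : ℂ) ^ 2 + 1) * hT
  rw [hS] at key
  have hJ : jFun a z = (t - 1) ^ 2 / (2 * t) := (jFun_eq h1 h2).symm
  have him : ∀ x : ℂ, (x.im : ℂ) = -(I / 2) * (x - conj x) := fun x => by
    rw [im_eq_sub_conj, div_eq_iff (by simp)]
    linear_combination (x - conj x) * I_sq
  refine mul_right_cancel₀ ht1 ?_
  rw [hFun, hk, ← ht, h, hu, Real.log_exp, him, re_eq_add_conj, hJ]
  simp only [map_mul, map_div₀, map_pow, map_sub, map_one, map_ofNat, conj_I]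
  have hA : (z + conj z) / 2 * ((conj t - 1) ^ 2 / (2 * conj t)) * (t - 1) =
      a * ((t * conj t - 1) * (conj t - 1) / (2 * conj t)) := by
    field_simp
    linear_combination (conj t - 1) ^ 2 * hzt + (conj t - 1) * (t - 1) * hzt'
  linear_combination (-I * a) * key - I * conj (laurent (phiZ α) t) * hA + I * hzt

end

section

open Complex ComplexConjugate Filter Topology

/-! ### Bounds, regularity and decay of the explicit solution -/

theorem mem_solDom_of_le {α a : ℝ} (hα : 0 < α) {z : ℂ} (h1 : (Real.exp α)⁻¹ ≤ ‖mob a z‖)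
    (h2 : ‖mob a z‖ ≤ Real.exp α) : z ∈ solDom α a := by
  refine ⟨lt_of_lt_of_le ?_ h1, lt_of_le_of_lt h2 ?_⟩
  · rw [← Real.exp_neg, ← Real.exp_neg, Real.exp_lt_exp]; linarith
  · rw [Real.exp_lt_exp]; linarith

theorem norm_kFun_le {α a : ℝ} {z : ℂ} (h1 : (Real.exp α)⁻¹ ≤ ‖mob a z‖)
    (h2 : ‖mob a z‖ ≤ Real.exp α) (hs : WSummable (Real.exp α) (halfDiff (phiZ α))) :
    ‖kFun α a z‖ ≤ wnorm (Real.exp α) (halfDiff (phiZ α)) := by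
  rw [kFun, norm_mul, norm_I, one_mul]
  exact norm_laurent_le (Real.exp_pos _) hs h1 h2

theorem norm_lFun_le {α a : ℝ} {z : ℂ} (h1 : (Real.exp α)⁻¹ ≤ ‖mob a z‖)
    (h2 : ‖mob a z‖ ≤ Real.exp α) (hs : WSummable (Real.exp α) (halfDiff (tauZ α))) :
    ‖lFun α a z‖ ≤ wnorm (Real.exp α) (halfDiff (tauZ α)) := by
  rw [lFun, norm_mul, norm_I, one_mul]
  exact norm_laurent_le (Real.exp_pos _) hs h1 h2

theorem hasDerivAt_kFun {α a : ℝ} (hα : 0 < α) {z : ℂ} (hz : z ∈ solDom α a) :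
    HasDerivAt (kFun α a) (I * (deriv (laurent (halfDiff (phiZ α))) (mob a z) *
      (-2 * a / (z - a) ^ 2))) z := by
  have hd := ((differentiableOn_laurent (Real.exp_pos _) (wSummable_halfDiff
    (one_le_exp_three_halves hα) (wSummable_phiZ hα))).differentiableAt
      ((isOpen_annulus _).mem_nhds hz)).hasDerivAt
  exact (hd.comp z (hasDerivAt_mob (sub_ne_zero_of_mem_solDom hz))).const_mul I

/-- Since `4 a x = |z + a|² - |z - a|²`, the left side equals `|r - r⁻¹|/2` with `r = |t|`, and `r`
lies between `exp (-α)` and `exp α`. -/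
theorem abs_re_mul_le {α a : ℝ} {z : ℂ} (h1 : (Real.exp α)⁻¹ ≤ ‖mob a z‖)
    (h2 : ‖mob a z‖ ≤ Real.exp α) (hza : z - a ≠ 0) (hza' : z + a ≠ 0) :
    ‖z.re * (-2 * a / (z - a) ^ 2) / mob a z‖ ≤ Real.sinh α := by
  have hP : 0 < ‖z + a‖ := norm_pos_iff.2 hza'
  have hQ : 0 < ‖z - a‖ := norm_pos_iff.2 hza
  have e0 : z.re * (-2 * a / (z - a) ^ 2) / mob a z =
      -(((2 * a * z.re : ℝ) : ℂ)) / ((z - a) * (z + a)) := by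
    unfold mob; push_cast; field_simp
  have e1 : ‖mob a z‖ = ‖z + a‖ / ‖z - a‖ := by rw [mob, norm_div]
  have e2 : 4 * a * z.re = ‖z + a‖ ^ 2 - ‖z - a‖ ^ 2 := by
    rw [← normSq_eq_norm_sq, ← normSq_eq_norm_sq, normSq_apply, normSq_apply]
    simp; ring
  rw [e0, norm_div, norm_neg, norm_real, norm_mul (z - a), Real.norm_eq_abs,
    div_le_iff₀ (mul_pos hQ hP), Real.sinh_eq, Real.exp_neg]
  rw [e1] at h1 h2
  set P := ‖z + a‖
  set Q := ‖z - a‖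
  set u := Real.exp α with hu
  have hu0 : 0 < u := Real.exp_pos α
  have h3 : P ≤ u * Q := (div_le_iff₀ hQ).1 h2
  have h4 : Q ≤ u * P := by
    rw [le_div_iff₀ hQ, inv_mul_le_iff₀ hu0] at h1; exact h1
  have h5 : u⁻¹ * P ≤ Q := by rw [inv_mul_le_iff₀ hu0]; exact h3
  have h6 : u⁻¹ * Q ≤ P := by rw [inv_mul_le_iff₀ hu0]; exact h4
  have e3 : 2 * a * z.re = (P ^ 2 - Q ^ 2) / 2 := by linarith
  rw [e3, abs_le]
  constructor <;> nlinarith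

theorem norm_re_mul_deriv_kFun_le {α a : ℝ} (hα : 0 < α) {z : ℂ}
    (h1 : (Real.exp α)⁻¹ ≤ ‖mob a z‖) (h2 : ‖mob a z‖ ≤ Real.exp α)
    (hs : WSummable (Real.exp α) (fun n => Real.sinh α * (n * halfDiff (phiZ α) n))) :
    ‖z.re * deriv (kFun α a) z‖ ≤
      wnorm (Real.exp α) (fun n => Real.sinh α * (n * halfDiff (phiZ α) n)) := by
  have hz := mem_solDom_of_le hα h1 h2
  have ht0 := ne_zero_of_mem_annulus (Real.exp_pos _) hz
  have hsum := (hasSum_mul_deriv_laurent (Real.exp_pos _) (wSummable_halfDiff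
    (one_le_exp_three_halves hα) (wSummable_phiZ hα)) hz).mul_left (Real.sinh α : ℂ)
  have hlau : (Real.sinh α : ℂ) * (mob a z * deriv (laurent (halfDiff (phiZ α))) (mob a z)) =
      laurent (fun n => Real.sinh α * (n * halfDiff (phiZ α) n)) (mob a z) := by
    rw [← hsum.tsum_eq, laurent]
    refine tsum_congr fun n => ?_
    rw [← mul_assoc, ← ofReal_mul]
  have hb := norm_laurent_le (Real.exp_pos α) hs h1 h2
  rw [← hlau, norm_mul, norm_real, Real.norm_of_nonneg (Real.sinh_nonneg_iff.2 hα.le)] at hb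
  refine le_trans ?_ hb
  have hc := abs_re_mul_le h1 h2 (sub_ne_zero_of_mem_solDom hz) (add_ne_zero_of_mem_solDom hz)
  rw [(hasDerivAt_kFun hα hz).deriv]
  have e : (z.re : ℂ) * (I * (deriv (laurent (halfDiff (phiZ α))) (mob a z) *
      (-2 * a / (z - a) ^ 2))) = I * ((z.re * (-2 * a / (z - a) ^ 2) / mob a z) *
      (mob a z * deriv (laurent (halfDiff (phiZ α))) (mob a z))) := by
    field_simp
  rw [e, norm_mul, norm_I, one_mul, norm_mul]
  gcongr

theorem norm_hDeriv_le (α a : ℝ) (z : ℂ) :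
    ‖hDeriv α a z‖ ≤ ‖kFun α a z‖ + ‖z.re * deriv (kFun α a) z + lFun α a z‖ := by
  refine ContinuousLinearMap.opNorm_le_bound _ (by positivity) fun w => ?_
  rw [hDeriv_apply, add_mul ‖kFun α a z‖]
  refine (norm_add_le _ _).trans (add_le_add ?_ ?_)
  · rw [norm_mul, norm_mul, norm_neg, norm_I, one_mul, norm_real]
    gcongr
    exact abs_im_le_norm _
  · rw [RCLike.norm_conj, norm_mul]

theorem contDiffOn_kFun {α : ℝ} (hα : 0 < α) (a : ℝ) : ContDiffOn ℝ 2 (kFun α a) (solDom α a) :=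
  ((differentiableOn_kFun hα a).contDiffOn (isOpen_solDom α a)).restrict_scalars ℝ

theorem contDiffOn_hFun {α : ℝ} (hα : 0 < α) (a : ℝ) : ContDiffOn ℝ 2 (hFun α a) (solDom α a) := by
  have hU := isOpen_solDom α a
  have hk := contDiffOn_kFun hα a
  have h1 : ContDiffOn ℝ 2 (fun z => laurent (divIndex (phiZ α)) (mob a z)) (solDom α a) :=
    ((differentiableOn_laurent_mob (wSummable_divIndex (Real.exp_pos _)
      (wSummable_phiZ hα))).contDiffOn hU).restrict_scalars ℝ
  have h2 : ContDiffOn ℝ 2 (fun z => laurent (divIndex (tauZ α)) (mob a z)) (solDom α a) :=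
    ((differentiableOn_laurent_mob (wSummable_divIndex (Real.exp_pos _)
      (wSummable_tauZ hα))).contDiffOn hU).restrict_scalars ℝ
  have h3 : ContDiffOn ℝ 2 (mob a) (solDom α a) :=
    ((differentiableOn_mob α a).contDiffOn hU).restrict_scalars ℝ
  have h4 : ContDiffOn ℝ 2 (fun z => Real.log ‖mob a z‖) (solDom α a) :=
    (h3.norm ℝ fun z hz => ne_zero_of_mem_annulus (Real.exp_pos _) hz).log
      fun z hz => norm_ne_zero_iff.2 (ne_zero_of_mem_annulus (Real.exp_pos _) hz)
  have c1 := ((ofRealCLM.comp reCLM).contDiff (n := 2)).contDiffOn (s := solDom α a)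
  have c2 := ((conjCLE : ℂ →L[ℝ] ℂ).contDiff (n := 2)).comp_contDiffOn hk
  have c3 := ((ofRealCLM.comp imCLM).contDiff (n := 2)).comp_contDiffOn h1
  have c4 := ((conjCLE : ℂ →L[ℝ] ℂ).contDiff (n := 2)).comp_contDiffOn h2
  have c5 := (ofRealCLM.contDiff (n := 2)).comp_contDiffOn h4
  exact ((c1.mul c2).sub (contDiffOn_const.mul c3)).add
    (contDiffOn_const.mul (c4.add (contDiffOn_const.mul c5)))

/-! ### Decay of the explicit solution at infinity. -/

theorem sub_inv_isBigO (a : ℝ) :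
    (fun z : ℂ => (z - a)⁻¹) =O[cobounded ℂ] fun z => ‖z‖⁻¹ := by
  refine IsBigO.of_bound 2 ?_
  filter_upwards [eventually_cobounded_le_norm (2 * |a| + 1)] with z hz
  have h1 : ‖z‖ - |a| ≤ ‖z - a‖ := by
    have := norm_sub_norm_le z (a : ℂ)
    rwa [norm_real, Real.norm_eq_abs] at this
  have h0 : 0 < ‖z‖ := by linarith [abs_nonneg a]
  rw [norm_inv, norm_inv, norm_norm, inv_le_comm₀ (by linarith [abs_nonneg a]) (by positivity),
    mul_inv, inv_inv]
  linarith [abs_nonneg a]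

theorem mob_sub_one {a : ℝ} {z : ℂ} (hz : z - a ≠ 0) : mob a z - 1 = 2 * a * (z - a)⁻¹ := by
  unfold mob; field_simp; ring

theorem eventually_sub_ne_zero (a : ℝ) : ∀ᶠ z : ℂ in cobounded ℂ, z - (a : ℂ) ≠ 0 := by
  filter_upwards [eventually_cobounded_le_norm (|a| + 1)] with z hz h
  have : z = a := by linear_combination h
  rw [this, norm_real, Real.norm_eq_abs] at hz
  linarith

theorem mob_sub_one_isBigO (a : ℝ) :
    (fun z : ℂ => mob a z - 1) =O[cobounded ℂ] fun z => ‖z‖⁻¹ := by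
  refine ((sub_inv_isBigO a).const_mul_left (2 * a : ℂ)).congr' ?_ EventuallyEq.rfl
  filter_upwards [eventually_sub_ne_zero a] with z hz
  exact (mob_sub_one hz).symm

theorem tendsto_norm_inv_cobounded : Tendsto (fun z : ℂ => ‖z‖⁻¹) (cobounded ℂ) (𝓝 0) :=
  tendsto_inv_atTop_zero.comp tendsto_norm_cobounded_atTop

theorem tendsto_mob (a : ℝ) : Tendsto (mob a) (cobounded ℂ) (𝓝 1) := by
  have h := (mob_sub_one_isBigO a).trans_tendsto tendsto_norm_inv_cobounded
  simpa using h.add_const 1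

theorem one_mem_annulus {α : ℝ} (hα : 0 < α) : (1 : ℂ) ∈ annulus (Real.exp (3 / 2 * α)) := by
  have h : 1 < Real.exp (3 / 2 * α) := Real.one_lt_exp_iff.2 (by positivity)
  exact ⟨by rw [norm_one]; exact inv_lt_one_of_one_lt₀ h, by rwa [norm_one]⟩

theorem eventually_mem_solDom {α : ℝ} (hα : 0 < α) (a : ℝ) :
    ∀ᶠ z in cobounded ℂ, z ∈ solDom α a :=
  (tendsto_mob a).eventually ((isOpen_annulus _).mem_nhds (one_mem_annulus hα))

theorem comp_mob_isBigO {F : ℂ → ℂ} (hF : DifferentiableAt ℂ F 1) (h1 : F 1 = 0) (a : ℝ) :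
    (fun z => F (mob a z)) =O[cobounded ℂ] fun z => ‖z‖⁻¹ := by
  have h := hF.isBigO_sub
  simp only [h1, sub_zero] at h
  exact (h.comp_tendsto (tendsto_mob a)).trans (mob_sub_one_isBigO a)

theorem comp_mob_isBigO_one {F : ℂ → ℂ} (hF : ContinuousAt F 1) (a : ℝ) :
    (fun z => F (mob a z)) =O[cobounded ℂ] fun _ => (1 : ℝ) :=
  (hF.tendsto.comp (tendsto_mob a)).isBigO_one ℝ

theorem jFun_isBigO (a : ℝ) : jFun a =O[cobounded ℂ] fun z => (‖z‖ ^ 2)⁻¹ := by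
  have h1 := sub_inv_isBigO a
  have h2 := sub_inv_isBigO (-a)
  refine (((h1.mul h2).const_mul_left (2 * a ^ 2 : ℂ)).congr_left fun z => ?_).congr_right
    fun z => ?_
  · rw [jFun, ← mul_inv, div_eq_mul_inv]; push_cast; ring_nf
  · rw [sq, mul_inv]

theorem kFun_isBigO {α : ℝ} (hα : 0 < α) (a : ℝ) :
    kFun α a =O[cobounded ℂ] fun z => (‖z‖ ^ 2)⁻¹ := by
  have hc := ((differentiableOn_laurent (Real.exp_pos _) (wSummable_phiZ hα)).differentiableAt
    ((isOpen_annulus _).mem_nhds (one_mem_annulus hα))).continuousAt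
  refine (((jFun_isBigO a).mul (comp_mob_isBigO_one hc a)).const_mul_left I).congr' ?_ (by simp)
  filter_upwards [eventually_mem_solDom hα a] with z hz
  rw [kFun_eq hα hz, mul_assoc]

theorem lFun_isBigO {α : ℝ} (hα : 0 < α) (a : ℝ) :
    lFun α a =O[cobounded ℂ] fun z => (‖z‖ ^ 2)⁻¹ := by
  have hc := ((differentiableOn_laurent (Real.exp_pos _) (wSummable_tauZ hα)).differentiableAt
    ((isOpen_annulus _).mem_nhds (one_mem_annulus hα))).continuousAt
  refine (((jFun_isBigO a).mul (comp_mob_isBigO_one hc a)).const_mul_left I).congr' ?_ (by simp)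
  filter_upwards [eventually_mem_solDom hα a] with z hz
  rw [lFun_eq hα hz, mul_assoc]

theorem re_isBigO : (fun z : ℂ => (z.re : ℂ)) =O[cobounded ℂ] fun z => ‖z‖ :=
  .of_bound 1 (.of_forall fun z => by
    rw [norm_real, one_mul, norm_norm]; exact abs_re_le_norm z)

/-- The factor `x` uses up one order of the decay `|z|⁻²` of `dt/dz`. One order comes back because a
series symmetric under `t ↦ t⁻¹` has zero derivative at `t = 1`, the image of infinity. -/
theorem re_mul_deriv_kFun_isBigO {α : ℝ} (hα : 0 < α) (a : ℝ) :
    (fun z => z.re * deriv (kFun α a) z) =O[cobounded ℂ] fun z => (‖z‖ ^ 2)⁻¹ := by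
  have hs := wSummable_halfDiff (one_le_exp_three_halves hα) (wSummable_phiZ hα)
  have hd := ((differentiableOn_laurent (Real.exp_pos _) hs).deriv
    (isOpen_annulus _)).differentiableAt ((isOpen_annulus _).mem_nhds (one_mem_annulus hα))
  have h1 : deriv (laurent (halfDiff (phiZ α))) 1 = 0 := by
    have h := (hasSum_mul_deriv_laurent (Real.exp_pos _) hs (one_mem_annulus hα)).tsum_eq
    rw [one_mul] at h
    rw [← h]
    refine laurent_one_of_odd (c := fun n => n * halfDiff (phiZ α) n) fun n => ?_
    rw [phiZ_halfDiff_even]; push_cast; ring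
  have h2 := comp_mob_isBigO hd h1 a
  have h3 := sub_inv_isBigO a
  have h4 := (re_isBigO.mul ((h2.mul (h3.mul h3)).const_mul_left (I * (-2 * a)))).congr'
    (f₂ := fun z => z.re * deriv (kFun α a) z) (g₂ := fun z => (‖z‖ ^ 2)⁻¹) ?_ ?_
  · exact h4
  · filter_upwards [eventually_mem_solDom hα a] with z hz
    rw [(hasDerivAt_kFun hα hz).deriv]
    have := sub_ne_zero_of_mem_solDom hz
    field_simp
  · filter_upwards [eventually_cobounded_le_norm 1] with z hz
    have : ‖z‖ ≠ 0 := by positivity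
    field_simp

theorem hDeriv_isBigO {α : ℝ} (hα : 0 < α) (a : ℝ) :
    hDeriv α a =O[cobounded ℂ] fun z => (‖z‖ ^ 2)⁻¹ := by
  refine IsBigO.trans (.of_bound 1 (.of_forall fun z => ?_)) (((kFun_isBigO hα a).norm_left.add
    ((re_mul_deriv_kFun_isBigO hα a).add (lFun_isBigO hα a)).norm_left))
  rw [one_mul, Real.norm_of_nonneg (by positivity)]
  exact norm_hDeriv_le α a z

/-- The integrated series are odd and so vanish at `t = 1`, as does the logarithm; the constant at
infinity is therefore 0. -/
theorem hFun_isBigO {α : ℝ} (hα : 0 < α) (a : ℝ) :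
    hFun α a =O[cobounded ℂ] fun z => ‖z‖⁻¹ := by
  have hd : ∀ {c : ℤ → ℝ}, WSummable (Real.exp (3 / 2 * α)) c → DifferentiableAt ℂ (laurent c) 1 :=
    fun hc => (differentiableOn_laurent (Real.exp_pos _) hc).differentiableAt
      ((isOpen_annulus _).mem_nhds (one_mem_annulus hα))
  have h1 := comp_mob_isBigO (hd (wSummable_divIndex (Real.exp_pos _) (wSummable_phiZ hα)))
    (laurent_one_of_odd (divIndex_neg (phiZ_neg α))) a
  have h2 := comp_mob_isBigO (hd (wSummable_divIndex (Real.exp_pos _) (wSummable_tauZ hα)))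
    (laurent_one_of_odd (divIndex_neg (tauZ_neg α))) a
  have h3 := comp_mob_isBigO (differentiableAt_log (by simp : (1 : ℂ) ∈ slitPlane)) Complex.log_one a
  have k1 : (fun z : ℂ => (z.re : ℂ) * conj (kFun α a z)) =O[cobounded ℂ] fun z => ‖z‖⁻¹ := by
    refine (re_isBigO.mul (IsBigO.trans (.of_bound 1 (.of_forall fun z => ?_))
      (kFun_isBigO hα a))).congr' .rfl ?_
    · rw [RCLike.norm_conj, one_mul]
    · filter_upwards [eventually_cobounded_le_norm 1] with z hz
      have : ‖z‖ ≠ 0 := by positivity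
      field_simp
  have k2 : (fun z : ℂ => ((laurent (divIndex (phiZ α)) (mob a z)).im : ℂ)) =O[cobounded ℂ]
      fun z => ‖z‖⁻¹ := by
    refine IsBigO.trans (.of_bound 1 (.of_forall fun z => ?_)) h1
    rw [norm_real, one_mul]; exact abs_im_le_norm _
  have k3 : (fun z : ℂ => conj (laurent (divIndex (tauZ α)) (mob a z))) =O[cobounded ℂ]
      fun z => ‖z‖⁻¹ := by
    refine IsBigO.trans (.of_bound 1 (.of_forall fun z => ?_)) h2
    rw [RCLike.norm_conj, one_mul]
  have k4 : (fun z : ℂ => (Real.log ‖mob a z‖ : ℂ)) =O[cobounded ℂ] fun z => ‖z‖⁻¹ := by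
    refine IsBigO.trans (.of_bound 1 (.of_forall fun z => ?_)) h3
    rw [norm_real, one_mul, ← log_re]; exact abs_re_le_norm _
  exact (k1.sub (k2.const_mul_left _)).add ((k3.add (k4.const_mul_left _)).const_mul_left _)

end

section

open Complex ComplexConjugate Filter Topology

/-! ### Geometry of the two circles -/

/-- The circle of Apollonius: the level set `|z + a| = exp α |z - a|` is the circle of radius `R`
about `c`, and the sides of both are compared at once. -/
theorem exp_sq_mul_sub {R α a c : ℝ} (ha : R * Real.sinh α = a) (hc : R * Real.cosh α = c)
    (z : ℂ) : Real.exp α ^ 2 * ‖z - a‖ ^ 2 - ‖z + a‖ ^ 2 =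
      (Real.exp α ^ 2 - 1) * (‖z - c‖ ^ 2 - R ^ 2) := by
  have hu := (Real.exp_pos α).ne'
  have h1 : a * (Real.exp α ^ 2 + 1) = c * (Real.exp α ^ 2 - 1) := by
    rw [← ha, ← hc, Real.sinh_eq, Real.cosh_eq, Real.exp_neg]
    field_simp
  have h2 : a ^ 2 = c ^ 2 - R ^ 2 := by
    rw [← ha, ← hc, mul_pow, mul_pow, Real.cosh_sq]
    ring
  rw [← normSq_eq_norm_sq, ← normSq_eq_norm_sq, ← normSq_eq_norm_sq, normSq_apply, normSq_apply,
    normSq_apply]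
  simp only [sub_re, sub_im, add_re, add_im, ofReal_re, ofReal_im]
  linear_combination -2 * z.re * h1 + (Real.exp α ^ 2 - 1) * h2

theorem one_lt_exp_sq {α : ℝ} (hα : 0 < α) : 1 < Real.exp α ^ 2 := by
  have := Real.one_lt_exp_iff.2 hα
  nlinarith

theorem norm_add_le_of_le_norm_sub {R α a c : ℝ} (hα : 0 < α) (hR : 0 < R)
    (ha : R * Real.sinh α = a) (hc : R * Real.cosh α = c) {z : ℂ} (h : R ≤ ‖z - c‖) :
    ‖z + a‖ ≤ Real.exp α * ‖z - a‖ := by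
  refine le_of_sq_le_sq ?_ (by positivity)
  have h1 := exp_sq_mul_sub ha hc z
  have h2 : 0 ≤ (Real.exp α ^ 2 - 1) * (‖z - c‖ ^ 2 - R ^ 2) :=
    mul_nonneg (by linarith [one_lt_exp_sq hα]) (by nlinarith)
  rw [mul_pow]
  linarith

theorem sub_ne_zero_of_norm_add_le {α a : ℝ} (ha : 0 < a) {z : ℂ}
    (h : ‖z + a‖ ≤ Real.exp α * ‖z - a‖) : 0 < ‖z - a‖ := by
  refine norm_pos_iff.2 fun h0 => ?_
  have hz : z = a := by linear_combination h0
  rw [h0, norm_zero, mul_zero, hz, ← ofReal_add, norm_real, Real.norm_of_nonneg (by linarith)] at h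
  linarith

theorem norm_mob_mem {R α a c : ℝ} (hα : 0 < α) (hR : 0 < R)
    (ha : R * Real.sinh α = a) (hc : R * Real.cosh α = c) {z : ℂ} (h : R ≤ ‖z - c‖)
    (h' : R ≤ ‖z + c‖) : (Real.exp α)⁻¹ ≤ ‖mob a z‖ ∧ ‖mob a z‖ ≤ Real.exp α := by
  have ha0 : 0 < a := ha ▸ mul_pos hR (Real.sinh_pos_iff.2 hα)
  have h1 := norm_add_le_of_le_norm_sub hα hR ha hc h
  have h2 := norm_add_le_of_le_norm_sub hα hR ha hc (z := -z)
    (by rwa [← norm_neg, neg_sub, sub_neg_eq_add, add_comm])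
  rw [show -z + (a : ℂ) = -(z - a) by ring, show -z - (a : ℂ) = -(z + a) by ring, norm_neg,
    norm_neg] at h2
  have h3 := sub_ne_zero_of_norm_add_le ha0 h1
  rw [mob, norm_div, div_le_iff₀ h3, le_div_iff₀ h3, inv_mul_le_iff₀ (Real.exp_pos _)]
  exact ⟨h2, h1⟩

theorem norm_mob_eq {R α a c : ℝ} (hα : 0 < α) (hR : 0 < R)
    (ha : R * Real.sinh α = a) (hc : R * Real.cosh α = c) {z : ℂ} (h : ‖z - c‖ = R) :
    ‖mob a z‖ = Real.exp α := by
  have ha0 : 0 < a := ha ▸ mul_pos hR (Real.sinh_pos_iff.2 hα)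
  have h3 := sub_ne_zero_of_norm_add_le ha0 (norm_add_le_of_le_norm_sub hα hR ha hc h.ge)
  rw [mob, norm_div, div_eq_iff h3.ne', ← sq_eq_sq₀ (norm_nonneg _) (by positivity), mul_pow]
  have h1 := exp_sq_mul_sub ha hc z
  rw [h, sub_self, mul_zero] at h1
  linarith

/-! ### The explicit solution in the Euclidean plane -/

/-- The isometry between the complex numbers and the Euclidean plane. -/
def toPlane : ℂ ≃ₗᵢ[ℝ] Plane := Complex.orthonormalBasisOneI.repr

theorem toPlane_zero (z : ℂ) : toPlane z 0 = z.re := by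
  simp [toPlane]

theorem toPlane_one (z : ℂ) : toPlane z 1 = z.im := by
  simp [toPlane]

theorem re_toPlane_symm (x : Plane) : (toPlane.symm x).re = x 0 := by
  rw [← toPlane_zero, LinearIsometryEquiv.apply_symm_apply]

theorem im_toPlane_symm (x : Plane) : (toPlane.symm x).im = x 1 := by
  rw [← toPlane_one, LinearIsometryEquiv.apply_symm_apply]

theorem toPlane_symm_single_zero : toPlane.symm (EuclideanSpace.single 0 1) = 1 := by
  apply Complex.ext <;> simp [re_toPlane_symm, im_toPlane_symm]

theorem toPlane_symm_single_one : toPlane.symm (EuclideanSpace.single 1 1) = I := by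
  apply Complex.ext <;> simp [re_toPlane_symm, im_toPlane_symm]

theorem toPlane_symm_real (c : ℝ) : toPlane.symm !₂[c, 0] = c := by
  apply Complex.ext <;> simp [re_toPlane_symm, im_toPlane_symm]

theorem dist_real (x : Plane) (c : ℝ) : dist x !₂[c, 0] = ‖toPlane.symm x - c‖ := by
  rw [← toPlane_symm_real, ← map_sub, LinearIsometryEquiv.norm_map, dist_eq_norm]

theorem toPlane_neg_I_mul (x : Plane) : toPlane (-I * toPlane.symm x) = rigidRotation x := by
  ext i; fin_cases i
  · simp [toPlane_zero, rigidRotation, im_toPlane_symm]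
  · simp [toPlane_one, rigidRotation, re_toPlane_symm]

theorem mem_exterior_iff {R : ℝ} (hR : 0 < R) (δ : ℝ) (x : Plane) :
    x ∈ exterior R δ ↔ R < dist x !₂[-R - δ / 2, 0] ∧ R < dist x !₂[R + δ / 2, 0] := by
  rw [exterior, closure_union, disk1, disk2, closure_ball _ hR.ne', closure_ball _ hR.ne']
  simp

theorem isOpen_exterior (R δ : ℝ) : IsOpen (exterior R δ) := isClosed_closure.isOpen_compl

theorem le_dist_of_mem_closure_exterior {R : ℝ} (hR : 0 < R) {δ : ℝ} {x : Plane}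
    (hx : x ∈ closure (exterior R δ)) :
    R ≤ dist x !₂[-R - δ / 2, 0] ∧ R ≤ dist x !₂[R + δ / 2, 0] := by
  have hc : IsClosed {x : Plane | R ≤ dist x !₂[-R - δ / 2, 0] ∧ R ≤ dist x !₂[R + δ / 2, 0]} :=
    .and (isClosed_le continuous_const (continuous_id.dist continuous_const))
      (isClosed_le continuous_const (continuous_id.dist continuous_const))
  refine closure_minimal (fun y hy => ?_) hc hx
  exact ⟨((mem_exterior_iff hR δ y).1 hy).1.le, ((mem_exterior_iff hR δ y).1 hy).2.le⟩

theorem norm_mob_mem_of_mem_closure {R δ α a : ℝ} (hα : 0 < α) (hR : 0 < R)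
    (ha : R * Real.sinh α = a) (hc : R * Real.cosh α = R + δ / 2) {x : Plane}
    (hx : x ∈ closure (exterior R δ)) :
    (Real.exp α)⁻¹ ≤ ‖mob a (toPlane.symm x)‖ ∧ ‖mob a (toPlane.symm x)‖ ≤ Real.exp α := by
  obtain ⟨h1, h2⟩ := le_dist_of_mem_closure_exterior hR hx
  rw [dist_real] at h1 h2
  refine norm_mob_mem hα hR ha hc h2 ?_
  convert h1 using 2
  push_cast; ring

/-- The velocity field of the explicit solution. -/
def velSol (α a : ℝ) (x : Plane) : Plane := toPlane (hFun α a (toPlane.symm x))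

/-- The pressure of the explicit solution. -/
def preSol (μ α a : ℝ) (x : Plane) : ℝ := 2 * μ * (kFun α a (toPlane.symm x)).re

theorem hasFDerivAt_velSol {α a : ℝ} (hα : 0 < α) {x : Plane} (hx : toPlane.symm x ∈ solDom α a) :
    HasFDerivAt (velSol α a) ((toPlane.toContinuousLinearEquiv : ℂ →L[ℝ] Plane) ∘L
      (hDeriv α a (toPlane.symm x) ∘L (toPlane.symm.toContinuousLinearEquiv : Plane →L[ℝ] ℂ))) x :=
  (toPlane.toContinuousLinearEquiv.hasFDerivAt).comp x
    ((hasFDerivAt_hFun hα hx).comp x toPlane.symm.toContinuousLinearEquiv.hasFDerivAt)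

theorem fderiv_velSol_apply {α a : ℝ} (hα : 0 < α) {x : Plane}
    (hx : toPlane.symm x ∈ solDom α a) (v : Plane) :
    fderiv ℝ (velSol α a) x v = toPlane (hDeriv α a (toPlane.symm x) (toPlane.symm v)) := by
  rw [(hasFDerivAt_velSol hα hx).fderiv]; rfl

theorem norm_fderiv_velSol_le {α a : ℝ} (hα : 0 < α) {x : Plane}
    (hx : toPlane.symm x ∈ solDom α a) :
    ‖fderiv ℝ (velSol α a) x‖ ≤ ‖hDeriv α a (toPlane.symm x)‖ := by
  refine ContinuousLinearMap.opNorm_le_bound _ (norm_nonneg _) fun v => ?_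
  rw [fderiv_velSol_apply hα hx, LinearIsometryEquiv.norm_map]
  refine (ContinuousLinearMap.le_opNorm _ _).trans ?_
  rw [LinearIsometryEquiv.norm_map]

theorem contDiffOn_velSol {α : ℝ} (hα : 0 < α) (a : ℝ) :
    ContDiffOn ℝ 2 (velSol α a) (toPlane.symm ⁻¹' solDom α a) :=
  toPlane.contDiff.comp_contDiffOn
    ((contDiffOn_hFun hα a).comp toPlane.symm.contDiff.contDiffOn fun _ h => h)

theorem contDiffOn_preSol (μ : ℝ) {α : ℝ} (hα : 0 < α) (a : ℝ) :
    ContDiffOn ℝ 2 (preSol μ α a) (toPlane.symm ⁻¹' solDom α a) :=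
  contDiffOn_const.mul (reCLM.contDiff.comp_contDiffOn
    ((contDiffOn_kFun hα a).comp toPlane.symm.contDiff.contDiffOn fun _ h => h))

theorem isOpen_preimage_solDom (α a : ℝ) : IsOpen (toPlane.symm ⁻¹' solDom α a) :=
  (isOpen_solDom α a).preimage toPlane.symm.continuous

/-- The Laplacian as the sum of the pure second partial derivatives. -/
theorem laplacian_eq_sum {u : Plane → Plane} {x : Plane} (hu : ContDiffAt ℝ 2 u x) :
    (Δ u) x = ∑ i, fderiv ℝ (fun y => fderiv ℝ u y (EuclideanSpace.single i 1)) x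
      (EuclideanSpace.single i 1) := by
  have hd : DifferentiableAt ℝ (fderiv ℝ u) x :=
    (hu.fderiv_right (m := 1) (by norm_num)).differentiableAt (by norm_num)
  rw [InnerProductSpace.laplacian_eq_iteratedFDeriv_orthonormalBasis u
    (EuclideanSpace.basisFun (Fin 2) ℝ)]
  refine Finset.sum_congr rfl fun i _ => ?_
  rw [iteratedFDeriv_two_apply, fderiv_clm_apply hd (differentiableAt_const _)]
  simp

theorem hasFDerivAt_hDeriv_apply {α a : ℝ} (hα : 0 < α) {z : ℂ} (hz : z ∈ solDom α a) (w : ℂ) :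
    ∃ D : ℂ →L[ℝ] ℂ, HasFDerivAt (fun z => hDeriv α a z w) D z ∧ ∀ v, D v =
      -I * ((deriv (kFun α a) z * v).im) * w + conj ((v.re * deriv (kFun α a) z +
        (z.re * deriv (deriv (kFun α a)) z + deriv (lFun α a) z) * v) * w) := by
  have hU := (isOpen_solDom α a).mem_nhds hz
  have hk := (((differentiableOn_kFun hα a).differentiableAt hU).hasDerivAt).hasFDerivAt
    |>.restrictScalars ℝ
  have hk' := ((((differentiableOn_kFun hα a).deriv (isOpen_solDom α a)).differentiableAt
    hU).hasDerivAt).hasFDerivAt |>.restrictScalars ℝ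
  have hl := (((differentiableOn_lFun hα a).differentiableAt hU).hasDerivAt).hasFDerivAt
    |>.restrictScalars ℝ
  have hre : HasFDerivAt (fun z : ℂ => (z.re : ℂ)) (ofRealCLM ∘L reCLM) z :=
    (ofRealCLM ∘L reCLM).hasFDerivAt
  have him := (ofRealCLM ∘L imCLM).hasFDerivAt.comp z hk
  have e := ((him.const_mul (-I)).mul_const w).add
    ((conjCLE : ℂ →L[ℝ] ℂ).hasFDerivAt.comp z (((hre.mul hk').add hl).mul_const w))
  refine ⟨_, e.congr_of_eventuallyEq (.of_forall fun z => hDeriv_apply α a z w), fun v => ?_⟩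
  simp [mul_comm]
  ring

theorem laplacian_velSol {α a : ℝ} (hα : 0 < α) {x : Plane} (hx : toPlane.symm x ∈ solDom α a) :
    (Δ (velSol α a)) x = toPlane (2 * conj (deriv (kFun α a) (toPlane.symm x))) := by
  have hU := (isOpen_preimage_solDom α a).mem_nhds hx
  rw [laplacian_eq_sum ((contDiffOn_velSol hα a).contDiffAt hU)]
  have key : ∀ v : Plane, ∃ D : ℂ →L[ℝ] ℂ,
      HasFDerivAt (fun z => hDeriv α a z (toPlane.symm v)) D (toPlane.symm x) ∧
      fderiv ℝ (fun y => fderiv ℝ (velSol α a) y v) x v = toPlane (D (toPlane.symm v)) ∧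
      ∀ w, D w = _ := fun v => by
    obtain ⟨D, hD, hv⟩ := hasFDerivAt_hDeriv_apply hα hx (toPlane.symm v)
    refine ⟨D, hD, ?_, hv⟩
    have h := (toPlane.toContinuousLinearEquiv.hasFDerivAt).comp x
      (hD.comp x toPlane.symm.toContinuousLinearEquiv.hasFDerivAt)
    have h' := h.congr_of_eventuallyEq (f₁ := fun y => fderiv ℝ (velSol α a) y v)
      (by filter_upwards [hU] with y hy using fderiv_velSol_apply hα hy v)
    rw [h'.fderiv]; rfl
  obtain ⟨D₀, -, e₀, f₀⟩ := key (EuclideanSpace.single 0 1)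
  obtain ⟨D₁, -, e₁, f₁⟩ := key (EuclideanSpace.single 1 1)
  rw [Fin.sum_univ_two, e₀, e₁, ← map_add, f₀, f₁, toPlane_symm_single_zero,
    toPlane_symm_single_one]
  congr 1
  apply Complex.ext <;> simp <;> ring

theorem gradient_preSol (μ : ℝ) {α a : ℝ} (hα : 0 < α) {x : Plane}
    (hx : toPlane.symm x ∈ solDom α a) :
    ∇ (preSol μ α a) x = μ • toPlane (2 * conj (deriv (kFun α a) (toPlane.symm x))) := by
  have hk := (((differentiableOn_kFun hα a).differentiableAt
    ((isOpen_solDom α a).mem_nhds hx)).hasDerivAt).hasFDerivAt.restrictScalars ℝ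
  have h := ((reCLM.hasFDerivAt.comp x
    (hk.comp x toPlane.symm.toContinuousLinearEquiv.hasFDerivAt)).const_mul (2 * μ))
  refine HasGradientAt.gradient (hasGradientAt_iff_hasFDerivAt.2 (h.congr_fderiv ?_))
  ext v
  rw [InnerProductSpace.toDual_apply_apply, inner_smul_left, ← toPlane.symm.inner_map_map,
    LinearIsometryEquiv.symm_apply_apply]
  simp [Complex.inner]
  ring

theorem divergence_velSol {α a : ℝ} (hα : 0 < α) {x : Plane} (hx : toPlane.symm x ∈ solDom α a) :
    divergence (velSol α a) x = 0 := by
  rw [divergence, Matrix.trace_fin_two, velGrad, Matrix.of_apply, Matrix.of_apply,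
    fderiv_velSol_apply hα hx, fderiv_velSol_apply hα hx, toPlane_symm_single_zero,
    toPlane_symm_single_one, toPlane_zero, toPlane_one, hDeriv_apply, hDeriv_apply]
  simp

theorem tendsto_toPlane_symm : Tendsto toPlane.symm (cobounded Plane) (cobounded ℂ) :=
  tendsto_norm_atTop_iff_cobounded.1 (by
    simpa only [LinearIsometryEquiv.norm_map] using tendsto_norm_cobounded_atTop)

theorem decayClass_sol (μ : ℝ) {α : ℝ} (hα : 0 < α) (a : ℝ) :
    DecayClass (velSol α a) (preSol μ α a) := by
  have hn : ∀ x, ‖toPlane.symm x‖ = ‖x‖ := toPlane.symm.norm_map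
  refine ⟨⟨0, ?_⟩, ?_, ?_⟩
  · have h := (hFun_isBigO hα a).comp_tendsto tendsto_toPlane_symm
    refine IsBigO.trans (.of_bound 1 (.of_forall fun x => ?_)) (h.congr_right fun x => ?_)
    · rw [sub_zero, velSol, LinearIsometryEquiv.norm_map, one_mul, Function.comp]
    · rw [Function.comp, hn]
  · have h := (hDeriv_isBigO hα a).comp_tendsto tendsto_toPlane_symm
    refine IsBigO.trans (.of_bound 1 ?_) (h.congr_right fun x => ?_)
    · filter_upwards [tendsto_toPlane_symm.eventually (eventually_mem_solDom hα a)] with x hx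
      rw [one_mul]
      exact norm_fderiv_velSol_le hα hx
    · rw [Function.comp, hn]
  · have h := (kFun_isBigO hα a).comp_tendsto tendsto_toPlane_symm
    refine IsBigO.trans (.of_bound ‖2 * μ‖ (.of_forall fun x => ?_)) (h.congr_right fun x => ?_)
    · rw [preSol, norm_mul, Function.comp]
      gcongr
      exact abs_re_le_norm _
    · rw [Function.comp, hn]

theorem isRotSolution_sol {μ R δ α a : ℝ} (hα : 0 < α) (hR : 0 < R)
    (ha : R * Real.sinh α = a) (hc : R * Real.cosh α = R + δ / 2) :
    IsRotSolution μ R δ (velSol α a) (preSol μ α a) := by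
  have hsub : closure (exterior R δ) ⊆ toPlane.symm ⁻¹' solDom α a := fun x hx =>
    have h := norm_mob_mem_of_mem_closure hα hR ha hc hx
    mem_solDom_of_le hα h.1 h.2
  have hsub' := subset_closure.trans hsub
  refine ⟨(contDiffOn_velSol hα a).mono hsub', ((contDiffOn_preSol μ hα a).of_le
    (by norm_num)).mono hsub', ((contDiffOn_velSol hα a).of_le (by norm_num)).mono hsub,
    (contDiffOn_preSol μ hα a).continuousOn.mono hsub, fun x hx => ?_, fun x hx => ?_,
    fun x hx => ?_, decayClass_sol μ hα a⟩
  · rw [laplacian_velSol hα (hsub' hx), gradient_preSol μ hα (hsub' hx)]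
  · exact divergence_velSol hα (hsub' hx)
  · rw [disk1, disk2, frontier_ball _ hR.ne', frontier_ball _ hR.ne', Set.mem_union,
      Metric.mem_sphere, Metric.mem_sphere, dist_real, dist_real] at hx
    rw [← toPlane_neg_I_mul, velSol]
    congr 1
    rcases hx with h | h
    · have h' : ‖-toPlane.symm x - ((R + δ / 2 : ℝ) : ℂ)‖ = R := by
        rw [show -toPlane.symm x - ((R + δ / 2 : ℝ) : ℂ) =
          -(toPlane.symm x - ((-R - δ / 2 : ℝ) : ℂ)) by push_cast; ring, norm_neg, h]
      have := hFun_boundary_right hα (norm_mob_eq hα hR ha hc h')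
      rw [hFun_neg] at this
      linear_combination -this
    · exact hFun_boundary_right hα (norm_mob_eq hα hR ha hc h)

/-- The bipolar parameter of the two circles. -/
theorem exists_bipolar {R δ : ℝ} (hR : 0 < R) (hδ : 0 < δ) :
    ∃ α, 0 < α ∧ R * Real.cosh α = R + δ / 2 ∧ α ^ 2 ≤ δ / R := by
  have h : 1 < 1 + δ / (2 * R) := by linarith [div_pos hδ (mul_pos two_pos hR)]
  have hc := Real.cosh_arcosh h.le
  refine ⟨Real.arcosh (1 + δ / (2 * R)), Real.arcosh_pos h, ?_, ?_⟩
  · rw [hc]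
    field_simp
  · set α := Real.arcosh (1 + δ / (2 * R))
    have hα : 0 < α := Real.arcosh_pos h
    have h1 : α / 2 ≤ Real.sinh (α / 2) := Real.self_le_sinh_iff.2 (by positivity)
    have h2 : δ / R = 2 * (δ / (2 * R)) := by field_simp
    have h3 := Real.cosh_two_mul (α / 2)
    rw [Real.cosh_sq, mul_div_cancel₀ _ two_ne_zero, hc] at h3
    nlinarith

/-! ### Strain, stress and the uniform bound for the explicit solution. -/

theorem abs_strain_le (u : Plane → Plane) (x : Plane) (i j : Fin 2) :
    |strain u x i j| ≤ ‖fderiv ℝ u x‖ := by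
  have h : ∀ i j, |velGrad u x i j| ≤ ‖fderiv ℝ u x‖ := fun i j => by
    have h1 := PiLp.norm_apply_le (fderiv ℝ u x (EuclideanSpace.single j 1)) i
    have h2 := (fderiv ℝ u x).le_opNorm (EuclideanSpace.single j 1)
    simp only [PiLp.norm_single, norm_one, mul_one] at h2
    exact h1.trans h2
  rw [strain, Matrix.smul_apply, Matrix.add_apply, Matrix.transpose_apply, smul_eq_mul, abs_mul,
    abs_of_nonneg (by norm_num : (0 : ℝ) ≤ 1 / 2)]
  linarith [abs_add_le (velGrad u x i j) (velGrad u x j i), h i j, h j i]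

theorem abs_stress_le {μ : ℝ} (hμ : 0 < μ) (u : Plane → Plane) (p : Plane → ℝ) (x : Plane)
    (i j : Fin 2) : |stress μ u p x i j| ≤ |p x| + 2 * μ * |strain u x i j| := by
  rw [stress, Matrix.add_apply, Matrix.smul_apply, Matrix.smul_apply, smul_eq_mul, smul_eq_mul]
  refine (abs_add_le _ _).trans (add_le_add ?_ ?_)
  · rw [abs_mul, abs_neg, Matrix.one_apply]
    split_ifs <;> simp
  · rw [abs_mul, abs_of_pos (by positivity)]

theorem exists_bound_sol {R μ : ℝ} (hR : 0 < R) (hμ : 0 < μ) {δ₀ : ℝ} (hδ₀ : 0 < δ₀) :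
    ∃ K : ℝ, ∀ δ, 0 < δ → δ ≤ δ₀ → ∃ u p, IsRotSolution μ R δ u p ∧ ∀ x ∈ exterior R δ,
      ‖fderiv ℝ u x‖ ≤ K ∧ |p x| ≤ 2 * μ * K := by
  obtain ⟨K, hK⟩ := exists_wnorm_bounds (M := √(δ₀ / R)) (by positivity)
  refine ⟨K + (K + K), fun δ hδ hδ' => ?_⟩
  obtain ⟨α, hα, hc, hle⟩ := exists_bipolar hR hδ
  have hαM : α ≤ √(δ₀ / R) := Real.le_sqrt_of_sq_le (hle.trans (by gcongr))
  obtain ⟨⟨s1, b1⟩, ⟨s2, b2⟩, s3, b3⟩ := hK α hα hαM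
  refine ⟨_, _, isRotSolution_sol hα hR rfl hc, fun x hx => ?_⟩
  obtain ⟨h1, h2⟩ := norm_mob_mem_of_mem_closure hα hR rfl hc (subset_closure hx)
  have c1 := norm_kFun_le h1 h2 s1
  have c2 := norm_lFun_le h1 h2 s2
  have c3 := norm_re_mul_deriv_kFun_le hα h1 h2 s3
  have hK0 : 0 ≤ K := (norm_nonneg _).trans (c1.trans b1)
  constructor
  · refine (norm_fderiv_velSol_le hα (mem_solDom_of_le hα h1 h2)).trans
      ((norm_hDeriv_le _ _ _).trans (add_le_add (c1.trans b1) ((norm_add_le _ _).trans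
        (add_le_add (c3.trans b3) (c2.trans b2)))))
  · rw [preSol, abs_mul, abs_of_pos (by positivity)]
    gcongr
    exact ((abs_re_le_norm _).trans (c1.trans b1)).trans (by linarith)

end

section

open Filter Topology MeasureTheory

/-! ### The energy identity on domains with vanishing boundary values -/

/-- The coordinate vectors of the plane. -/
abbrev stdVec (j : Fin 2) : Plane := EuclideanSpace.single j 1

theorem norm_stdVec (j : Fin 2) : ‖stdVec j‖ = 1 := by simp [stdVec]

theorem deriv_smoothTransition_of_neg {x : ℝ} (hx : x < 0) : deriv Real.smoothTransition x = 0 := by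
  have h : Real.smoothTransition =ᶠ[𝓝 x] fun _ => 0 := by
    filter_upwards [Iio_mem_nhds hx] with y hy
    exact Real.smoothTransition.zero_of_nonpos (Set.mem_Iio.1 hy).le
  rw [h.deriv_eq, deriv_const]

theorem deriv_smoothTransition_of_one_lt {x : ℝ} (hx : 1 < x) :
    deriv Real.smoothTransition x = 0 := by
  have h : Real.smoothTransition =ᶠ[𝓝 x] fun _ => 1 := by
    filter_upwards [Ioi_mem_nhds hx] with y hy
    exact Real.smoothTransition.one_of_one_le (Set.mem_Ioi.1 hy).le
  rw [h.deriv_eq, deriv_const]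

theorem hasDerivAt_smoothTransition (x : ℝ) :
    HasDerivAt Real.smoothTransition (deriv Real.smoothTransition x) x :=
  ((Real.smoothTransition.contDiff (n := 1)).differentiable (by norm_num) x).hasDerivAt

theorem exists_abs_deriv_smoothTransition_le :
    ∃ B : ℝ, 0 ≤ B ∧ ∀ x, |deriv Real.smoothTransition x| ≤ B := by
  obtain ⟨B, hB⟩ := isCompact_Icc.exists_bound_of_continuousOn (s := Set.Icc (0 : ℝ) 1)
    ((Real.smoothTransition.contDiff (n := 1)).continuous_deriv (by norm_num)).continuousOn
  have hB0 : 0 ≤ B := (norm_nonneg _).trans (hB 0 (by simp))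
  refine ⟨B, hB0, fun x => ?_⟩
  rcases lt_or_ge x 0 with h | h
  · rwa [deriv_smoothTransition_of_neg h, abs_zero]
  rcases lt_or_ge 1 x with h' | h'
  · rwa [deriv_smoothTransition_of_one_lt h', abs_zero]
  · exact hB x ⟨h, h'⟩

/-- A cutoff that vanishes where `w` is small and far away. -/
def cutoff (w : Plane → Plane) (m : ℝ) (x : Plane) : ℝ :=
  Real.smoothTransition (m ^ 2 * ‖w x‖ ^ 2 - 1) * Real.smoothTransition (2 - ‖x‖ ^ 2 / m ^ 2)

theorem cutoff_eq_zero_of_small {w : Plane → Plane} {m : ℝ} {x : Plane}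
    (h : m ^ 2 * ‖w x‖ ^ 2 ≤ 1) : cutoff w m x = 0 := by
  rw [cutoff, Real.smoothTransition.zero_of_nonpos (by linarith), zero_mul]

theorem cutoff_eq_zero_of_far {w : Plane → Plane} {m : ℝ} (hm : 0 < m) {x : Plane}
    (h : 2 * m ^ 2 ≤ ‖x‖ ^ 2) : cutoff w m x = 0 := by
  have : 2 ≤ ‖x‖ ^ 2 / m ^ 2 := (le_div_iff₀ (by positivity)).2 h
  rw [cutoff, Real.smoothTransition.zero_of_nonpos (x := 2 - ‖x‖ ^ 2 / m ^ 2) (by linarith),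
    mul_zero]

theorem cutoff_eq_one {w : Plane → Plane} {m : ℝ} (hm : 0 < m) {x : Plane}
    (h : 2 ≤ m ^ 2 * ‖w x‖ ^ 2) (h' : ‖x‖ ^ 2 ≤ m ^ 2) : cutoff w m x = 1 := by
  have : ‖x‖ ^ 2 / m ^ 2 ≤ 1 := (div_le_one₀ (by positivity)).2 h'
  rw [cutoff, Real.smoothTransition.one_of_one_le (by linarith),
    Real.smoothTransition.one_of_one_le (by linarith), mul_one]

theorem cutoff_nonneg (w : Plane → Plane) (m : ℝ) (x : Plane) : 0 ≤ cutoff w m x :=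
  mul_nonneg (Real.smoothTransition.nonneg _) (Real.smoothTransition.nonneg _)

theorem cutoff_le_one (w : Plane → Plane) (m : ℝ) (x : Plane) : cutoff w m x ≤ 1 :=
  mul_le_one₀ (Real.smoothTransition.le_one _) (Real.smoothTransition.nonneg _)
    (Real.smoothTransition.le_one _)

theorem contDiffOn_cutoff {w : Plane → Plane} {U : Set Plane} (hw : ContDiffOn ℝ 1 w U) (m : ℝ) :
    ContDiffOn ℝ 1 (cutoff w m) U := by
  have h := Real.smoothTransition.contDiff (n := 1)
  exact (h.comp_contDiffOn ((contDiffOn_const.mul (hw.norm_sq ℝ)).sub contDiffOn_const)).mul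
    (h.comp_contDiffOn (contDiffOn_const.sub ((contDiffOn_id.norm_sq ℝ).div_const _)))

theorem fderiv_cutoff_apply {w : Plane → Plane} {x : Plane} (hw : DifferentiableAt ℝ w x) (m : ℝ)
    (v : Plane) : fderiv ℝ (cutoff w m) x v =
      deriv Real.smoothTransition (m ^ 2 * ‖w x‖ ^ 2 - 1) *
        (m ^ 2 * (2 * inner ℝ (w x) (fderiv ℝ w x v))) *
        Real.smoothTransition (2 - ‖x‖ ^ 2 / m ^ 2) -
      Real.smoothTransition (m ^ 2 * ‖w x‖ ^ 2 - 1) *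
        (deriv Real.smoothTransition (2 - ‖x‖ ^ 2 / m ^ 2) * (2 * inner ℝ x v / m ^ 2)) := by
  have h1 : HasFDerivAt (fun x => m ^ 2 * ‖w x‖ ^ 2 - 1) _ x :=
    (hw.hasFDerivAt.norm_sq.const_mul (m ^ 2)).sub_const 1
  have h2 : HasFDerivAt (fun x : Plane => 2 - ‖x‖ ^ 2 / m ^ 2) _ x :=
    (((hasFDerivAt_id x).norm_sq).mul_const (m ^ 2)⁻¹).const_sub 2
  have h3 := (hasDerivAt_smoothTransition _).comp_hasFDerivAt x h1
  have h4 := (hasDerivAt_smoothTransition _).comp_hasFDerivAt x h2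
  have h5 : HasFDerivAt (cutoff w m) _ x := h3.mul h4
  rw [h5.fderiv]
  simp
  ring

/-- The difference of two solutions, on a domain on the boundary of which it vanishes. -/
structure HomStokes (μ : ℝ) (U : Set Plane) (w : Plane → Plane) (q : Plane → ℝ) : Prop where
  isOpen : IsOpen U
  velocity : ContDiffOn ℝ 2 w U
  pressure : ContDiffOn ℝ 1 q U
  momentum : ∀ x ∈ U, μ • (Δ w) x = ∇ q x
  incompressible : ∀ x ∈ U, divergence w x = 0
  vanishing : ∀ x ∉ U, ∀ ε > 0, ∀ᶠ y in 𝓝 x, y ∈ U → ‖w y‖ < ε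
  bounded : ∃ A, ∀ x ∈ U, ‖w x‖ ≤ A ∧ ‖fderiv ℝ w x‖ ≤ A * ((1 + ‖x‖)⁻¹) ^ 2 ∧
    |q x| ≤ A * ((1 + ‖x‖)⁻¹) ^ 2

/-- A (non-symmetric) stress vector. -/
def stressVec (μ : ℝ) (w : Plane → Plane) (q : Plane → ℝ) (j : Fin 2) (x : Plane) : Plane :=
  μ • fderiv ℝ w x (stdVec j) - q x • stdVec j

/-- The energy flux. -/
def flux (μ : ℝ) (w : Plane → Plane) (q : Plane → ℝ) (j : Fin 2) (x : Plane) : ℝ :=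
  inner ℝ (w x) (stressVec μ w q j x)

/-- The energy density. -/
def energy (w : Plane → Plane) (x : Plane) : ℝ := ∑ j, ‖fderiv ℝ w x (stdVec j)‖ ^ 2

/-- The truncated energy flux. -/
def truncFlux (μ : ℝ) (U : Set Plane) (w : Plane → Plane) (q : Plane → ℝ) (m : ℝ) (j : Fin 2) :
    Plane → ℝ :=
  U.indicator fun x => cutoff w m x * flux μ w q j x

namespace HomStokes

variable {μ : ℝ} {U : Set Plane} {w : Plane → Plane} {q : Plane → ℝ}

theorem contDiffOn_fderiv (h : HomStokes μ U w q) : ContDiffOn ℝ 1 (fderiv ℝ w) U :=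
  h.velocity.fderiv_of_isOpen h.isOpen (by norm_num)

theorem contDiffOn_stressVec (h : HomStokes μ U w q) (j : Fin 2) :
    ContDiffOn ℝ 1 (stressVec μ w q j) U := by
  have h1 := (h.contDiffOn_fderiv.clm_apply (contDiffOn_const (c := stdVec j))).const_smul μ
  have h2 := h.pressure.smul (contDiffOn_const (c := stdVec j))
  exact h1.sub h2

theorem contDiffOn_flux (h : HomStokes μ U w q) (j : Fin 2) : ContDiffOn ℝ 1 (flux μ w q j) U :=
  (h.velocity.of_le (by norm_num)).inner ℝ (h.contDiffOn_stressVec j)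

theorem differentiableAt (h : HomStokes μ U w q) {x : Plane} (hx : x ∈ U) :
    DifferentiableAt ℝ w x :=
  (h.velocity.contDiffAt (h.isOpen.mem_nhds hx)).differentiableAt (by norm_num)

/-- With the non-symmetric stress `μ ∇w - q I` the momentum equation says that the stress vectors
have zero divergence, and incompressibility removes the pressure work. -/
theorem sum_fderiv_flux (h : HomStokes μ U w q) {x : Plane} (hx : x ∈ U) :
    ∑ j, fderiv ℝ (flux μ w q j) x (stdVec j) = μ * energy w x := by
  have hU := h.isOpen.mem_nhds hx
  have hw := h.differentiableAt hx
  have hq : DifferentiableAt ℝ q x := (h.pressure.contDiffAt hU).differentiableAt (by norm_num)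
  have hdw : DifferentiableAt ℝ (fderiv ℝ w) x :=
    (h.contDiffOn_fderiv.contDiffAt hU).differentiableAt (by norm_num)
  have hT : ∀ j, DifferentiableAt ℝ (stressVec μ w q j) x := fun j =>
    ((h.contDiffOn_stressVec j).contDiffAt hU).differentiableAt (by norm_num)
  have hg : ∇ q x = ∑ j, fderiv ℝ q x (stdVec j) • stdVec j := by
    have hi : ∀ i, (∇ q x) i = fderiv ℝ q x (stdVec i) := fun i => by
      rw [← inner_gradient_left, EuclideanSpace.inner_single_right]; simp
    ext i; fin_cases i <;> simp [Fin.sum_univ_two, hi, stdVec]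
  have hdT : ∀ j, fderiv ℝ (stressVec μ w q j) x (stdVec j) =
      μ • fderiv ℝ (fun y => fderiv ℝ w y (stdVec j)) x (stdVec j) -
        fderiv ℝ q x (stdVec j) • stdVec j := fun j => by
    have h1 : DifferentiableAt ℝ (fun y => fderiv ℝ w y (stdVec j)) x :=
      hdw.clm_apply (differentiableAt_const _)
    have h2 : HasFDerivAt (stressVec μ w q j) _ x :=
      (h1.hasFDerivAt.const_smul μ).sub (hq.hasFDerivAt.smul_const (stdVec j))
    rw [h2.fderiv]
    simp
  have hsum : ∑ j, fderiv ℝ (stressVec μ w q j) x (stdVec j) = 0 := by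
    simp only [hdT]
    rw [Finset.sum_sub_distrib, ← Finset.smul_sum, ← hg, ← h.momentum x hx,
      laplacian_eq_sum (h.velocity.contDiffAt hU), sub_self]
  have hdiv : ∑ j, inner ℝ (fderiv ℝ w x (stdVec j)) (stdVec j) = 0 := by
    rw [← h.incompressible x hx, divergence, Matrix.trace]
    refine Finset.sum_congr rfl fun j _ => ?_
    rw [EuclideanSpace.inner_single_right]
    simp [velGrad]
  have e : ∀ j, fderiv ℝ (flux μ w q j) x (stdVec j) =
      inner ℝ (w x) (fderiv ℝ (stressVec μ w q j) x (stdVec j)) +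
        (μ * ‖fderiv ℝ w x (stdVec j)‖ ^ 2 -
          q x * inner ℝ (fderiv ℝ w x (stdVec j)) (stdVec j)) := fun j => by
    rw [← real_inner_self_eq_norm_sq, ← inner_smul_right, ← inner_smul_right, ← inner_sub_right]
    exact fderiv_inner_apply ℝ hw (hT j) _
  simp only [e]
  rw [Finset.sum_add_distrib, ← inner_sum, hsum, inner_zero_right, Finset.sum_sub_distrib,
    ← Finset.mul_sum, ← Finset.mul_sum, hdiv, energy]
  ring

theorem truncFlux_eventuallyEq (h : HomStokes μ U w q) (m : ℝ) (j : Fin 2) {x : Plane}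
    (hx : x ∈ U) : truncFlux μ U w q m j =ᶠ[𝓝 x] fun y => cutoff w m y * flux μ w q j y := by
  filter_upwards [h.isOpen.mem_nhds hx] with y hy
  exact Set.indicator_of_mem hy _

/-- `w` tends to 0 at the boundary, so the cutoff is zero near every boundary point. The extension
by zero is thus `C¹` with no regularity asked of the boundary. -/
theorem truncFlux_eventuallyEq_zero (h : HomStokes μ U w q) {m : ℝ} (hm : 0 < m) (j : Fin 2)
    {x : Plane} (hx : x ∉ U) : truncFlux μ U w q m j =ᶠ[𝓝 x] fun _ => 0 := by
  filter_upwards [h.vanishing x hx m⁻¹ (inv_pos.2 hm)] with y hy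
  by_cases hyU : y ∈ U
  · rw [truncFlux, Set.indicator_of_mem hyU, cutoff_eq_zero_of_small, zero_mul]
    have h1 := hy hyU
    rw [← mul_pow]
    have h2 : m * ‖w y‖ ≤ 1 := by
      have := mul_le_mul_of_nonneg_left h1.le hm.le
      rwa [mul_inv_cancel₀ hm.ne'] at this
    exact pow_le_one₀ (by positivity) h2
  · exact Set.indicator_of_notMem hyU _

theorem contDiff_truncFlux (h : HomStokes μ U w q) {m : ℝ} (hm : 0 < m) (j : Fin 2) :
    ContDiff ℝ 1 (truncFlux μ U w q m j) := by
  rw [contDiff_iff_contDiffAt]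
  intro x
  by_cases hx : x ∈ U
  · refine ContDiffAt.congr_of_eventuallyEq ?_ (h.truncFlux_eventuallyEq m j hx)
    exact ((contDiffOn_cutoff (h.velocity.of_le (by norm_num)) m).mul
      (h.contDiffOn_flux j)).contDiffAt (h.isOpen.mem_nhds hx)
  · exact contDiffAt_const.congr_of_eventuallyEq (h.truncFlux_eventuallyEq_zero hm j hx)

theorem hasCompactSupport_truncFlux (μ : ℝ) (U : Set Plane) (w : Plane → Plane) (q : Plane → ℝ)
    {m : ℝ} (hm : 0 < m) (j : Fin 2) : HasCompactSupport (truncFlux μ U w q m j) := by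
  refine HasCompactSupport.intro (isCompact_closedBall 0 (2 * m)) fun x hx => ?_
  rw [mem_closedBall_zero_iff, not_le] at hx
  by_cases hxU : x ∈ U
  · rw [truncFlux, Set.indicator_of_mem hxU, cutoff_eq_zero_of_far hm (by nlinarith), zero_mul]
  · exact Set.indicator_of_notMem hxU _

theorem integrable_fderiv_truncFlux (h : HomStokes μ U w q) {m : ℝ} (hm : 0 < m) (j : Fin 2) :
    Integrable fun x => fderiv ℝ (truncFlux μ U w q m j) x (stdVec j) :=
  (((h.contDiff_truncFlux hm j).continuous_fderiv (by norm_num)).clm_apply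
    continuous_const).integrable_of_hasCompactSupport
      ((hasCompactSupport_truncFlux μ U w q hm j).fderiv_apply ℝ _)

theorem integral_fderiv_truncFlux (h : HomStokes μ U w q) {m : ℝ} (hm : 0 < m) (j : Fin 2) :
    ∫ x, fderiv ℝ (truncFlux μ U w q m j) x (stdVec j) = 0 := by
  have h0 := (h.contDiff_truncFlux hm j).continuous.integrable_of_hasCompactSupport (μ := volume)
    (hasCompactSupport_truncFlux μ U w q hm j)
  -- Integration by parts against the constant function 1.
  have := integral_mul_fderiv_eq_neg_fderiv_mul_of_integrable (μ := volume) (𝕜 := ℝ)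
    (f := fun _ : Plane => (1 : ℝ)) (g := truncFlux μ U w q m j) (v := stdVec j) (by simp)
    (by simpa using h.integrable_fderiv_truncFlux hm j) (by simpa using h0)
    (fun _ _ => differentiableAt_const _)
    (fun x _ => (h.contDiff_truncFlux hm j).differentiable (by norm_num) x)
  simpa using this

theorem fderiv_truncFlux (h : HomStokes μ U w q) (m : ℝ) (j : Fin 2) {x : Plane} (hx : x ∈ U)
    (v : Plane) : fderiv ℝ (truncFlux μ U w q m j) x v =
      cutoff w m x * fderiv ℝ (flux μ w q j) x v +
        flux μ w q j x * fderiv ℝ (cutoff w m) x v := by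
  have hU := h.isOpen.mem_nhds hx
  have h1 := ((contDiffOn_cutoff (h.velocity.of_le (by norm_num)) m).contDiffAt
    hU).differentiableAt (by norm_num)
  have h2 := ((h.contDiffOn_flux j).contDiffAt hU).differentiableAt (by norm_num)
  have h3 : HasFDerivAt (fun y => cutoff w m y * flux μ w q j y) _ x :=
    h1.hasFDerivAt.mul h2.hasFDerivAt
  rw [(h.truncFlux_eventuallyEq m j hx).fderiv_eq, h3.fderiv]
  simp

/-- At a fixed point where `w` does not vanish, the cutoff is identically 1 nearby for all large
`m`, so the sequence is eventually constant there. -/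
theorem tendsto_sum_fderiv_truncFlux (h : HomStokes μ U w q) (h0 : ∀ x ∈ U, w x ≠ 0) (x : Plane) :
    Tendsto (fun n : ℕ => ∑ j, fderiv ℝ (truncFlux μ U w q (n + 1) j) x (stdVec j)) atTop
      (𝓝 (U.indicator (fun x => μ * energy w x) x)) := by
  refine tendsto_const_nhds.congr' ?_
  by_cases hx : x ∈ U
  · have hw0 : 0 < ‖w x‖ := norm_pos_iff.2 (h0 x hx)
    filter_upwards [tendsto_natCast_atTop_atTop.eventually_gt_atTop (‖x‖ + 2 * ‖w x‖⁻¹)] with n hn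
    have hm : (0 : ℝ) < n + 1 := by positivity
    have e1 : ∀ᶠ y in 𝓝 x, cutoff w (n + 1) y = 1 := by
      have c1 : ∀ᶠ y in 𝓝 x, 2 < ((n : ℝ) + 1) * ‖w y‖ := by
        refine ((h.differentiableAt hx).continuousAt.norm.const_mul
          ((n : ℝ) + 1)).eventually_const_lt ?_
        have : 2 * ‖w x‖⁻¹ < n + 1 := by linarith [norm_nonneg x]
        have := mul_lt_mul_of_pos_right this hw0
        rwa [mul_assoc, inv_mul_cancel₀ hw0.ne', mul_one] at this
      have c2 : ∀ᶠ y in 𝓝 x, ‖y‖ < n + 1 := by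
        refine (continuous_norm.tendsto x).eventually_lt_const ?_
        have : 0 < ‖w x‖⁻¹ := by positivity
        linarith
      filter_upwards [c1, c2] with y h1 h2
      refine cutoff_eq_one hm ?_ ?_
      · rw [← mul_pow]; nlinarith
      · exact pow_le_pow_left₀ (norm_nonneg _) h2.le 2
    have e2 : fderiv ℝ (cutoff w (n + 1)) x = 0 := by
      rw [EventuallyEq.fderiv_eq (f := fun _ => (1 : ℝ)) e1]; simp
    rw [Set.indicator_of_mem hx, ← h.sum_fderiv_flux hx]
    refine Finset.sum_congr rfl fun j _ => ?_
    rw [h.fderiv_truncFlux _ j hx, e1.self_of_nhds, e2]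
    simp
  · refine .of_forall fun n => ?_
    rw [Set.indicator_of_notMem hx]
    refine (Finset.sum_eq_zero ?_).symm
    intro j _
    rw [(h.truncFlux_eventuallyEq_zero (by positivity) j hx).fderiv_eq]
    simp

theorem norm_fderiv_stdVec_le (w : Plane → Plane) (x : Plane) (j : Fin 2) :
    ‖fderiv ℝ w x (stdVec j)‖ ≤ ‖fderiv ℝ w x‖ := by
  simpa [norm_stdVec] using (fderiv ℝ w x).le_opNorm (stdVec j)

/-- The dominating function, independent of the cutoff parameter. The danger is the cutoff gradient,
which lives in a layer where `|w|` is about `1/m` and in one where `|x|` is about `m`. -/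
theorem exists_bound_sum_fderiv_truncFlux (hμ : 0 < μ) (h : HomStokes μ U w q) :
    ∃ K, 0 ≤ K ∧ ∀ m : ℝ, 1 ≤ m → ∀ x,
      |∑ j, fderiv ℝ (truncFlux μ U w q m j) x (stdVec j)| ≤ K * ((1 + ‖x‖)⁻¹) ^ 3 := by
  obtain ⟨B, hB0, hB⟩ := exists_abs_deriv_smoothTransition_le
  obtain ⟨A', hA'⟩ := h.bounded
  set A := |A'| with hAdef
  have hA0 : 0 ≤ A := abs_nonneg _
  set T := (μ + 1) * A with hTdef
  have hT0 : 0 ≤ T := by positivity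
  refine ⟨μ * (A ^ 2 + A ^ 2) + (4 * B * A * T + 8 * B * A * T + (4 * B * A * T + 8 * B * A * T)),
    by positivity, fun m hm x => ?_⟩
  have hm0 : 0 < m := by linarith
  set r := (1 + ‖x‖)⁻¹ with hr
  have hr0 : 0 < r := by positivity
  have hr1 : r ≤ 1 := inv_le_one_of_one_le₀ (by linarith [norm_nonneg x])
  by_cases hx : x ∈ U
  swap
  · rw [Finset.sum_eq_zero]
    · rw [abs_zero]; positivity
    · intro j _
      rw [(h.truncFlux_eventuallyEq_zero hm0 j hx).fderiv_eq]
      simp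
  have hA : ‖w x‖ ≤ A ∧ ‖fderiv ℝ w x‖ ≤ A * r ^ 2 ∧ |q x| ≤ A * r ^ 2 := by
    obtain ⟨h1, h2, h3⟩ := hA' x hx
    have h4 : A' ≤ A := le_abs_self _
    have h5 : A' * r ^ 2 ≤ A * r ^ 2 := by gcongr
    exact ⟨h1.trans h4, h2.trans h5, h3.trans h5⟩
  obtain ⟨hw, hdw, hq⟩ := hA
  have hdj : ∀ j, ‖fderiv ℝ w x (stdVec j)‖ ≤ A * r ^ 2 :=
    fun j => (norm_fderiv_stdVec_le w x j).trans hdw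
  have hT : ∀ j, ‖stressVec μ w q j x‖ ≤ T * r ^ 2 := fun j => by
    refine (norm_sub_le _ _).trans ?_
    rw [norm_smul, norm_smul, Real.norm_of_nonneg hμ.le, norm_stdVec, mul_one, Real.norm_eq_abs]
    calc μ * ‖fderiv ℝ w x (stdVec j)‖ + |q x| ≤ μ * (A * r ^ 2) + A * r ^ 2 := by
          gcongr; exact hdj j
      _ = T * r ^ 2 := by rw [hTdef]; ring
  have hflux : ∀ j, |flux μ w q j x| ≤ ‖w x‖ * (T * r ^ 2) := fun j =>
    (abs_real_inner_le_norm _ _).trans (by gcongr; exact hT j)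
  have hr4 : r ^ 4 ≤ r ^ 3 := pow_le_pow_of_le_one hr0.le hr1 (by norm_num)
  have hE : |cutoff w m x * (μ * energy w x)| ≤ μ * (A ^ 2 + A ^ 2) * r ^ 3 := by
    have hE0 : 0 ≤ energy w x := Finset.sum_nonneg fun _ _ => by positivity
    rw [abs_of_nonneg (mul_nonneg (cutoff_nonneg _ _ _) (by positivity))]
    calc cutoff w m x * (μ * energy w x) ≤ 1 * (μ * energy w x) := by
          gcongr; exact cutoff_le_one _ _ _
      _ ≤ μ * ((A * r ^ 2) ^ 2 + (A * r ^ 2) ^ 2) := by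
          rw [one_mul, energy, Fin.sum_univ_two]
          gcongr <;> exact hdj _
      _ = μ * (A ^ 2 + A ^ 2) * r ^ 4 := by ring
      _ ≤ _ := by gcongr
  have hC : ∀ j, |flux μ w q j x * fderiv ℝ (cutoff w m) x (stdVec j)| ≤
      (4 * B * A * T + 8 * B * A * T) * r ^ 3 := fun j => by
    have s1 := Real.smoothTransition.nonneg (m ^ 2 * ‖w x‖ ^ 2 - 1)
    have s2 := Real.smoothTransition.nonneg (2 - ‖x‖ ^ 2 / m ^ 2)
    rw [fderiv_cutoff_apply (h.differentiableAt hx), mul_sub, add_mul]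
    refine (abs_sub _ _).trans (add_le_add ?_ ?_)
    -- In the inner layer one factor `|w|` from the flux and one from the cutoff gradient compensate
    -- `m²`; four powers of decay remain.
    · by_cases hs : m ^ 2 * ‖w x‖ ^ 2 ≤ 2
      · rw [abs_mul, abs_mul, abs_mul, abs_mul, abs_mul, abs_of_nonneg (sq_nonneg m),
          abs_of_pos (two_pos : (0 : ℝ) < 2), abs_of_nonneg (Real.smoothTransition.nonneg _)]
        have hi : |inner ℝ (w x) (fderiv ℝ w x (stdVec j))| ≤ ‖w x‖ * (A * r ^ 2) :=
          (abs_real_inner_le_norm _ _).trans (by gcongr; exact hdj j)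
        calc _ ≤ ‖w x‖ * (T * r ^ 2) * (B * (m ^ 2 * (2 * (‖w x‖ * (A * r ^ 2)))) * 1) := by
              gcongr
              · exact hflux j
              · exact hB _
              · exact Real.smoothTransition.le_one _
          _ = 2 * B * A * T * r ^ 4 * (m ^ 2 * ‖w x‖ ^ 2) := by ring
          _ ≤ 2 * B * A * T * r ^ 3 * 2 := by gcongr
          _ = _ := by ring
      · rw [deriv_smoothTransition_of_one_lt (by linarith)]
        simp only [zero_mul, mul_zero, abs_zero]
        positivity
    -- In the outer layer `m ≤ ‖x‖`, so the cutoff gradient supplies one power of decay and the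
    -- stress the other two.
    · by_cases hs : 0 ≤ 2 - ‖x‖ ^ 2 / m ^ 2 ∧ 2 - ‖x‖ ^ 2 / m ^ 2 ≤ 1
      · have hs1 : ‖x‖ ^ 2 ≤ 2 * m ^ 2 := (div_le_iff₀ (by positivity)).1 (by linarith [hs.1])
        have hs2 : m ^ 2 ≤ ‖x‖ ^ 2 := by
          have := (le_div_iff₀ (by positivity : 0 < m ^ 2)).1 (by linarith [hs.2] :
            1 ≤ ‖x‖ ^ 2 / m ^ 2)
          linarith
        have hxm : m ≤ ‖x‖ := le_of_sq_le_sq hs2 (norm_nonneg x)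
        have hin : |inner ℝ x (stdVec j)| ≤ ‖x‖ := by
          simpa [norm_stdVec] using abs_real_inner_le_norm x (stdVec j)
        have hd : 2 * ‖x‖ / m ^ 2 ≤ 8 * r := by
          rw [hr, div_le_iff₀ (by positivity), ← div_eq_mul_inv, div_mul_eq_mul_div,
            le_div_iff₀ (by positivity)]
          nlinarith
        rw [abs_mul, abs_mul, abs_mul, abs_div, abs_mul, abs_of_nonneg (sq_nonneg m),
          abs_of_pos (two_pos : (0 : ℝ) < 2), abs_of_nonneg (Real.smoothTransition.nonneg _)]
        calc _ ≤ A * (T * r ^ 2) * (1 * (B * (8 * r))) := by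
              gcongr
              · exact (hflux j).trans (by gcongr)
              · exact Real.smoothTransition.le_one _
              · exact hB _
              · refine le_trans ?_ hd
                gcongr
          _ = _ := by ring
      · have : deriv Real.smoothTransition (2 - ‖x‖ ^ 2 / m ^ 2) = 0 := by
          rw [not_and_or, not_le, not_le] at hs
          exact hs.elim deriv_smoothTransition_of_neg deriv_smoothTransition_of_one_lt
        rw [this]
        simp only [zero_mul, mul_zero, abs_zero]
        positivity
  have hsum : ∑ j, fderiv ℝ (truncFlux μ U w q m j) x (stdVec j) =
      cutoff w m x * (μ * energy w x) +
        (flux μ w q 0 x * fderiv ℝ (cutoff w m) x (stdVec 0) +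
          flux μ w q 1 x * fderiv ℝ (cutoff w m) x (stdVec 1)) := by
    rw [← h.sum_fderiv_flux hx, Fin.sum_univ_two, Fin.sum_univ_two, h.fderiv_truncFlux m 0 hx,
      h.fderiv_truncFlux m 1 hx]
    ring
  rw [hsum]
  refine (abs_add_le _ _).trans ?_
  rw [add_mul (μ * (A ^ 2 + A ^ 2)), add_mul (4 * B * A * T + 8 * B * A * T)]
  exact add_le_add hE ((abs_add_le _ _).trans (add_le_add (hC 0) (hC 1)))

theorem integrable_one_add_norm_inv_cube :
    Integrable fun x : Plane => ((1 + ‖x‖)⁻¹) ^ 3 := by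
  have := integrable_one_add_norm (E := Plane) (μ := volume) (r := 3) (by simp; norm_num)
  refine this.congr (.of_forall fun x => ?_)
  change (1 + ‖x‖) ^ (-3 : ℝ) = ((1 + ‖x‖)⁻¹) ^ 3
  rw [Real.rpow_neg (by positivity), inv_pow]
  norm_cast

theorem fderiv_eq_zero_of_ne_zero (hμ : 0 < μ) (h : HomStokes μ U w q) (h0 : ∀ x ∈ U, w x ≠ 0)
    {x : Plane} (hx : x ∈ U) : fderiv ℝ w x = 0 := by
  obtain ⟨K, -, hK⟩ := h.exists_bound_sum_fderiv_truncFlux hμ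
  have hm : ∀ n : ℕ, (1 : ℝ) ≤ n + 1 := fun n => by linarith [n.cast_nonneg (α := ℝ)]
  have hb := integrable_one_add_norm_inv_cube.const_mul K
  have hmeas : ∀ n : ℕ, AEStronglyMeasurable (fun x =>
      ∑ j, fderiv ℝ (truncFlux μ U w q (n + 1) j) x (stdVec j)) volume := fun n =>
    (integrable_finsetSum _ fun j _ =>
      h.integrable_fderiv_truncFlux (by linarith [hm n]) j).aestronglyMeasurable
  have hlim := tendsto_integral_of_dominated_convergence _ hmeas hb
    (fun n => .of_forall fun x => hK _ (hm n) x)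
    (.of_forall fun x => h.tendsto_sum_fderiv_truncFlux h0 x)
  have hint0 : ∫ x, U.indicator (fun x => μ * energy w x) x = 0 := by
    refine tendsto_nhds_unique hlim (tendsto_const_nhds.congr fun n => ?_)
    rw [integral_finsetSum _ fun j _ => h.integrable_fderiv_truncFlux (by linarith [hm n]) j,
      Finset.sum_eq_zero]
    exact fun j _ => h.integral_fderiv_truncFlux (by linarith [hm n]) j
  have hE0 : ∀ x, 0 ≤ energy w x := fun x => Finset.sum_nonneg fun _ _ => by positivity
  have hint : Integrable (U.indicator fun x => μ * energy w x) := by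
    refine hb.mono' (aestronglyMeasurable_of_tendsto_ae atTop hmeas
      (.of_forall fun x => h.tendsto_sum_fderiv_truncFlux h0 x)) (.of_forall fun x => ?_)
    exact le_of_tendsto (h.tendsto_sum_fderiv_truncFlux h0 x).norm
      (.of_forall fun n => hK _ (hm n) x)
  have hae := (integral_eq_zero_iff_of_nonneg (fun x => Set.indicator_nonneg
    (fun x _ => mul_nonneg hμ.le (hE0 x)) x) hint).1 hint0
  have hae' : (fun x => μ * energy w x) =ᵐ[volume.restrict U] fun _ => 0 := by
    filter_upwards [ae_restrict_of_ae hae, ae_restrict_mem h.isOpen.measurableSet] with y h1 h2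
    rwa [Set.indicator_of_mem h2] at h1
  have hcont : ContinuousOn (fun x => μ * energy w x) U :=
    continuousOn_const.mul (continuousOn_finsetSum _ fun j _ =>
      ((h.contDiffOn_fderiv.continuousOn.clm_apply continuousOn_const).norm.pow 2))
  have hz : energy w x = 0 := by
    have := Measure.eqOn_open_of_ae_eq hae' h.isOpen hcont continuousOn_const hx
    exact (mul_eq_zero.1 this).resolve_left hμ.ne'
  have hj : ∀ j, fderiv ℝ w x (stdVec j) = 0 := fun j => by
    have := (Finset.sum_eq_zero_iff_of_nonneg (fun j _ => by positivity)).1 hz j (Finset.mem_univ j)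
    exact norm_eq_zero.1 (pow_eq_zero_iff two_ne_zero |>.1 this)
  refine ContinuousLinearMap.coe_injective
    ((EuclideanSpace.basisFun (Fin 2) ℝ).toBasis.ext fun j => ?_)
  simpa [stdVec] using hj j

/-- The energy argument applies on the open set where `w ≠ 0`, whose boundary values are again zero.
Continuity of the gradient extends the result to the closure, and off the closure `w` is locally
zero. -/
theorem fderiv_eq_zero (hμ : 0 < μ) (h : HomStokes μ U w q) {x : Plane} (hx : x ∈ U) :
    fderiv ℝ w x = 0 := by
  set V : Set Plane := {y ∈ U | w y ≠ 0} with hV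
  have hVU : V ⊆ U := fun y hy => hy.1
  have hcw : ContinuousOn w U := h.velocity.continuousOn
  have hVo : IsOpen V := hcw.isOpen_inter_preimage h.isOpen isOpen_compl_singleton
  have hHom : HomStokes μ V w q :=
    { isOpen := hVo
      velocity := h.velocity.mono hVU
      pressure := h.pressure.mono hVU
      momentum := fun y hy => h.momentum y hy.1
      incompressible := fun y hy => h.incompressible y hy.1
      vanishing := fun y hy ε hε => by
        by_cases hyU : y ∈ U
        · have hy0 : w y = 0 := by
            by_contra hne
            exact hy ⟨hyU, hne⟩
          have := (hcw.continuousAt (h.isOpen.mem_nhds hyU)).norm.eventually_lt_const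
            (by simpa [hy0] using hε : ‖w y‖ < ε)
          filter_upwards [this] with z hz _ using hz
        · filter_upwards [h.vanishing y hyU ε hε] with z hz hzV using hz hzV.1
      bounded := by
        obtain ⟨A, hA⟩ := h.bounded
        exact ⟨A, fun y hy => hA y hy.1⟩ }
  by_cases hxV : x ∈ closure V
  · have hc : ContinuousAt (fderiv ℝ w) x :=
      h.contDiffOn_fderiv.continuousOn.continuousAt (h.isOpen.mem_nhds hx)
    have : fderiv ℝ w x ∈ closure {0} := hc.continuousWithinAt.mem_closure hxV
      fun y hy => hHom.fderiv_eq_zero_of_ne_zero hμ (fun z hz => hz.2) hy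
    simpa using this
  · have : w =ᶠ[𝓝 x] fun _ => 0 := by
      filter_upwards [h.isOpen.mem_nhds hx, isClosed_closure.isOpen_compl.mem_nhds hxV]
        with y hy hy'
      by_contra hne
      exact hy' (subset_closure ⟨hy, hne⟩)
    rw [this.fderiv_eq]
    simp

theorem fderiv_pressure_eq_zero (hμ : 0 < μ) (h : HomStokes μ U w q) {x : Plane} (hx : x ∈ U) :
    fderiv ℝ q x = 0 := by
  have hU := h.isOpen.mem_nhds hx
  have e : ∀ j, (fun y => fderiv ℝ w y (stdVec j)) =ᶠ[𝓝 x] fun _ => 0 := fun j => by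
    filter_upwards [hU] with y hy
    rw [h.fderiv_eq_zero hμ hy]
    rfl
  have hg : ∇ q x = 0 := by
    rw [← h.momentum x hx, laplacian_eq_sum (h.velocity.contDiffAt hU), Finset.sum_eq_zero,
      smul_zero]
    intro j _
    rw [(e j).fderiv_eq]
    simp
  ext v
  rw [← inner_gradient_left, hg]
  simp

end HomStokes

end

section

open Filter Topology

/-! ### Uniqueness of the gradient and of the pressure -/

theorem HomStokes.pressure_eq_zero {μ : ℝ} {U : Set Plane} {w : Plane → Plane} {q : Plane → ℝ}
    (hμ : 0 < μ) (h : HomStokes μ U w q) {x v : Plane} (hv : v ≠ 0)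
    (hray : ∀ t : ℝ, 0 ≤ t → x + t • v ∈ U) : q x = 0 := by
  obtain ⟨A, hA⟩ := h.bounded
  have hd : ∀ t : ℝ, 0 ≤ t → HasDerivAt (fun t : ℝ => q (x + t • v)) 0 t := fun t ht => by
    have hU := hray t ht
    have h1 : HasFDerivAt q (0 : Plane →L[ℝ] ℝ) (x + t • v) := by
      rw [← h.fderiv_pressure_eq_zero hμ hU]
      exact ((h.pressure.contDiffAt (h.isOpen.mem_nhds hU)).differentiableAt
        (by norm_num)).hasFDerivAt
    have h2 : HasDerivAt (fun t : ℝ => x + t • v) v t := by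
      simpa using ((hasDerivAt_id t).smul_const v).const_add x
    exact h1.comp_hasDerivAt t h2
  have hconst : ∀ t : ℝ, 0 ≤ t → q (x + t • v) = q x := fun t ht => by
    have := constant_of_has_deriv_right_zero (a := 0) (b := t)
      (fun s hs => (hd s hs.1).continuousAt.continuousWithinAt)
      (fun s hs => (hd s hs.1).hasDerivWithinAt) t ⟨ht, le_rfl⟩
    simpa using this
  have hnorm : Tendsto (fun t : ℝ => 1 + ‖x + t • v‖) atTop atTop := by
    have h1 : Tendsto (fun t : ℝ => t * ‖v‖ + (1 - ‖x‖)) atTop atTop :=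
      tendsto_atTop_add_const_right _ _ (tendsto_id.atTop_mul_const (norm_pos_iff.2 hv))
    refine tendsto_atTop_mono' _ ?_ h1
    filter_upwards [eventually_ge_atTop (0 : ℝ)] with t ht
    have h2 := norm_sub_norm_le (t • v) (-x)
    rw [norm_neg, sub_neg_eq_add, add_comm (t • v), norm_smul, Real.norm_of_nonneg ht] at h2
    linarith
  have hlim : Tendsto (fun t : ℝ => A * ((1 + ‖x + t • v‖)⁻¹) ^ 2) atTop (𝓝 0) := by
    simpa using ((tendsto_inv_atTop_zero.comp hnorm).pow 2).const_mul A
  have : |q x| ≤ 0 := by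
    refine ge_of_tendsto hlim ?_
    filter_upwards [eventually_ge_atTop (0 : ℝ)] with t ht
    rw [← hconst t ht]
    exact (hA _ (hray t ht)).2.2
  exact abs_eq_zero.1 (le_antisymm this (abs_nonneg _))

/-- Both centres lie on the horizontal axis, so moving vertically away from that axis does not
decrease the distance to either. -/
theorem exists_ray_exterior {R : ℝ} (hR : 0 < R) {δ : ℝ} {x : Plane} (hx : x ∈ exterior R δ) :
    ∃ v : Plane, v ≠ 0 ∧ ∀ t : ℝ, 0 ≤ t → x + t • v ∈ exterior R δ := by
  have key : ∀ s : ℝ, 0 ≤ s * x 1 → ∀ c t : ℝ, 0 ≤ t →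
      dist x !₂[c, 0] ≤ dist (x + t • (!₂[0, s] : Plane)) !₂[c, 0] := fun s hs c t ht => by
    rw [EuclideanSpace.dist_eq, EuclideanSpace.dist_eq]
    refine Real.sqrt_le_sqrt ?_
    simp only [Fin.sum_univ_two, Real.dist_eq, sq_abs]
    simp
    nlinarith [mul_nonneg ht hs, sq_nonneg (t * s)]
  obtain ⟨s, hs0, hs⟩ : ∃ s : ℝ, s ≠ 0 ∧ 0 ≤ s * x 1 := by
    rcases le_total 0 (x 1) with h | h
    · exact ⟨1, one_ne_zero, by linarith⟩
    · exact ⟨-1, by norm_num, by linarith⟩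
  refine ⟨!₂[0, s], fun h => hs0 ?_, fun t ht => ?_⟩
  · simpa using congrArg (fun v : Plane => v 1) h
  · rw [mem_exterior_iff hR] at hx ⊢
    exact ⟨hx.1.trans_le (key s hs _ t ht), hx.2.trans_le (key s hs _ t ht)⟩

/-! ### Global bounds from decay and regularity up to the boundary. -/

theorem exists_bound_of_isBigO {E : Type*} [NormedAddCommGroup E] {f : Plane → E} {U : Set Plane}
    {k : ℕ} (hf : f =O[cobounded Plane] fun x => (‖x‖ ^ k)⁻¹)
    (hb : ∀ ρ : ℝ, ∃ C, ∀ x ∈ U, ‖x‖ ≤ ρ → ‖f x‖ ≤ C) :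
    ∃ A, ∀ x ∈ U, ‖f x‖ ≤ A * ((1 + ‖x‖)⁻¹) ^ k := by
  obtain ⟨C₁, hC₁0, hC₁⟩ := hf.exists_pos
  obtain ⟨ρ, -, hρ⟩ := hasBasis_cobounded_norm.eventually_iff.1 hC₁.bound
  obtain ⟨C₂, hC₂⟩ := hb (max ρ 1)
  refine ⟨max (C₁ * 2 ^ k) (|C₂| * (1 + max ρ 1) ^ k), fun x hx => ?_⟩
  have hr : 0 < 1 + ‖x‖ := by positivity
  rw [inv_pow, ← div_eq_mul_inv, le_div_iff₀ (by positivity)]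
  rcases le_total ‖x‖ (max ρ 1) with h | h
  · refine le_trans ?_ (le_max_right _ _)
    have := (hC₂ x hx h).trans (le_abs_self _)
    gcongr
  · refine le_trans ?_ (le_max_left _ _)
    have h1 : 1 ≤ ‖x‖ := (le_max_right _ _).trans h
    have h2 := hρ ((le_max_left ρ 1).trans h)
    rw [Real.norm_of_nonneg (by positivity), ← div_eq_mul_inv,
      le_div_iff₀ (by positivity)] at h2
    calc ‖f x‖ * (1 + ‖x‖) ^ k ≤ ‖f x‖ * (2 * ‖x‖) ^ k := by gcongr; linarith
      _ = ‖f x‖ * ‖x‖ ^ k * 2 ^ k := by rw [mul_pow]; ring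
      _ ≤ _ := by gcongr

theorem exists_bound_of_continuousOn_closure {E : Type*} [NormedAddCommGroup E] {f : Plane → E}
    {U : Set Plane} (hf : ContinuousOn f (closure U)) (ρ : ℝ) :
    ∃ C, ∀ x ∈ U, ‖x‖ ≤ ρ → ‖f x‖ ≤ C := by
  have hK : IsCompact (closure U ∩ Metric.closedBall 0 ρ) :=
    (isCompact_closedBall 0 ρ).inter_left isClosed_closure
  obtain ⟨C, hC⟩ := hK.exists_bound_of_continuousOn (hf.mono Set.inter_subset_left)
  exact ⟨C, fun x hx hxρ => hC x ⟨subset_closure hx, mem_closedBall_zero_iff.2 hxρ⟩⟩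

/-- Near each point of the closure there is a derivative within the closure that is continuous,
hence locally bounded; on the open set it is the ordinary derivative. Compactness makes the local
bounds uniform. -/
theorem exists_bound_fderiv_of_contDiffOn_closure {u : Plane → Plane} {U : Set Plane}
    (hU : IsOpen U) (hu : ContDiffOn ℝ 1 u (closure U)) (ρ : ℝ) :
    ∃ C, ∀ x ∈ U, ‖x‖ ≤ ρ → ‖fderiv ℝ u x‖ ≤ C := by
  have hK : IsCompact (closure U ∩ Metric.closedBall 0 ρ) :=
    (isCompact_closedBall 0 ρ).inter_left isClosed_closure
  have key : ∃ C, ∀ x ∈ closure U ∩ Metric.closedBall 0 ρ, x ∈ U → ‖fderiv ℝ u x‖ ≤ C := by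
    refine hK.induction_on (p := fun s => ∃ C, ∀ x ∈ s, x ∈ U → ‖fderiv ℝ u x‖ ≤ C)
      ⟨0, fun x hx => hx.elim⟩ (fun s t hst ⟨C, hC⟩ => ⟨C, fun x hx => hC x (hst hx)⟩)
      (fun s t ⟨C, hC⟩ ⟨D, hD⟩ => ⟨max C D, fun x hx hxU => hx.elim
        (fun h => (hC x h hxU).trans (le_max_left _ _))
        (fun h => (hD x h hxU).trans (le_max_right _ _))⟩) fun x hx => ?_
    have hux : ContDiffWithinAt ℝ (0 + 1) u (closure U) x := by
      rw [zero_add]; exact hu x hx.1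
    obtain ⟨V, hV, -, f', hf', hc⟩ :=
      (contDiffWithinAt_succ_iff_hasFDerivWithinAt (by simp)).1 hux
    rw [Set.insert_eq_of_mem hx.1] at hV
    have hb : ∀ᶠ y in 𝓝[V] x, ‖f' y‖ < ‖f' x‖ + 1 :=
      hc.continuousWithinAt.norm.eventually_lt_const (by linarith)
    rw [eventually_nhdsWithin_iff] at hb
    obtain ⟨W, hWo, hxW, hWV⟩ := mem_nhdsWithin.1 hV
    refine ⟨W ∩ {y | y ∈ V → ‖f' y‖ < ‖f' x‖ + 1},
      mem_nhdsWithin_of_mem_nhds (inter_mem (hWo.mem_nhds hxW) hb), ‖f' x‖ + 1, fun y hy hyU => ?_⟩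
    have hyV : V ∈ 𝓝 y := by
      filter_upwards [hWo.mem_nhds hy.1, hU.mem_nhds hyU] with z h1 h2
      exact hWV ⟨h1, subset_closure h2⟩
    rw [((hf' y (mem_of_mem_nhds hyV)).hasFDerivAt hyV).fderiv]
    exact (hy.2 (mem_of_mem_nhds hyV)).le
  obtain ⟨C, hC⟩ := key
  exact ⟨C, fun x hx hxρ => hC x ⟨subset_closure hx, mem_closedBall_zero_iff.2 hxρ⟩ hx⟩

namespace IsRotSolution

variable {μ R δ : ℝ} {u u' : Plane → Plane} {p p' : Plane → ℝ}

theorem bounded (h : IsRotSolution μ R δ u p) : ∃ A, ∀ x ∈ exterior R δ, ‖u x‖ ≤ A ∧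
    ‖fderiv ℝ u x‖ ≤ A * ((1 + ‖x‖)⁻¹) ^ 2 ∧ |p x| ≤ A * ((1 + ‖x‖)⁻¹) ^ 2 := by
  obtain ⟨⟨C, hC⟩, hdu, hp⟩ := h.decay
  have hu : u =O[cobounded Plane] fun x => (‖x‖ ^ 0)⁻¹ := by
    have h1 : (fun x => u x - C) =O[cobounded Plane] fun _ => (1 : ℝ) :=
      hC.trans ((tendsto_inv_atTop_zero.comp
        (tendsto_norm_cobounded_atTop (E := Plane))).isBigO_one ℝ)
    have h2 := h1.add (isBigO_const_const C (one_ne_zero (α := ℝ)) (cobounded Plane))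
    simpa using h2
  obtain ⟨A₁, h₁⟩ := exists_bound_of_isBigO hu
    (exists_bound_of_continuousOn_closure h.velocity_closure.continuousOn)
  obtain ⟨A₂, h₂⟩ := exists_bound_of_isBigO hdu
    (exists_bound_fderiv_of_contDiffOn_closure (isOpen_exterior R δ) h.velocity_closure)
  obtain ⟨A₃, h₃⟩ := exists_bound_of_isBigO hp
    (exists_bound_of_continuousOn_closure h.pressure_closure)
  refine ⟨max A₁ (max A₂ A₃), fun x hx => ⟨?_, ?_, ?_⟩⟩
  · refine (h₁ x hx).trans ?_
    rw [pow_zero, mul_one]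
    exact le_max_left _ _
  · refine (h₂ x hx).trans ?_
    gcongr
    exact (le_max_left _ _).trans (le_max_right _ _)
  · refine (h₃ x hx).trans ?_
    gcongr
    exact (le_max_right _ _).trans (le_max_right _ _)

theorem homStokes_sub (hR : 0 < R) (h : IsRotSolution μ R δ u p) (h' : IsRotSolution μ R δ u' p') :
    HomStokes μ (exterior R δ) (u - u') (p - p') := by
  have hU := isOpen_exterior R δ
  have hd : ∀ {u p}, IsRotSolution μ R δ u p → ∀ {x}, x ∈ exterior R δ → DifferentiableAt ℝ u x :=
    fun h x hx => (h.velocity_interior.contDiffAt (hU.mem_nhds hx)).differentiableAt (by norm_num)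
  have hdp : ∀ {u p}, IsRotSolution μ R δ u p → ∀ {x}, x ∈ exterior R δ → DifferentiableAt ℝ p x :=
    fun h x hx => (h.pressure_interior.contDiffAt (hU.mem_nhds hx)).differentiableAt (by norm_num)
  have hfd : ∀ x ∈ exterior R δ, fderiv ℝ (u - u') x = fderiv ℝ u x - fderiv ℝ u' x :=
    fun x hx => fderiv_sub (hd h hx) (hd h' hx)
  refine ⟨hU, h.velocity_interior.sub h'.velocity_interior,
    h.pressure_interior.sub h'.pressure_interior, fun x hx => ?_, fun x hx => ?_,
    fun x hx ε hε => ?_, ?_⟩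
  · rw [ContDiffAt.laplacian_sub (h.velocity_interior.contDiffAt (hU.mem_nhds hx))
      (h'.velocity_interior.contDiffAt (hU.mem_nhds hx)), smul_sub, h.momentum x hx,
      h'.momentum x hx, gradient, gradient, gradient, fderiv_sub (hdp h hx) (hdp h' hx), map_sub]
  · have e1 := h.incompressible x hx
    have e2 := h'.incompressible x hx
    simp only [divergence, Matrix.trace_fin_two, velGrad, Matrix.of_apply] at e1 e2 ⊢
    rw [hfd x hx]
    simp only [sub_apply, PiLp.sub_apply]
    linarith
  · by_cases hxc : x ∈ closure (exterior R δ)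
    · have hx0 : (u - u') x = 0 := by
        have hfr : x ∈ frontier (disk1 R δ) ∪ frontier (disk2 R δ) := by
          rw [disk1, disk2, frontier_ball _ hR.ne', frontier_ball _ hR.ne']
          obtain ⟨h1, h2⟩ := le_dist_of_mem_closure_exterior hR hxc
          rw [mem_exterior_iff hR, not_and_or, not_lt, not_lt] at hx
          -- A point of the closure outside the open exterior is at distance exactly `R` from one of
          -- the centres, so both boundary conditions apply there.
          exact hx.imp (fun h => le_antisymm h h1) (fun h => le_antisymm h h2)
        rw [Pi.sub_apply, h.boundary x hfr, h'.boundary x hfr, sub_self]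
      have hc := ((h.velocity_closure.continuousOn.sub h'.velocity_closure.continuousOn) x
        hxc).norm.eventually_lt_const (by rw [hx0, norm_zero]; exact hε : ‖(u - u') x‖ < ε)
      filter_upwards [eventually_nhdsWithin_iff.1 hc] with y hy hyU using hy (subset_closure hyU)
    · filter_upwards [isClosed_closure.isOpen_compl.mem_nhds hxc] with y hy hyU
      exact (hy (subset_closure hyU)).elim
  · obtain ⟨A, hA⟩ := h.bounded
    obtain ⟨A', hA'⟩ := h'.bounded
    refine ⟨A + A', fun x hx => ?_⟩
    obtain ⟨a1, a2, a3⟩ := hA x hx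
    obtain ⟨b1, b2, b3⟩ := hA' x hx
    rw [hfd x hx, add_mul]
    exact ⟨(norm_sub_le _ _).trans (add_le_add a1 b1), (norm_sub_le _ _).trans (add_le_add a2 b2),
      (abs_sub _ _).trans (add_le_add a3 b3)⟩

theorem fderiv_eq (hR : 0 < R) (hμ : 0 < μ) (h : IsRotSolution μ R δ u p)
    (h' : IsRotSolution μ R δ u' p') {x : Plane} (hx : x ∈ exterior R δ) :
    fderiv ℝ u x = fderiv ℝ u' x := by
  have hU := (isOpen_exterior R δ).mem_nhds hx
  have e := (homStokes_sub hR h h').fderiv_eq_zero hμ hx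
  rw [fderiv_sub ((h.velocity_interior.contDiffAt hU).differentiableAt (by norm_num))
    ((h'.velocity_interior.contDiffAt hU).differentiableAt (by norm_num))] at e
  exact sub_eq_zero.1 e

theorem pressure_eq (hR : 0 < R) (hμ : 0 < μ) (h : IsRotSolution μ R δ u p)
    (h' : IsRotSolution μ R δ u' p') {x : Plane} (hx : x ∈ exterior R δ) : p x = p' x := by
  obtain ⟨v, hv, hray⟩ := exists_ray_exterior hR hx
  exact sub_eq_zero.1 ((homStokes_sub hR h h').pressure_eq_zero hμ hv hray)

end IsRotSolution

end

end StokesTwoDisks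

end

/-! ### Transfer of the bounds to arbitrary solutions. -/

theorem mainTheorem7 (R μ : ℝ) (hR : 0 < R) (hμ : 0 < μ) :
    (∀ δ : ℝ, 0 < δ → ∃ (h : StokesTwoDisks.Plane → StokesTwoDisks.Plane)
        (p : StokesTwoDisks.Plane → ℝ), StokesTwoDisks.IsRotSolution μ R δ h p) ∧
      ∀ δ₀ : ℝ, 0 < δ₀ → ∃ C : ℝ, ∀ δ : ℝ, 0 < δ → δ ≤ δ₀ →
        ∀ (h : StokesTwoDisks.Plane → StokesTwoDisks.Plane) (p : StokesTwoDisks.Plane → ℝ),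
          StokesTwoDisks.IsRotSolution μ R δ h p →
          (∀ x ∈ StokesTwoDisks.exterior R δ, ∀ i j : Fin 2,
            |StokesTwoDisks.strain h x i j| ≤ C) ∧
          (∀ x ∈ StokesTwoDisks.exterior R δ, |p x| ≤ C) ∧
          (∀ x ∈ StokesTwoDisks.exterior R δ, ∀ i j : Fin 2,
            |StokesTwoDisks.stress μ h p x i j| ≤ C) := by
  refine ⟨fun δ hδ => ?_, fun δ₀ hδ₀ => ?_⟩
  · obtain ⟨α, hα, hc, -⟩ := StokesTwoDisks.exists_bipolar hR hδ
    exact ⟨_, _, StokesTwoDisks.isRotSolution_sol hα hR rfl hc⟩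
  · obtain ⟨K, hK⟩ := StokesTwoDisks.exists_bound_sol hR hμ hδ₀
    refine ⟨K + (2 * μ * K + 2 * μ * K), fun δ hδ hδ' h p hsol => ?_⟩
    obtain ⟨u, q, hu, hb⟩ := hK δ hδ hδ'
    have hp : ∀ x ∈ StokesTwoDisks.exterior R δ, |p x| ≤ 2 * μ * K := fun x hx => by
      rw [hsol.pressure_eq hR hμ hu hx]
      exact (hb x hx).2
    have hs : ∀ x ∈ StokesTwoDisks.exterior R δ, ∀ i j, |StokesTwoDisks.strain h x i j| ≤ K :=
      fun x hx i j => (StokesTwoDisks.abs_strain_le h x i j).trans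
        -- Strain depends on the velocity only through its gradient, so uniqueness of the gradient
        -- is enough.
        (hsol.fderiv_eq hR hμ hu hx ▸ (hb x hx).1)
    refine ⟨fun x hx i j => ?_, fun x hx => ?_, fun x hx i j => ?_⟩
    all_goals
      have hK0 : 0 ≤ K := (norm_nonneg _).trans (hb x hx).1
      have hK1 : 0 ≤ 2 * μ * K := by positivity
    · linarith [hs x hx i j]
    · linarith [hp x hx]
    · have h1 := StokesTwoDisks.abs_stress_le hμ h p x i j
      have h2 := mul_le_mul_of_nonneg_left (hs x hx i j) (by positivity : 0 ≤ 2 * μ)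
      linarith [hp x hx]
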